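/- Let $(W,S)$ be a Coxeter system of finite rank with length function $\ell$. Let $\widehat S$ be a set partition of $S$ into blocks $I$ whose parabolic subgroups $W_I=\langle I\rangle$ are finite, let $r_I$ be the longest element of $W_I$, and let $\widehat W\le W$ be the subgroup generated by $R=\{r_I : I\in\widehat S\}$. The partition is *admissible* if for every $w\in\widehat W$ and every $I\in\widehat S$ either $\ell(ws)=\ell(w)+1$ for all $s\in I$, or $\ell(ws)=\ell(w)-1$ for all $s\in I$. In that case $\widehat W$ is called a *folding subgroup* of $W$, and its *unfolding series* is the formal power series $$U_{\widehat W}^{W}(q)=\sum_{w\in\widehat W}q^{\ell(w)} .$$ Write $[k]_t=1+t+\cdots+t^{k-1}$. The affine Coxeter groups below have generators $s_0,\dots,s_m$ and the following Coxeter graphs (edges without label have label $3$): * $\widetilde A_m$ ($m\ge2$): the cycle $s_0 - s_1-\cdots-s_m-s_0$; * $\widetilde B_m$ ($m\ge3$): the path $s_0-s_1-\cdots-s_{m-1}$ with $s_0-s_1$ labelled $4$, and $s_m$ joined to $s_{m-2}$; * $\widetilde C_m$ ($m\ge2$): the path $s_0-s_1-\cdots-s_m$ with the first and the last edge labelled $4$;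 * $\widetilde D_m$ ($m\ge4$): the path $s_1-s_2-\cdots-s_{m-1}$, with $s_0$ joined to $s_2$ and $s_m$ joined to $s_{m-2}$. **Theorem.** Let $n\ge2$. In each of the cases below, the indicated elements $r_0,\dots,r_n$ of $W$ are the longest elements of the parabolic subgroups generated by the blocks of an admissible partition of $S$ (the block of $r_i$ being the set of the $s_j$ that occur in the given expression for $r_i$), and the folding subgroup $\widehat W=\langle r_0,\dots,r_n\rangle$ is a Coxeter group of type $\widetilde C_n$ with respect to the generators $r_0,\dots,r_n$ in this order: 1. $W=\widetilde A_{2n+1}$: $r_0=s_0s_{2n+1}s_0$, $r_n=s_ns_{n+1}s_n$, $r_i=s_is_{2n+1-i}$ for $0<i<n$; 2. $W=\widetilde A_{2n}$: $r_0=s_0s_{2n}s_0$, $r_n=s_n$, $r_i=s_is_{2n-i}$ for $0<i<n$; 3. $W=\widetilde A_{2n-1}$: $r_0=s_0$, $r_n=s_n$, $r_i=s_is_{2n-i}$ for $0<i<n$; 4. $W=\widetilde B_{n+1}$: $r_i=s_i$ for $i<n$, $r_n=s_ns_{n+1}$; 5. $W=\widetilde D_{n+2}$: $r_0=s_0s_1$,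 $r_n=s_{n+1}s_{n+2}$, $r_i=s_{i+1}$ for $0<i<n$; 6. $W=\widetilde C_{2n+1}$: $r_i=s_is_{2n+1-i}$ for $i<n$, $r_n=s_ns_{n+1}s_n$; 7. $W=\widetilde C_{2n}$: $r_i=s_is_{2n-i}$ for $i<n$, $r_n=s_n$. The corresponding unfolding series are, as formal power series in $q$: 1. $\displaystyle U_{\widetilde C_n}^{\widetilde A_{2n+1}}(q)=[n+1]_{-q}\,[n+1]_{(-1)^{n+1}q}\prod_{\substack{k=1\\k\ne n+1}}^{2n+1}\frac{[k]_{(-1)^kq}}{1+(-q)^k}$ 2. $\displaystyle U_{\widetilde C_n}^{\widetilde A_{2n}}(q)=\prod_{k=1}^{2n}\frac{[k+1]_{(-1)^{k+1}q}}{1+(-q)^k}$ 3. $\displaystyle U_{\widetilde C_n}^{\widetilde A_{2n-1}}(q)=\prod_{k=2}^{2n}\frac{[k]_{(-1)^kq}}{1+(-q)^{k-1}}$ 4. $\displaystyle U_{\widetilde C_n}^{\widetilde B_{n+1}}(q)=\frac{[2]_q[3]_{-q}[4]_q[2]_{-q^{n+1}}}{(1-q)(1-q^3)(1-q^5)}\prod_{k=3}^n\frac{[2k+1]_q-q^k}{1-q^{2k+1}}$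 5. $\displaystyle U_{\widetilde C_n}^{\widetilde D_{n+2}}(q)=[2]_q[3]_{-q}[4]_q\Bigl(\prod_{k=3}^n\bigl([2k+1]_q-q^k\bigr)\Bigr)\prod_{k=1}^n\frac{1+q^{k+1}}{1-q^{n+k+2}}$ 6. $\displaystyle U_{\widetilde C_n}^{\widetilde C_{2n+1}}(q)=\Bigl(\prod_{k=1}^{2n+1}[k]_{(-1)^kq}\Bigr)\prod_{k=1}^n\frac{1+q^{2k}}{1-q^{2(n+k)+1}}$ 7. $\displaystyle U_{\widetilde C_n}^{\widetilde C_{2n}}(q)=\Bigl(\prod_{k=1}^{2n}[k]_{(-1)^kq}\Bigr)\prod_{k=1}^n\frac{1+q^{2k}}{1-q^{2(n+k)-1}}$ -/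

import Mathlib

open PowerSeries

namespace CoxeterFolding

/-! ### Folding subgroups of a Coxeter system -/

section Folding

variable {B W ι : Type*} [Group W] {M : CoxeterMatrix B}

/-- The standard parabolic subgroup `W_J`. -/
def parabolic (cs : CoxeterSystem M W) (J : Set B) : Subgroup W :=
  Subgroup.closure (cs.simple '' J)

/-- `r` is the element of maximal length of `W_J`. -/
def IsLongestElement (cs : CoxeterSystem M W) (J : Set B) (r : W) : Prop :=
  r ∈ parabolic cs J ∧ ∀ w ∈ parabolic cs J, w ≠ r → cs.length w < cs.length r

/-- The subgroup `Ŵ` of `W` generated by the elements `r i`. -/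
def foldingSubgroup (r : ι → W) : Subgroup W :=
  Subgroup.closure (Set.range r)

/-- The set partition of the simple generators into the fibres of `p : B → ι` is admissible, each
block generates a finite parabolic subgroup, and `r i` is the longest element of the parabolic
subgroup of the `i`-th block. -/
structure IsAdmissible (cs : CoxeterSystem M W) (p : B → ι) (r : ι → W) : Prop where
  surjective : Function.Surjective p
  finite : ∀ i, Finite (parabolic cs (p ⁻¹' {i}))
  longest : ∀ i, IsLongestElement cs (p ⁻¹' {i}) (r i)
  admissible : ∀ w ∈ foldingSubgroup r, ∀ i,
    (∀ b, p b = i → cs.length (w * cs.simple b) = cs.length w + 1) ∨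
    (∀ b, p b = i → cs.length (w * cs.simple b) + 1 = cs.length w)

/-- The admissible partition `p` realizes the Coxeter group with Coxeter matrix `M'` as the folding
subgroup `Ŵ` of `W`: with its generators `r i` (in this order), `Ŵ` is a Coxeter system of
type `M'`. -/
structure IsFolding (cs : CoxeterSystem M W) (p : B → ι) (r : ι → W)
    (M' : CoxeterMatrix ι) : Prop extends IsAdmissible cs p r where
  coxeter : ∃ cs' : CoxeterSystem M' (foldingSubgroup r), ∀ i, (cs'.simple i : W) = r i

/-- Finite rank Coxeter groups have finitely many elements of each length, so that the
coefficients of `unfoldingSeries` below are genuine cardinalities. -/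
theorem finite_length_eq [Finite B] (cs : CoxeterSystem M W) (H : Subgroup W) (m : ℕ) :
    Finite {w : H // cs.length (w : W) = m} := by
  have hfin : {w : W | cs.length w = m}.Finite := by
    refine ((List.finite_length_eq B m).image cs.wordProd).subset ?_
    intro w hw
    obtain ⟨ω, hω, rfl⟩ := cs.exists_isReduced w
    exact ⟨ω, hω.symm.trans hw, rfl⟩
  have := hfin.to_subtype
  refine Finite.of_injective (β := {w : W | cs.length w = m}) (fun w => ⟨w.1.1, w.2⟩) ?_
  intro x y h
  exact Subtype.ext (Subtype.ext (by simpa using h))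

/-- The unfolding series `∑_{w ∈ Ŵ} q ^ ℓ(w)`, where `ℓ` is the length function of the ambient
group `W`, as a formal power series in `q`. -/
noncomputable def unfoldingSeries (cs : CoxeterSystem M W) (r : ι → W) : ℚ⟦X⟧ :=
  PowerSeries.mk fun m => (Nat.card {w : foldingSubgroup r // cs.length (w : W) = m} : ℚ)

end Folding

/-! ### The affine Coxeter graphs -/

/-- The Coxeter matrix on the vertices `0, …, m` in which the entry at `i < j` is `e i j`. -/
def ofLabels (m : ℕ) (e : ℕ → ℕ → ℕ) (he : ∀ i j, e i j ≠ 1) : CoxeterMatrix (Fin (m + 1)) where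
  M := Matrix.of fun i j => if i = j then 1 else e (min i.val j.val) (max i.val j.val)
  isSymm := by
    ext i j
    simp only [Matrix.transpose_apply, Matrix.of_apply]
    rw [min_comm, max_comm]
    simp only [eq_comm]
  diagonal i := by simp
  off_diagonal i j h := by simpa [h] using he _ _

/-- Type `Ã_m` (for `m ≥ 2`): the cycle `0 — 1 — ⋯ — m — 0`. -/
def affineA (m : ℕ) : CoxeterMatrix (Fin (m + 1)) :=
  ofLabels m (fun i j => if j = i + 1 ∨ (i = 0 ∧ j = m) then 3 else 2)
    (by intro i j; split_ifs <;> simp)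

/-- Type `B̃_m` (for `m ≥ 3`): the path `0 — 1 — ⋯ — m - 1` whose edge `0 — 1` has label `4`,
with the vertex `m` joined to `m - 2`. -/
def affineB (m : ℕ) : CoxeterMatrix (Fin (m + 1)) :=
  ofLabels m (fun i j => if i = 0 ∧ j = 1 then 4
      else if (j = i + 1 ∧ j < m) ∨ (i + 2 = m ∧ j = m) then 3 else 2)
    (by intro i j; split_ifs <;> simp)

/-- Type `C̃_m` (for `m ≥ 2`): the path `0 — 1 — ⋯ — m` whose first and last edges have
label `4`. -/
def affineC (m : ℕ) : CoxeterMatrix (Fin (m + 1)) :=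
  ofLabels m (fun i j => if j = i + 1 then (if i = 0 ∨ j = m then 4 else 3) else 2)
    (by intro i j; split_ifs <;> simp)

/-- Type `D̃_m` (for `m ≥ 4`): the path `1 — 2 — ⋯ — m - 1`, with the vertex `0` joined to `2` and
the vertex `m` joined to `m - 2`. -/
def affineD (m : ℕ) : CoxeterMatrix (Fin (m + 1)) :=
  ofLabels m (fun i j =>
      if (i = 0 ∧ j = 2) ∨ (1 ≤ i ∧ j = i + 1 ∧ j < m) ∨ (i + 2 = m ∧ j = m) then 3 else 2)
    (by intro i j; split_ifs <;> simp)

/-- The simple generator `s_k` of the Coxeter group of `M`, for `k ≤ m`. -/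
def gen {m : ℕ} (M : CoxeterMatrix (Fin (m + 1))) (k : ℕ) : M.Group :=
  M.simple (Fin.ofNat (m + 1) k)

/-! ### The seven foldings: blocks of the partition and images of the generators `r_0, …, r_n` -/

/-- The partition of `s_0, …, s_m` with blocks `{s_i, s_{c-i}}` for `0 ≤ i ≤ n` (where `s_k` is
dropped for `k > m`), used for `c ∈ {2n, 2n+1}` and `m ∈ {c-1, c}`. -/
def reflectBlock (n m c : ℕ) (j : Fin (m + 1)) : Fin (n + 1) :=
  Fin.ofNat (n + 1) (min j.val (c - j.val))

/-- The partition of `s_0, …, s_{n+1}` with blocks `{s_0}, …, {s_{n-1}}, {s_n, s_{n+1}}`. -/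
def forkBlock (n : ℕ) (j : Fin (n + 1 + 1)) : Fin (n + 1) :=
  Fin.ofNat (n + 1) (min j.val n)

/-- The partition of `s_0, …, s_{n+2}` with blocks
`{s_0, s_1}, {s_2}, …, {s_n}, {s_{n+1}, s_{n+2}}`. -/
def doubleForkBlock (n : ℕ) (j : Fin (n + 2 + 1)) : Fin (n + 1) :=
  Fin.ofNat (n + 1) (min (j.val - 1) n)

/-- `C̃_n → Ã_{2n+1}`. -/
def fold₁ (n : ℕ) (i : Fin (n + 1)) : (affineA (2 * n + 1)).Group :=
  let s := gen (affineA (2 * n + 1))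
  if i.val = 0 then s 0 * s (2 * n + 1) * s 0
  else if i.val = n then s n * s (n + 1) * s n
  else s i.val * s (2 * n + 1 - i.val)

/-- `C̃_n → Ã_{2n}`. -/
def fold₂ (n : ℕ) (i : Fin (n + 1)) : (affineA (2 * n)).Group :=
  let s := gen (affineA (2 * n))
  if i.val = 0 then s 0 * s (2 * n) * s 0
  else if i.val = n then s n
  else s i.val * s (2 * n - i.val)

/-- `C̃_n → Ã_{2n-1}`. -/
def fold₃ (n : ℕ) (i : Fin (n + 1)) : (affineA (2 * n - 1)).Group :=
  let s := gen (affineA (2 * n - 1))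
  if i.val = 0 then s 0
  else if i.val = n then s n
  else s i.val * s (2 * n - i.val)

/-- `C̃_n → B̃_{n+1}`. -/
def fold₄ (n : ℕ) (i : Fin (n + 1)) : (affineB (n + 1)).Group :=
  let s := gen (affineB (n + 1))
  if i.val = n then s n * s (n + 1)
  else s i.val

/-- `C̃_n → D̃_{n+2}`. -/
def fold₅ (n : ℕ) (i : Fin (n + 1)) : (affineD (n + 2)).Group :=
  let s := gen (affineD (n + 2))
  if i.val = 0 then s 0 * s 1
  else if i.val = n then s (n + 1) * s (n + 2)
  else s (i.val + 1)

/-- `C̃_n → C̃_{2n+1}`. -/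
def fold₆ (n : ℕ) (i : Fin (n + 1)) : (affineC (2 * n + 1)).Group :=
  let s := gen (affineC (2 * n + 1))
  if i.val = n then s n * s (n + 1) * s n
  else s i.val * s (2 * n + 1 - i.val)

/-- `C̃_n → C̃_{2n}`. -/
def fold₇ (n : ℕ) (i : Fin (n + 1)) : (affineC (2 * n)).Group :=
  let s := gen (affineC (2 * n))
  if i.val = n then s n
  else s i.val * s (2 * n - i.val)

/-- The `q`-integer `[k]_t = 1 + t + ⋯ + t ^ (k - 1)`. -/
noncomputable def qInt (k : ℕ) (t : ℚ⟦X⟧) : ℚ⟦X⟧ :=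
  ∑ i ∈ Finset.range k, t ^ i

end CoxeterFolding

open CoxeterFolding

namespace CoxeterFolding

/-! ### Positivity of roots along ascents -/

section Ascent

variable {B W V : Type*} [Group W] {M : CoxeterMatrix B} (cs : CoxeterSystem M W)

open CoxeterSystem

/-! All groups involved have labels 2, 3, 4, so `W` acts on `B → ℤ` through an integral Cartan
matrix, and `b` is a right descent of `w` exactly if `w` sends the simple root of `b` to a
nonpositive vector. This positivity is proved in an abstract form,
`apply_mem_of_not_isRightDescent`: for any action of a Coxeter group and any family of sets `Δ i`,
it suffices to control short alternating words in two generators.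

The abstract form is used twice. With `Δ i` a single simple root it gives the usual root positivity
for `W`. With `Δ i` the simple roots of a whole block it applies to the abstract group of type `M'`,
acting through the homomorphism φ that sends its generators to the `r i`. Hence φ turns a descent
`i` into descents at all elements of block `i`, and a non-descent into non-descents. Admissibility
follows; φ is injective because a nontrivial element has a descent; and ℓ(φ(w sᵢ)) = ℓ(φ(w)) + ℓ(rᵢ)
at every ascent. So a folding can be recognized on pairs of blocks (`isFolding_of_blocks`). Here a
pair is either orthogonal or one of six configurations of rank at most 4, settled by matrix
computations.

The unfolding series is therefore the Poincaré series of C̃_n with weights a = ℓ(r_0), b = ℓ(r_i)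
for 0 < i < n, and c = ℓ(r_n). Put t = q^b. In `levelSeries_affineC`, let D_j be the set of elements
with descent set {0, …, j-1}. Then D_0 = {1}, D_{n+1} is empty because C̃_n is infinite, and D_j ∪
D_{j+1} consists of minimal coset representatives times the longest element of the type B parabolic
on 0, …, j-1. The alternating sum of these unions telescopes to 1. On the other hand each term is
the full series times q^{L(w₀)}, with w₀ that longest element, divided by two weighted Poincaré
polynomials of type B (`levelSeries_parabolic_path`). Over a common denominator the sum is evaluated
by `qVandermonde`, which yields a product formula in a, b, c.

The seven formulas come from the weights (3,2,3), (3,2,1), (1,2,1), (1,1,2), (2,1,2), (2,2,3),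
(2,2,1) and elementary product identities, chiefly `prod_one_sub_pow_upper`. -/

theorem length_mul_wordProd_le (v : W) (ω : List B) :
    cs.length (v * cs.wordProd ω) ≤ cs.length v + ω.length :=
  (cs.length_mul_le _ _).trans (Nat.add_le_add_left (cs.length_wordProd_le ω) _)

/-- An element with a right descent `j` and without the right descent `i` factors through the
rank two parabolic subgroup of `i` and `j`: the left factor has neither `i` nor `j` as a right
descent, the right factor is an alternating word shorter than the braid word. -/
theorem exists_alternating_factorization {w : W} {i j : B} (hi : ¬ cs.IsRightDescent w i)
    (hj : cs.IsRightDescent w j) :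
    ∃ (k : ℕ) (v : W), w = v * cs.wordProd (alternatingWord i j k) ∧
      cs.length v < cs.length w ∧ (M i j ≠ 0 → k < M i j) ∧
      ¬ cs.IsRightDescent v i ∧ ¬ cs.IsRightDescent v j := by
  classical
  -- `Q k` says that `w` ends, without loss of length, in the alternating word of length `k` with
  -- last letter `j`. The largest such `k` is taken.
  let Q : ℕ → Prop := fun k => ∃ v : W, w = v * cs.wordProd (alternatingWord i j k) ∧
    cs.length w = cs.length v + k
  have hQ1 : Q 1 := by
    refine ⟨w * cs.simple j, by simp [alternatingWord], ?_⟩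
    rw [cs.isRightDescent_iff] at hj
    exact hj.symm
  have hbd : ∀ k, Q k → k ≤ cs.length w := by
    rintro k ⟨v, -, h⟩
    omega
  set k := Nat.findGreatest Q (cs.length w) with hk
  have hk1 : 1 ≤ k := Nat.le_findGreatest (hbd 1 hQ1) hQ1
  obtain ⟨v, hv, hl⟩ : Q k := Nat.findGreatest_spec (hbd 1 hQ1) hQ1
  have hmax : ¬ Q (k + 1) := by
    intro h
    have := Nat.le_findGreatest (hbd _ h) h
    omega
  -- A descent of `v` at the letter that would come next would extend the word, against maximality.
  have hyp : ∀ x, x = (if Even k then j else i) → ¬ cs.IsRightDescent v x := by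
    intro x hx hd
    apply hmax
    refine ⟨v * cs.simple x, ?_, ?_⟩
    · rw [alternatingWord_succ', ← hx, wordProd_cons, mul_assoc,
        simple_mul_simple_cancel_left, ← hv]
    · rw [cs.isRightDescent_iff] at hd
      omega
  -- A descent of `v` at the first letter of the word would cancel against it and make `w` shorter.
  have hyp2 : ∀ x, x = (if Even (k - 1) then j else i) → ¬ cs.IsRightDescent v x := by
    intro x hx hd
    have h1 : w = v * cs.simple x * cs.wordProd (alternatingWord i j (k - 1)) := by
      conv_lhs => rw [hv]
      conv_lhs => rw [show k = k - 1 + 1 by omega]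
      rw [alternatingWord_succ', ← hx, wordProd_cons, mul_assoc]
    have h2 := length_mul_wordProd_le cs (v * cs.simple x) (alternatingWord i j (k - 1))
    rw [← h1, length_alternatingWord] at h2
    unfold CoxeterSystem.IsRightDescent at hd
    omega
  refine ⟨k, v, hv, by omega, ?_, ?_, ?_⟩
  -- If the word contained a full braid word, the braid relation would let `w` end in `i`, making
  -- `i` a descent.
  · intro hM
    by_contra hcon
    rw [not_lt] at hcon
    apply hi
    -- split off the last `M i j` letters
    have key : ∀ d, d ≤ k → ∃ v' : W, w = v' * cs.wordProd (alternatingWord i j (k - d)) ∧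
        cs.length w = cs.length v' + (k - d) := by
      intro d hd
      induction d with
      | zero => exact ⟨v, hv, hl⟩
      | succ d ih =>
        obtain ⟨v', h1, h2⟩ := ih (by omega)
        rw [show k - d = k - (d + 1) + 1 by omega, alternatingWord_succ', wordProd_cons,
          ← mul_assoc] at h1
        refine ⟨_, h1, ?_⟩
        have h3 := length_mul_wordProd_le cs _ (alternatingWord i j (k - (d + 1))) |>.trans'
          (le_of_eq (congrArg cs.length h1))
        rw [length_alternatingWord] at h3
        have h4 := cs.length_mul_le v' (cs.simple (if Even (k - (d + 1)) then j else i))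
        rw [cs.length_simple] at h4
        omega
    obtain ⟨v', h1, h2⟩ := key (k - M i j) (by omega)
    rw [show k - (k - M i j) = M i j by omega] at h1 h2
    have h5 : cs.wordProd (alternatingWord i j (M i j)) =
        cs.wordProd (alternatingWord j i (M i j)) := by
      have := cs.wordProd_braidWord_eq i j
      simp only [braidWord, M.symmetric j i] at this
      exact this
    obtain ⟨d, hd⟩ : ∃ d, M i j = d + 1 := Nat.exists_eq_succ_of_ne_zero hM
    rw [h5, hd, alternatingWord_succ, wordProd_concat, ← mul_assoc] at h1
    unfold CoxeterSystem.IsRightDescent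
    have h6 : w * cs.simple i = v' * cs.wordProd (alternatingWord i j d) := by
      conv_lhs => rw [h1]
      rw [simple_mul_simple_cancel_right]
    have h7 := length_mul_wordProd_le cs v' (alternatingWord i j d)
    rw [← h6, length_alternatingWord] at h7
    omega
  · by_cases he : Even k
    · apply hyp2
      have : ¬ Even (k - 1) := by
        rw [Nat.even_sub hk1]; simp [he]
      simp [this]
    · apply hyp; simp [he]
  · by_cases he : Even k
    · apply hyp; simp [he]
    · apply hyp2
      have : Even (k - 1) := by
        rw [Nat.even_sub hk1]; simp [he]
      simp [this]

/-- Suppose that `W` acts on `V` and that, for each pair `i ≠ j`, the alternating words ending in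
`j` that are shorter than the braid word map `Δ i` into the cone spanned by `Δ i ∪ Δ j`. Then every
`w` without the right descent `i` maps `Δ i` into any cone containing all `Δ j`. -/
theorem apply_mem_of_not_isRightDescent [AddCommMonoid V] (ρ : W →* AddMonoid.End V)
    (Δ : B → Set V) (P : AddSubmonoid V) (hΔ : ∀ i, Δ i ⊆ P)
    (hρ : ∀ i j, i ≠ j → ∀ k, (M i j ≠ 0 → k < M i j) → ∀ v ∈ Δ i,
      ρ (cs.wordProd (alternatingWord i j k)) v ∈ AddSubmonoid.closure (Δ i ∪ Δ j))
    (w : W) (i : B) (hi : ¬ cs.IsRightDescent w i) {x : V} (hx : x ∈ Δ i) : ρ w x ∈ P := by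
  induction hn : cs.length w using Nat.strong_induction_on generalizing w i x with
  | _ n ih =>
    by_cases hw : w = 1
    · subst hw
      simpa using hΔ i hx
    obtain ⟨j, hj⟩ := cs.exists_rightDescent_of_ne_one hw
    have hij : i ≠ j := by rintro rfl; exact hi hj
    obtain ⟨k, v, rfl, hlt, hk, hvi, hvj⟩ := exists_alternating_factorization cs hi hj
    rw [map_mul]
    change ρ v (ρ _ x) ∈ P
    have hmem := hρ i j hij k hk x hx
    -- The left factor is shorter and has neither `i` nor `j` as a descent, so by induction it maps
    -- both `Δ i` and `Δ j` into `P`.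
    have hle : AddSubmonoid.closure (Δ i ∪ Δ j) ≤ P.comap (ρ v) := by
      rw [AddSubmonoid.closure_le]
      rintro y (hy | hy)
      · exact ih _ (hn ▸ hlt) v i hvi hy rfl
      · exact ih _ (hn ▸ hlt) v j hvj hy rfl
    exact hle hmem

end Ascent

/-! ### The reflection representation of an integral Cartan matrix -/

section Cartan

set_option linter.unusedSimpArgs false

variable {B W : Type*} [Group W] {M : CoxeterMatrix B}

open CoxeterSystem

/-- `A` is an integral Cartan matrix for the Coxeter matrix `M`, all of whose labels are at
most `4`. -/
structure IsCartan (M : CoxeterMatrix B) (A : B → B → ℤ) : Prop where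
  diag : ∀ i, A i i = 2
  off : ∀ i j, i ≠ j → (M i j = 2 ∧ A i j = 0 ∧ A j i = 0) ∨
    (M i j = 3 ∧ A i j = -1 ∧ A j i = -1) ∨
    (M i j = 4 ∧ A i j = -1 ∧ A j i = -2) ∨ (M i j = 4 ∧ A i j = -2 ∧ A j i = -1)

variable [Fintype B] [DecidableEq B]

/-- The coroot `v ↦ ∑ j, A i j * v j`. -/
def coroot (A : B → B → ℤ) (i : B) : (B → ℤ) →+ ℤ where
  toFun v := ∑ j, A i j * v j
  map_zero' := by simp
  map_add' v w := by simp [mul_add, Finset.sum_add_distrib]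

/-- The reflection `v ↦ v - ⟨v, αᵢ^∨⟩ αᵢ`. -/
def reflection (A : B → B → ℤ) (i : B) : AddMonoid.End (B → ℤ) where
  toFun v := v - coroot A i v • Pi.single i 1
  map_zero' := by simp
  map_add' v w := by rw [map_add, add_smul]; abel

theorem coroot_single (A : B → B → ℤ) (i j : B) : coroot A i (Pi.single j 1) = A i j := by
  simp [coroot, Pi.single_apply]

theorem reflection_apply (A : B → B → ℤ) (i : B) (v : B → ℤ) :
    reflection A i v = v - coroot A i v • Pi.single i 1 := rfl

theorem reflection_single (A : B → B → ℤ) (i j : B) :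
    reflection A i (Pi.single j 1) = Pi.single j 1 - A i j • Pi.single i 1 := by
  rw [reflection_apply, coroot_single]

theorem coroot_reflection (A : B → B → ℤ) (i j : B) (v : B → ℤ) :
    coroot A j (reflection A i v) = coroot A j v - coroot A i v * A j i := by
  rw [reflection_apply, map_sub, map_zsmul, coroot_single, smul_eq_mul]

/-- The product T of two reflections changes `v` by multiples of two simple roots whose coefficients
depend only on the two coroot values of `v`, and T acts linearly on that pair of values (`h1`,
`h2`). Since labels are at most 4, iterating this at most four times verifies the relation. -/
theorem isLiftable_reflection {A : B → B → ℤ} (hA : IsCartan M A) :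
    M.IsLiftable (reflection A) := by
  intro i j
  by_cases hij : i = j
  · subst hij
    rw [M.diagonal, pow_one]
    ext1 v
    change reflection A i (reflection A i v) = v
    rw [reflection_apply, coroot_reflection, hA.diag, reflection_apply]
    module
  · have hexp : ∀ v, (reflection A i * reflection A j) v = v
        - coroot A j v • Pi.single j 1
        - (coroot A i v - coroot A j v * A i j) • Pi.single i 1 := by
      intro v
      change reflection A i (reflection A j v) = _
      rw [reflection_apply, coroot_reflection, reflection_apply]
    have h1 : ∀ v, coroot A i ((reflection A i * reflection A j) v) =
        - coroot A i v + coroot A j v * A i j := by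
      intro v
      rw [hexp, map_sub, map_sub, map_zsmul, map_zsmul, coroot_single, coroot_single, hA.diag]
      simp only [smul_eq_mul]
      ring
    have h2 : ∀ v, coroot A j ((reflection A i * reflection A j) v) =
        - coroot A j v - coroot A i v * A j i + coroot A j v * A i j * A j i := by
      intro v
      rw [hexp, map_sub, map_sub, map_zsmul, map_zsmul, coroot_single, coroot_single, hA.diag]
      simp only [smul_eq_mul]
      ring
    have hpow : ∀ (k : ℕ) v, ((reflection A i * reflection A j) ^ (k + 1)) v =
        ((reflection A i * reflection A j) ^ k) ((reflection A i * reflection A j) v) := by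
      intro k v
      rw [pow_succ]; rfl
    have hpow0 : ∀ v, ((reflection A i * reflection A j) ^ 0) v = v := by
      intro v; rw [pow_zero]; rfl
    ext1 v
    change _ = v
    rcases hA.off i j hij with ⟨h, ha, hb⟩ | ⟨h, ha, hb⟩ | ⟨h, ha, hb⟩ | ⟨h, ha, hb⟩ <;>
    · rw [h]
      rw [ha] at h1 h2 hexp
      rw [hb] at h2
      simp only [hpow, hpow0]
      generalize hT : reflection A i * reflection A j = T at *
      try rw [hexp (T (T (T v)))]; simp only [h1, h2]
      try rw [hexp (T (T v))]; simp only [h1, h2]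
      rw [hexp (T v)]; simp only [h1, h2]
      rw [hexp v]
      module

/-- The reflection representation of `W` on `B → ℤ`. -/
noncomputable def rootRep (cs : CoxeterSystem M W) {A : B → B → ℤ} (hA : IsCartan M A) :
    W →* AddMonoid.End (B → ℤ) :=
  cs.lift ⟨reflection A, isLiftable_reflection hA⟩

variable (cs : CoxeterSystem M W) {A : B → B → ℤ} (hA : IsCartan M A)

@[simp]
theorem rootRep_simple (i : B) : rootRep cs hA (cs.simple i) = reflection A i :=
  cs.lift_apply_simple _ _

theorem rootRep_mul_apply (w w' : W) (v : B → ℤ) :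
    rootRep cs hA (w * w') v = rootRep cs hA w (rootRep cs hA w' v) := by
  rw [map_mul]; rfl

theorem rootRep_one_apply (v : B → ℤ) : rootRep cs hA 1 v = v := by
  rw [map_one]; rfl

theorem rootRep_simple_single (i j : B) : rootRep cs hA (cs.simple i) (Pi.single j 1) =
    Pi.single j 1 - A i j • Pi.single i 1 := by
  rw [rootRep_simple, reflection_single]

/-- A simple root is mapped to a nonnegative vector by each `w` of which it is no descent. -/
theorem rootRep_single_nonneg {w : W} {i : B} (h : ¬ cs.IsRightDescent w i) :
    0 ≤ rootRep cs hA w (Pi.single i 1) := by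
  let P : AddSubmonoid (B → ℤ) := AddSubmonoid.nonneg _
  refine apply_mem_of_not_isRightDescent cs (rootRep cs hA) (fun i => {Pi.single i 1}) P ?_ ?_
    w i h (x := Pi.single i 1) rfl
  · rintro i _ rfl
    exact (Pi.single_nonneg.2 zero_le_one : (0 : B → ℤ) ≤ _)
  · rintro i j hij k hk _ rfl
    have hi : (Pi.single i 1 : B → ℤ) ∈
        AddSubmonoid.closure ({Pi.single i 1} ∪ {Pi.single j 1} : Set (B → ℤ)) :=
      AddSubmonoid.subset_closure (by simp)
    have hj : (Pi.single j 1 : B → ℤ) ∈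
        AddSubmonoid.closure ({Pi.single i 1} ∪ {Pi.single j 1} : Set (B → ℤ)) :=
      AddSubmonoid.subset_closure (by simp)
    have comb : ∀ (x : B → ℤ) (a b : ℕ), x = a • (Pi.single i 1) + b • (Pi.single j 1) →
        x ∈ AddSubmonoid.closure ({Pi.single i 1} ∪ {Pi.single j 1} : Set (B → ℤ)) := by
      rintro x a b rfl
      exact add_mem (nsmul_mem hi a) (nsmul_mem hj b)
    have hii := rootRep_simple_single cs hA i i
    have hjj := rootRep_simple_single cs hA j j
    have hij' := rootRep_simple_single cs hA i j
    have hji := rootRep_simple_single cs hA j i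
    rw [hA.diag] at hii hjj
    -- Only words of length at most 3 are shorter than a braid word.
    have hk4 : k < 4 := by
      rcases hA.off i j hij with ⟨h, -⟩ | ⟨h, -⟩ | ⟨h, -⟩ | ⟨h, -⟩ <;> rw [h] at hk <;> omega
    rcases hA.off i j hij with ⟨h, ha, hb⟩ | ⟨h, ha, hb⟩ | ⟨h, ha, hb⟩ | ⟨h, ha, hb⟩ <;>
    · rw [ha] at hij'
      rw [hb] at hji
      rw [h] at hk
      interval_cases k
      all_goals first
        | (exfalso; omega)
        | skip
      all_goals
        simp only [alternatingWord, List.concat_eq_append, List.nil_append, wordProd_cons,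
          wordProd_nil, rootRep_mul_apply, rootRep_one_apply, List.cons_append,
          hij', hji, hii, hjj, map_sub, map_zsmul]
      -- These are the positive roots that occur in types A₁ × A₁, A₂ and both orientations of B₂.
      all_goals first
        | exact comb _ 1 0 (by module)
        | exact comb _ 1 1 (by module)
        | exact comb _ 0 1 (by module)
        | exact comb _ 1 2 (by module)

theorem rootRep_single_ne_zero (w : W) (i : B) : rootRep cs hA w (Pi.single i 1) ≠ 0 := by
  intro h
  have := rootRep_mul_apply cs hA w⁻¹ w (Pi.single i 1)
  rw [h, map_zero, inv_mul_cancel, rootRep_one_apply] at this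
  have := congrFun this i
  simp at this

/-- A simple root is mapped to a nonpositive vector by each `w` of which it is a descent. -/
theorem rootRep_single_nonpos {w : W} {i : B} (h : cs.IsRightDescent w i) :
    rootRep cs hA w (Pi.single i 1) ≤ 0 := by
  rw [cs.isRightDescent_iff_not_isRightDescent_mul] at h
  have := rootRep_single_nonneg cs hA h
  rw [rootRep_mul_apply, rootRep_simple_single, hA.diag,
    show (Pi.single i 1 - (2 : ℤ) • Pi.single i 1 : B → ℤ) = - Pi.single i 1 by module,
    map_neg] at this
  exact neg_nonneg.1 this

/-- The image of a simple root is never zero, so the two signs exclude each other and the sign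
detects descents. -/
theorem isRightDescent_of_nonpos {w : W} {i : B}
    (h : rootRep cs hA w (Pi.single i 1) ≤ 0) : cs.IsRightDescent w i := by
  by_contra hc
  exact rootRep_single_ne_zero cs hA w i (le_antisymm h (rootRep_single_nonneg cs hA hc))

theorem not_isRightDescent_of_nonneg {w : W} {i : B}
    (h : 0 ≤ rootRep cs hA w (Pi.single i 1)) : ¬ cs.IsRightDescent w i := fun hc =>
  rootRep_single_ne_zero cs hA w i (le_antisymm (rootRep_single_nonpos cs hA hc) h)

end Cartan

/-! ### Parabolic subgroups and minimal coset representatives -/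

section Parabolic

variable {B W : Type*} [Group W] {M : CoxeterMatrix B}

open CoxeterSystem

theorem simple_mem_parabolic (cs : CoxeterSystem M W) {K : Set B} {i : B} (hi : i ∈ K) :
    cs.simple i ∈ parabolic cs K :=
  Subgroup.subset_closure ⟨i, hi, rfl⟩

theorem parabolic_mono (cs : CoxeterSystem M W) {K K' : Set B} (h : K ⊆ K') :
    parabolic cs K ≤ parabolic cs K' :=
  Subgroup.closure_mono (Set.image_mono h)

theorem wordProd_mem_parabolic (cs : CoxeterSystem M W) {K : Set B} {ω : List B}
    (h : ∀ b ∈ ω, b ∈ K) : cs.wordProd ω ∈ parabolic cs K := by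
  induction ω with
  | nil => simp
  | cons b ω ih =>
    rw [wordProd_cons]
    exact mul_mem (simple_mem_parabolic cs (h b (by simp)))
      (ih fun b' hb' => h b' (by simp [hb']))

theorem parabolic_induction_right (cs : CoxeterSystem M W) {K : Set B} {p : W → Prop}
    (one : p 1) (mul_simple : ∀ w i, w ∈ parabolic cs K → i ∈ K → p w → p (w * cs.simple i))
    {w : W} (hw : w ∈ parabolic cs K) : p w := by
  induction hw using Subgroup.closure_induction_right with
  | one => exact one
  | mul_right x hx y hy ih =>
    obtain ⟨i, hi, rfl⟩ := hy
    exact mul_simple x i hx hi ih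
  | mul_inv_cancel x hx y hy ih =>
    obtain ⟨i, hi, rfl⟩ := hy
    rw [cs.inv_simple]
    exact mul_simple x i hx hi ih

theorem parabolic_induction_left (cs : CoxeterSystem M W) {K : Set B} {p : W → Prop}
    (one : p 1) (simple_mul : ∀ w i, w ∈ parabolic cs K → i ∈ K → p w → p (cs.simple i * w))
    {w : W} (hw : w ∈ parabolic cs K) : p w := by
  induction hw using Subgroup.closure_induction_left with
  | one => exact one
  | mul_left x hx y hy ih =>
    obtain ⟨i, hi, rfl⟩ := hx
    exact simple_mul y i hy hi ih
  | inv_mul_cancel x hx y hy ih =>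
    obtain ⟨i, hi, rfl⟩ := hx
    rw [cs.inv_simple]
    exact simple_mul y i hy hi ih

/-- The minimal representatives of the left cosets of `W_K`. -/
def minReps (cs : CoxeterSystem M W) (K : Set B) : Set W :=
  {w | ∀ i ∈ K, ¬ cs.IsRightDescent w i}

/-- Descents in `K` are stripped off one at a time; the length drops, so this stops. -/
theorem exists_minReps_mul (cs : CoxeterSystem M W) (K : Set B) (w : W) :
    ∃ u ∈ minReps cs K, ∃ x ∈ parabolic cs K, w = u * x := by
  induction hn : cs.length w using Nat.strong_induction_on generalizing w with
  | _ n ih =>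
    by_cases h : w ∈ minReps cs K
    · exact ⟨w, h, 1, one_mem _, by simp⟩
    · simp only [minReps, Set.mem_ofPred_eq, not_forall, not_not] at h
      obtain ⟨i, hi, hd⟩ := h
      obtain ⟨u, hu, x, hx, hux⟩ := ih _ (hn ▸ hd) (w * cs.simple i) rfl
      exact ⟨u, hu, x * cs.simple i, mul_mem hx (simple_mem_parabolic cs hi), by
        rw [← mul_assoc, ← hux, simple_mul_simple_cancel_right]⟩

variable [Fintype B] [DecidableEq B] (cs : CoxeterSystem M W) {A : B → B → ℤ}

/-- Elements of `W_K` preserve the span of the simple roots of `K`. -/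
theorem rootRep_apply_eq_zero_of_notMem (hA : IsCartan M A) {K : Set B} {x : W}
    (hx : x ∈ parabolic cs K)
    {v : B → ℤ} (hv : ∀ j ∉ K, v j = 0) : ∀ j ∉ K, rootRep cs hA x v j = 0 := by
  revert v
  refine parabolic_induction_right cs (p := fun x => ∀ {v : B → ℤ}, (∀ j ∉ K, v j = 0) →
    ∀ j ∉ K, rootRep cs hA x v j = 0) ?_ ?_ hx
  · intro v hv
    simpa [rootRep_one_apply] using hv
  · intro w i _ hi ih v hv
    rw [rootRep_mul_apply, rootRep_simple]
    refine ih fun j hj => ?_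
    have hij : j ≠ i := by rintro rfl; exact hj hi
    simp [reflection_apply, hv j hj, hij]

/-- Elements of `W_K` fix the simple roots that are orthogonal to `K`. -/
theorem rootRep_single_of_orthogonal (hA : IsCartan M A) {K : Set B} {x : W}
    (hx : x ∈ parabolic cs K) (b : B) (hb : ∀ a ∈ K, A a b = 0) :
    rootRep cs hA x (Pi.single b 1) = Pi.single b 1 := by
  refine parabolic_induction_right cs
    (p := fun x => rootRep cs hA x (Pi.single b 1) = Pi.single b 1)
    (rootRep_one_apply cs hA _) ?_ hx
  intro w a _ ha ih
  rw [rootRep_mul_apply, rootRep_simple_single, hb a ha, zero_smul, sub_zero, ih]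

theorem rootRep_nonneg_of_mem_minReps (hA : IsCartan M A) {K : Set B} {u : W}
    (hu : u ∈ minReps cs K) {v : B → ℤ}
    (hv : ∀ j ∉ K, v j = 0) (hv0 : 0 ≤ v) : 0 ≤ rootRep cs hA u v := by
  have hsum : v = ∑ j, v j • (Pi.single j 1 : B → ℤ) := by
    ext k
    simp [Finset.sum_apply, Pi.single_apply]
  rw [hsum, map_sum]
  refine Finset.sum_nonneg fun j _ => ?_
  rw [map_zsmul]
  by_cases hj : j ∈ K
  · exact smul_nonneg (hv0 j) (rootRep_single_nonneg cs hA (hu j hj))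
  · rw [hv j hj, zero_smul]

/-- The image of a simple root of `K` under `x` stays in the span of the roots of `K`, where a
minimal representative preserves signs. -/
theorem isRightDescent_mul_iff (hA : IsCartan M A) {K : Set B} {u x : W} (hu : u ∈ minReps cs K)
    (hx : x ∈ parabolic cs K) {i : B} (hi : i ∈ K) :
    cs.IsRightDescent (u * x) i ↔ cs.IsRightDescent x i := by
  have hz : ∀ j ∉ K, rootRep cs hA x (Pi.single i 1) j = 0 :=
    rootRep_apply_eq_zero_of_notMem cs hA hx fun j hj => by
      have : j ≠ i := by rintro rfl; exact hj hi
      simp [this]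
  constructor
  · intro h
    by_contra hc
    refine not_isRightDescent_of_nonneg cs hA ?_ h
    rw [rootRep_mul_apply]
    exact rootRep_nonneg_of_mem_minReps cs hA hu hz (rootRep_single_nonneg cs hA hc)
  · intro h
    apply isRightDescent_of_nonpos cs hA
    rw [rootRep_mul_apply, ← neg_nonneg, ← map_neg]
    refine rootRep_nonneg_of_mem_minReps cs hA hu (fun j hj => ?_)
      (neg_nonneg.2 (rootRep_single_nonpos cs hA h))
    rw [Pi.neg_apply, hz j hj, neg_zero]

/-- Right multiplication by a simple reflection of `K` raises or lowers the lengths of `x` and `u *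
x` simultaneously. -/
theorem length_mul_of_mem_minReps (hA : IsCartan M A) {K : Set B} {u x : W} (hu : u ∈ minReps cs K)
    (hx : x ∈ parabolic cs K) : cs.length (u * x) = cs.length u + cs.length x := by
  refine parabolic_induction_right cs
    (p := fun x => cs.length (u * x) = cs.length u + cs.length x) ?_ ?_ hx
  · simp
  · intro w i hw hi ih
    have := isRightDescent_mul_iff cs hA hu hw hi
    rw [← mul_assoc]
    by_cases h : cs.IsRightDescent w i
    · have h' := this.2 h
      rw [cs.isRightDescent_iff] at h h'
      omega
    · have h' := mt this.1 h
      rw [cs.not_isRightDescent_iff] at h h'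
      omega

/-- Additivity of length applied to `x * x⁻¹` leaves no room for a positive length. -/
theorem eq_one_of_mem_minReps (hA : IsCartan M A) {K : Set B} {x : W} (hx : x ∈ parabolic cs K)
    (h : x ∈ minReps cs K) : x = 1 := by
  have := length_mul_of_mem_minReps cs hA h (inv_mem hx)
  rw [mul_inv_cancel, cs.length_one] at this
  exact cs.length_eq_zero_iff.1 (by omega)

/-- An element of `W_K` that maps the simple roots of `K` to nonnegative vectors is trivial. -/
theorem eq_one_of_nonneg (hA : IsCartan M A) {K : Set B} {x : W} (hx : x ∈ parabolic cs K)
    (h : ∀ i ∈ K, 0 ≤ rootRep cs hA x (Pi.single i 1)) : x = 1 :=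
  eq_one_of_mem_minReps cs hA hx fun i hi => not_isRightDescent_of_nonneg cs hA (h i hi)

/-- If two representatives differ by y ∈ W_K, then ℓ(u') = ℓ(u) + ℓ(y) and ℓ(u) = ℓ(u') + ℓ(y⁻¹),
which forces y = 1. -/
theorem eq_of_mul_eq_mul (hA : IsCartan M A) {K : Set B} {u u' x x' : W} (hu : u ∈ minReps cs K)
    (hu' : u' ∈ minReps cs K) (hx : x ∈ parabolic cs K) (hx' : x' ∈ parabolic cs K)
    (h : u * x = u' * x') : u = u' ∧ x = x' := by
  have hy : x * x'⁻¹ ∈ parabolic cs K := mul_mem hx (inv_mem hx')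
  have h1 : u' = u * (x * x'⁻¹) := by rw [← mul_assoc, h, mul_inv_cancel_right]
  have h2 := length_mul_of_mem_minReps cs hA hu hy
  have h3 := length_mul_of_mem_minReps cs hA hu' (inv_mem hy)
  rw [← h1] at h2
  rw [h1, mul_inv_cancel_right, ← h1, cs.length_inv] at h3
  have h4 : x * x'⁻¹ = 1 := cs.length_eq_zero_iff.1 (by omega)
  rw [h4, mul_one] at h1
  exact ⟨h1.symm, mul_inv_eq_one.1 h4⟩

/-- Both factors turn simple roots of `K` into nonpositive vectors, and `y` stays within the span of
`K`; the two signs cancel, so the product has no descent in `K`. -/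
theorem mul_eq_one_of_descents (hA : IsCartan M A) {K : Set B} {x y : W} (hx : x ∈ parabolic cs K)
    (hy : y ∈ parabolic cs K) (hdx : ∀ i ∈ K, cs.IsRightDescent x i)
    (hdy : ∀ i ∈ K, cs.IsRightDescent y i) : x * y = 1 := by
  refine eq_one_of_nonneg cs hA (mul_mem hx hy) fun i hi => ?_
  rw [rootRep_mul_apply]
  have hz : ∀ j ∉ K, rootRep cs hA y (Pi.single i 1) j = 0 :=
    rootRep_apply_eq_zero_of_notMem cs hA hy fun j hj => by
      have : j ≠ i := by rintro rfl; exact hj hi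
      simp [this]
  set v := rootRep cs hA y (Pi.single i 1) with hv
  have hv0 : v ≤ 0 := rootRep_single_nonpos cs hA (hdy i hi)
  have hsum : v = ∑ j, v j • (Pi.single j 1 : B → ℤ) := by
    ext k
    simp [Finset.sum_apply, Pi.single_apply]
  rw [hsum, map_sum]
  refine Finset.sum_nonneg fun j _ => ?_
  rw [map_zsmul]
  by_cases hj : j ∈ K
  · exact smul_nonneg_of_nonpos_of_nonpos (hv0 j) (rootRep_single_nonpos cs hA (hdx j hj))
  · rw [hz j hj, zero_smul]

/-- The longest element of `W_K` is the only one with all descents in `K`. -/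
theorem eq_of_descents (hA : IsCartan M A) {K : Set B} {x y : W} (hx : x ∈ parabolic cs K)
    (hy : y ∈ parabolic cs K) (hdx : ∀ i ∈ K, cs.IsRightDescent x i)
    (hdy : ∀ i ∈ K, cs.IsRightDescent y i) : x = y := by
  -- Both `x` and `y` are inverse to `y`.
  have h1 := mul_eq_one_of_descents cs hA hx hy hdx hdy
  have h2 := mul_eq_one_of_descents cs hA hy hy hdy hdy
  exact mul_right_cancel (h1.trans h2.symm)

end Parabolic

/-! ### A local criterion for foldings -/

section AltProd

/-- The alternating product of `k` factors `x` and `y` that ends with `y`. -/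
def altProd {G : Type*} [Monoid G] : ℕ → G → G → G
  | 0, _, _ => 1
  | k + 1, x, y => altProd k y x * y

theorem map_altProd {G H : Type*} [Monoid G] [Monoid H] (φ : G →* H) (k : ℕ) (x y : G) :
    φ (altProd k x y) = altProd k (φ x) (φ y) := by
  induction k generalizing x y with
  | zero => simp [altProd]
  | succ k ih => simp [altProd, ih]

theorem wordProd_alternatingWord {B W : Type*} [Group W] {M : CoxeterMatrix B}
    (cs : CoxeterSystem M W) (i j : B) (k : ℕ) :
    cs.wordProd (CoxeterSystem.alternatingWord i j k) = altProd k (cs.simple i) (cs.simple j) := by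
  induction k generalizing i j with
  | zero => simp [altProd, CoxeterSystem.alternatingWord]
  | succ k ih =>
    rw [CoxeterSystem.alternatingWord, CoxeterSystem.wordProd_concat, ih, altProd]

end AltProd

section Criterion

variable {B W ι : Type*} [Group W] {M : CoxeterMatrix B} [Fintype B] [DecidableEq B]
  (cs : CoxeterSystem M W) {A : B → B → ℤ} (hA : IsCartan M A) (p : B → ι) (r : ι → W)

/-- The simple roots of the `i`-th block. -/
def blockRoots (p : B → ι) (i : ι) : Set (B → ℤ) :=
  {v | ∃ b, p b = i ∧ v = Pi.single b 1}

/-- The dihedral part of the folding condition, for the blocks `i` and `j`: the elements `r i` and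
`r j` satisfy the braid relation of length `m`, and short alternating products map the simple roots
of one of the two blocks to nonnegative combinations of the simple roots of both blocks. -/
structure IsBlockPair (i j : ι) (m : ℕ) : Prop where
  rel : (r i * r j) ^ m = 1
  rel' : (r j * r i) ^ m = 1
  pos : ∀ k < m, ∀ v ∈ blockRoots p i,
    rootRep cs hA (altProd k (r i) (r j)) v ∈
      AddSubmonoid.closure (blockRoots p i ∪ blockRoots p j)
  pos' : ∀ k < m, ∀ v ∈ blockRoots p j,
    rootRep cs hA (altProd k (r j) (r i)) v ∈
      AddSubmonoid.closure (blockRoots p j ∪ blockRoots p i)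

theorem IsBlockPair.symm {i j : ι} {m : ℕ} (h : IsBlockPair cs hA p r i j m) :
    IsBlockPair cs hA p r j i m :=
  ⟨h.rel', h.rel, h.pos', h.pos⟩

/-- The part of the folding condition that concerns a single block. -/
structure IsBlock (i : ι) : Prop where
  nonempty : ∃ b, p b = i
  finite : Finite (parabolic cs (p ⁻¹' {i}))
  longest : IsLongestElement cs (p ⁻¹' {i}) (r i)
  sq : r i * r i = 1
  neg : ∀ b, p b = i → ∃ b', p b' = i ∧ rootRep cs hA (r i) (Pi.single b 1) = - Pi.single b' 1

variable {M' : CoxeterMatrix ι}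

theorem isLiftable_of_blocks (hblock : ∀ i, IsBlock cs hA p r i)
    (hpair : ∀ i j, i ≠ j → IsBlockPair cs hA p r i j (M' i j)) : M'.IsLiftable r := by
  intro i j
  by_cases h : i = j
  · subst h
    rw [M'.diagonal, pow_one, (hblock i).sq]
  · exact (hpair i j h).rel

/-- The homomorphism from the Coxeter group of type `M'` given by a folding. -/
noncomputable def foldingHom (hr : M'.IsLiftable r) : M'.Group →* W :=
  M'.toCoxeterSystem.lift ⟨r, hr⟩

theorem foldingHom_simple (hr : M'.IsLiftable r) (i : ι) :
    foldingHom r hr (M'.simple i) = r i :=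
  M'.toCoxeterSystem.lift_apply_simple hr i

theorem range_foldingHom (hr : M'.IsLiftable r) :
    (foldingHom r hr).range = foldingSubgroup r := by
  rw [MonoidHom.range_eq_map, ← M'.toCoxeterSystem.subgroup_closure_range_simple,
    MonoidHom.map_closure, foldingSubgroup]
  congr 1
  ext w
  simp [foldingHom_simple]

/-- This is the second use of `apply_mem_of_not_isRightDescent`: the group of type `M'` acts through
the folding, and the cone generators are the simple roots of a block. -/
theorem not_isRightDescent_foldingHom (hr : M'.IsLiftable r)
    (hpair : ∀ i j, i ≠ j → IsBlockPair cs hA p r i j (M' i j)) (hM' : ∀ i j, M' i j ≠ 0)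
    {w : M'.Group} {i : ι} (h : ¬ M'.toCoxeterSystem.IsRightDescent w i) {b : B} (hb : p b = i) :
    ¬ cs.IsRightDescent (foldingHom r hr w) b := by
  let P : AddSubmonoid (B → ℤ) := AddSubmonoid.nonneg _
  refine not_isRightDescent_of_nonneg cs hA (?_ : _ ∈ P)
  refine apply_mem_of_not_isRightDescent M'.toCoxeterSystem
    ((rootRep cs hA).comp (foldingHom r hr)) (blockRoots p) P ?_ ?_ w i h
    (x := Pi.single b 1) ⟨b, hb, rfl⟩
  · rintro i _ ⟨b, -, rfl⟩
    exact (Pi.single_nonneg.2 zero_le_one : (0 : B → ℤ) ≤ _)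
  · intro i j hij k hk v hv
    rw [wordProd_alternatingWord, MonoidHom.comp_apply, map_altProd]
    simp only [CoxeterMatrix.toCoxeterSystem_simple, foldingHom_simple]
    exact (hpair i j hij).pos k (hk (hM' i j)) v hv

/-- Write φ(w) = φ(w sᵢ) rᵢ, where w sᵢ does not have the descent `i`. The factor rᵢ sends block
roots to negatives of block roots, and φ(w sᵢ) keeps the latter nonpositive. -/
theorem isRightDescent_foldingHom (hr : M'.IsLiftable r) (hblock : ∀ i, IsBlock cs hA p r i)
    (hpair : ∀ i j, i ≠ j → IsBlockPair cs hA p r i j (M' i j)) (hM' : ∀ i j, M' i j ≠ 0)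
    {w : M'.Group} {i : ι} (h : M'.toCoxeterSystem.IsRightDescent w i) {b : B} (hb : p b = i) :
    cs.IsRightDescent (foldingHom r hr w) b := by
  rw [CoxeterSystem.isRightDescent_iff_not_isRightDescent_mul] at h
  obtain ⟨b', hb', he⟩ := (hblock i).neg b hb
  have h1 := not_isRightDescent_foldingHom cs hA p r hr hpair hM' h hb'
  apply isRightDescent_of_nonpos cs hA
  have h2 := rootRep_single_nonneg cs hA h1
  rw [map_mul, CoxeterMatrix.toCoxeterSystem_simple, foldingHom_simple] at h2
  have h3 : foldingHom r hr w = foldingHom r hr w * r i * r i := by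
    rw [mul_assoc, (hblock i).sq, mul_one]
  rw [h3, rootRep_mul_apply, he, map_neg]
  exact neg_nonpos.2 h2

/-- A nontrivial element of the kernel would have a descent, and so would its image 1. -/
theorem foldingHom_injective (hr : M'.IsLiftable r) (hblock : ∀ i, IsBlock cs hA p r i)
    (hpair : ∀ i j, i ≠ j → IsBlockPair cs hA p r i j (M' i j)) (hM' : ∀ i j, M' i j ≠ 0) :
    Function.Injective (foldingHom r hr) := by
  rw [injective_iff_map_eq_one]
  intro w hw
  by_contra hne
  obtain ⟨i, hi⟩ := M'.toCoxeterSystem.exists_rightDescent_of_ne_one hne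
  obtain ⟨b, hb⟩ := (hblock i).nonempty
  have := isRightDescent_foldingHom cs hA p r hr hblock hpair hM' hi hb
  rw [hw] at this
  exact cs.not_isRightDescent_one b this

/-- Without descents in the block, the image of `w` is minimal in its coset of the block parabolic,
to which `r i` belongs. This makes the length in `W` a weight function on the folded group. -/
theorem length_foldingHom_mul_simple (hr : M'.IsLiftable r) (hblock : ∀ i, IsBlock cs hA p r i)
    (hpair : ∀ i j, i ≠ j → IsBlockPair cs hA p r i j (M' i j)) (hM' : ∀ i j, M' i j ≠ 0)
    {w : M'.Group} {i : ι} (h : ¬ M'.toCoxeterSystem.IsRightDescent w i) :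
    cs.length (foldingHom r hr (w * M'.simple i)) =
      cs.length (foldingHom r hr w) + cs.length (r i) := by
  rw [map_mul, foldingHom_simple]
  exact length_mul_of_mem_minReps cs hA (K := p ⁻¹' {i})
    (fun b hb => not_isRightDescent_foldingHom cs hA p r hr hpair hM' h hb)
    (hblock i).longest.1

/-- Everything about a folding is encoded in single blocks and pairs of blocks: the pairs give a
homomorphism from the abstract group, and its compatibility with descents gives admissibility and
injectivity. -/
theorem isFolding_of_blocks (hblock : ∀ i, IsBlock cs hA p r i)
    (hpair : ∀ i j, i ≠ j → IsBlockPair cs hA p r i j (M' i j)) (hM' : ∀ i j, M' i j ≠ 0) :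
    IsFolding cs p r M' := by
  have hr := isLiftable_of_blocks cs hA p r hblock hpair
  refine { surjective := fun i => (hblock i).nonempty, finite := fun i => (hblock i).finite,
           longest := fun i => (hblock i).longest, admissible := ?_, coxeter := ?_ }
  · intro w hw i
    rw [← range_foldingHom r hr] at hw
    obtain ⟨x, rfl⟩ := hw
    by_cases h : M'.toCoxeterSystem.IsRightDescent x i
    · right
      intro b hb
      rw [← cs.isRightDescent_iff]
      exact isRightDescent_foldingHom cs hA p r hr hblock hpair hM' h hb
    · left
      intro b hb
      rw [← cs.not_isRightDescent_iff]
      exact not_isRightDescent_foldingHom cs hA p r hr hpair hM' h hb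
  · let e : M'.Group ≃* foldingSubgroup r :=
      (MonoidHom.ofInjective (foldingHom_injective cs hA p r hr hblock hpair hM')).trans
        (MulEquiv.subgroupCongr (range_foldingHom r hr))
    refine ⟨M'.toCoxeterSystem.map e, fun i => ?_⟩
    rw [CoxeterSystem.map_simple]
    exact foldingHom_simple r hr i

/-- The unfolding series counts the elements of the Coxeter group of type `M'` by the length of
their images. -/
theorem unfoldingSeries_eq (hr : M'.IsLiftable r) (hblock : ∀ i, IsBlock cs hA p r i)
    (hpair : ∀ i j, i ≠ j → IsBlockPair cs hA p r i j (M' i j)) (hM' : ∀ i j, M' i j ≠ 0) :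
    unfoldingSeries cs r = PowerSeries.mk fun m =>
      (({w | cs.length (foldingHom r hr w) = m} : Set M'.Group).ncard : ℚ) := by
  ext m
  simp only [unfoldingSeries, PowerSeries.coeff_mk]
  congr 1
  rw [← Nat.card_coe_set_eq]
  let e : M'.Group ≃* foldingSubgroup r :=
    (MonoidHom.ofInjective (foldingHom_injective cs hA p r hr hblock hpair hM')).trans
      (MulEquiv.subgroupCongr (range_foldingHom r hr))
  exact (Nat.card_congr (e.toEquiv.subtypeEquiv fun w => Iff.rfl)).symm

end Criterion

/-! ### Verification of the folding criterion in small rank -/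

section SmallRank

/-- The action of a word on coordinate vectors, for a Cartan matrix `A`. -/
def wordAct {k : ℕ} (A : Fin k → Fin k → ℤ) : List (Fin k) → (Fin k → ℤ) → Fin k → ℤ
  | [], v => v
  | x :: ω, v => fun y =>
    if y = x then wordAct A ω v y - ∑ z, A x z * wordAct A ω v z else wordAct A ω v y

/-- The linear combination with coefficients `v` of the rows of `N`. -/
def rowComb {k : ℕ} (N : Fin k → Fin k → ℤ) (v : Fin k → ℤ) : Fin k → ℤ :=
  fun y => ∑ x, v x * N x y

/-- The action on coordinate vectors of an alternating product of `n` factors with matrices `U` and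
`V`, ending with `V`. -/
def altAct {k : ℕ} : ℕ → (Fin k → Fin k → ℤ) → (Fin k → Fin k → ℤ) → (Fin k → ℤ) → Fin k → ℤ
  | 0, _, _, v => v
  | n + 1, U, V, v => altAct n V U (rowComb V v)

/-- The words `u` and `v` act for the Cartan matrix `A` by the matrices `U` and `V`, which satisfy
the dihedral folding condition of length `m` for the blocks `{x | I x}` and `{x | ¬ I x}`. -/
structure IsSmallPair {k : ℕ} (A : Fin k → Fin k → ℤ) (u v : List (Fin k))
    (U V : Fin k → Fin k → ℤ) (I : Fin k → Bool) (m : ℕ) : Prop where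
  left : ∀ x y, wordAct A u (Pi.single x 1) y = U x y
  right : ∀ x y, wordAct A v (Pi.single x 1) y = V x y
  pos : ∀ n < m, ∀ x, I x = true → ∀ y, 0 ≤ altAct n U V (Pi.single x 1) y
  pos' : ∀ n < m, ∀ x, I x = false → ∀ y, 0 ≤ altAct n V U (Pi.single x 1) y
  braid : ∀ x y, altAct m U V (Pi.single x 1) y = altAct m V U (Pi.single x 1) y

/-- In this and the following configurations, row `x` of `U` or `V` is the image of the `x`-th
simple root under the longest element of a block. The whole dihedral condition becomes a finite
check on integer matrices. -/
theorem isSmallPair_A₂ : IsSmallPair ![![2, -1], ![-1, 2]] [0] [1]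
    ![![-1, 0], ![1, 1]] ![![1, 1], ![0, -1]] ![true, false] 3 := by
  constructor <;> decide +kernel

theorem isSmallPair_A₂A₂ : IsSmallPair
    ![![2, 0, -1, 0], ![0, 2, 0, -1], ![-1, 0, 2, 0], ![0, -1, 0, 2]] [0, 1] [2, 3]
    ![![-1, 0, 0, 0], ![0, -1, 0, 0], ![1, 0, 1, 0], ![0, 1, 0, 1]]
    ![![1, 0, 1, 0], ![0, 1, 0, 1], ![0, 0, -1, 0], ![0, 0, 0, -1]]
    ![true, true, false, false] 3 := by
  constructor <;> decide +kernel

/-- The middle vertex of A₃ against its two end vertices. -/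
theorem isSmallPair_A₃ : IsSmallPair
    ![![2, -1, -1], ![-1, 2, 0], ![-1, 0, 2]] [0] [1, 2]
    ![![-1, 0, 0], ![1, 1, 0], ![1, 0, 1]] ![![1, 1, 1], ![0, -1, 0], ![0, 0, -1]]
    ![true, false, false] 4 := by
  constructor <;> decide +kernel

/-- The path is 2 — 0 — 1 — 3: the inner edge forms one block, the two end vertices the other. -/
theorem isSmallPair_A₄ : IsSmallPair
    ![![2, -1, -1, 0], ![-1, 2, 0, -1], ![-1, 0, 2, 0], ![0, -1, 0, 2]] [0, 1, 0] [2, 3]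
    ![![0, -1, 0, 0], ![-1, 0, 0, 0], ![1, 1, 1, 0], ![1, 1, 0, 1]]
    ![![1, 0, 1, 0], ![0, 1, 0, 1], ![0, 0, -1, 0], ![0, 0, 0, -1]]
    ![true, true, false, false] 4 := by
  constructor <;> decide +kernel

theorem isSmallPair_B₂ : IsSmallPair ![![2, -2], ![-1, 2]] [0] [1]
    ![![-1, 0], ![2, 1]] ![![1, 1], ![0, -1]] ![true, false] 4 := by
  constructor <;> decide +kernel

/-- The two copies of B₂ have opposite orientations. This matches the two ends of C̃_m, where the
entry -2 always stands at the smaller index. -/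
theorem isSmallPair_B₂B₂ : IsSmallPair
    ![![2, 0, -2, 0], ![0, 2, 0, -1], ![-1, 0, 2, 0], ![0, -2, 0, 2]] [0, 1] [2, 3]
    ![![-1, 0, 0, 0], ![0, -1, 0, 0], ![2, 0, 1, 0], ![0, 1, 0, 1]]
    ![![1, 0, 1, 0], ![0, 1, 0, 2], ![0, 0, -1, 0], ![0, 0, 0, -1]]
    ![true, true, false, false] 4 := by
  constructor <;> decide +kernel

theorem pow_three_eq_one_of_braid {G : Type*} [Group G] {x y : G} (hx : x * x = 1)
    (hy : y * y = 1) (h : altProd 3 x y = altProd 3 y x) : (x * y) ^ 3 = 1 := by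
  simp only [altProd, one_mul] at h
  calc (x * y) ^ 3 = x * y * x * (y * x * y) := by
        simp only [pow_succ, pow_zero, mul_assoc, one_mul]
    _ = x * (y * (x * x) * y) * x := by rw [h]; simp only [mul_assoc]
    _ = 1 := by rw [hx, mul_one, hy, mul_one, hx]

theorem pow_four_eq_one_of_braid {G : Type*} [Group G] {x y : G} (hx : x * x = 1)
    (hy : y * y = 1) (h : altProd 4 x y = altProd 4 y x) : (x * y) ^ 4 = 1 := by
  simp only [altProd, one_mul] at h
  calc (x * y) ^ 4 = x * y * x * y * (x * y * x * y) := by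
        simp only [pow_succ, pow_zero, mul_assoc, one_mul]
    _ = y * x * y * x * (x * y * x * y) := congrArg (· * (x * y * x * y)) h
    _ = y * (x * (y * (x * x) * y) * x) * y := by simp only [mul_assoc]
    _ = 1 := by rw [hx, mul_one, hy, mul_one, hx, mul_one, hy]

end SmallRank

/-! ### Transfer of the rank-four computations to parabolic subgroups -/

section Embedding

set_option linter.unusedSectionVars false

variable {B W ι : Type*} [Group W] {M : CoxeterMatrix B} [Fintype B] [DecidableEq B]
  (cs : CoxeterSystem M W) {A : B → B → ℤ} (hA : IsCartan M A) {k : ℕ}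

/-- The linear combination with coefficients `v` of the simple roots `f x`. -/
def rootComb (f : Fin k → B) (v : Fin k → ℤ) : B → ℤ := ∑ x, v x • Pi.single (f x) 1

theorem rootComb_single (f : Fin k → B) (x : Fin k) :
    rootComb f (Pi.single x 1) = Pi.single (f x) 1 := by
  simp [rootComb, Pi.single_apply, ite_smul]

/-- On combinations of the roots `f x`, the reflections `f x` only see the Cartan submatrix indexed
by `f`. -/
theorem rootRep_wordProd_rootComb {A₀ : Fin k → Fin k → ℤ} {f : Fin k → B}
    (hf : ∀ x y, A (f x) (f y) = A₀ x y) (ω : List (Fin k)) (v : Fin k → ℤ) :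
    rootRep cs hA (cs.wordProd (ω.map f)) (rootComb f v) = rootComb f (wordAct A₀ ω v) := by
  induction ω with
  | nil => simp [wordAct]
  | cons x ω ih =>
    rw [List.map_cons, CoxeterSystem.wordProd_cons, rootRep_mul_apply, ih, rootRep_simple,
      reflection_apply]
    set v' := wordAct A₀ ω v with hv'
    have h1 : coroot A (f x) (rootComb f v') = ∑ z, A₀ x z * v' z := by
      rw [rootComb, map_sum]
      refine Finset.sum_congr rfl fun z _ => ?_
      rw [map_zsmul, coroot_single, hf, smul_eq_mul, mul_comm]
    have h2 : wordAct A₀ (x :: ω) v = v' - (∑ z, A₀ x z * v' z) • Pi.single x 1 := by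
      ext y
      by_cases hy : y = x
      · subst hy; simp [wordAct, hv']
      · simp [wordAct, hv', hy]
    rw [h1, h2]
    simp only [rootComb, Pi.sub_apply, sub_smul, Finset.sum_sub_distrib, Pi.smul_apply]
    congr 1
    simp [Pi.single_apply, ite_smul]

theorem rootRep_rootComb {f : Fin k → B} {r : W} {U : Fin k → Fin k → ℤ}
    (hr : ∀ x, rootRep cs hA r (Pi.single (f x) 1) = rootComb f (U x)) (v : Fin k → ℤ) :
    rootRep cs hA r (rootComb f v) = rootComb f (rowComb U v) := by
  conv_lhs => rw [rootComb, map_sum]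
  simp only [map_zsmul, hr, rootComb, rowComb, Finset.smul_sum, Finset.sum_smul, smul_smul]
  rw [Finset.sum_comm]

theorem rootRep_altProd_rootComb {f : Fin k → B} {r r' : W} {U V : Fin k → Fin k → ℤ}
    (hr : ∀ x, rootRep cs hA r (Pi.single (f x) 1) = rootComb f (U x))
    (hr' : ∀ x, rootRep cs hA r' (Pi.single (f x) 1) = rootComb f (V x)) (n : ℕ)
    (v : Fin k → ℤ) :
    rootRep cs hA (altProd n r r') (rootComb f v) = rootComb f (altAct n U V v) := by
  induction n generalizing r r' U V v with
  | zero => simp [altProd, altAct]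
  | succ n ih => rw [altProd, altAct, rootRep_mul_apply, rootRep_rootComb cs hA hr', ih hr' hr]

theorem rootComb_mem_closure {f : Fin k → B} {S : Set (B → ℤ)}
    (hS : ∀ x, Pi.single (f x) 1 ∈ S) {v : Fin k → ℤ} (hv : ∀ x, 0 ≤ v x) :
    rootComb f v ∈ AddSubmonoid.closure S := by
  refine sum_mem fun x _ => ?_
  obtain ⟨n, hn⟩ := Int.eq_ofNat_of_zero_le (hv x)
  rw [hn, natCast_zsmul]
  exact nsmul_mem (AddSubmonoid.subset_closure (hS x)) n

/-- The dihedral folding condition can be verified on a Cartan submatrix. -/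
theorem IsSmallPair.isBlockPair {A₀ : Fin k → Fin k → ℤ} {u v : List (Fin k)}
    {U V : Fin k → Fin k → ℤ} {I : Fin k → Bool} {m : ℕ} (h : IsSmallPair A₀ u v U V I m)
    (hm : m = 3 ∨ m = 4) {f : Fin k → B} (hf : ∀ x y, A (f x) (f y) = A₀ x y) {p : B → ι}
    {r : ι → W} {i j : ι} (hi : IsBlock cs hA p r i) (hj : IsBlock cs hA p r j)
    (hpi : ∀ b, p b = i ↔ ∃ x, I x = true ∧ f x = b)
    (hpj : ∀ b, p b = j ↔ ∃ x, I x = false ∧ f x = b)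
    (hri : r i = cs.wordProd (u.map f)) (hrj : r j = cs.wordProd (v.map f)) :
    IsBlockPair cs hA p r i j m := by
  have hU : ∀ x, rootRep cs hA (r i) (Pi.single (f x) 1) = rootComb f (U x) := by
    intro x
    rw [← rootComb_single, hri, rootRep_wordProd_rootComb cs hA hf]
    congr 1
    exact funext (h.left x)
  have hV : ∀ x, rootRep cs hA (r j) (Pi.single (f x) 1) = rootComb f (V x) := by
    intro x
    rw [← rootComb_single, hrj, rootRep_wordProd_rootComb cs hA hf]
    congr 1
    exact funext (h.right x)
  have hfr : ∀ x, p (f x) = i ∨ p (f x) = j := by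
    intro x
    cases hx : I x
    · exact Or.inr ((hpj _).2 ⟨x, hx, rfl⟩)
    · exact Or.inl ((hpi _).2 ⟨x, hx, rfl⟩)
  have hrmem : ∀ ω : List (Fin k), cs.wordProd (ω.map f) ∈ parabolic cs (Set.range f) := by
    intro ω
    refine wordProd_mem_parabolic cs fun b hb => ?_
    obtain ⟨x, -, rfl⟩ := List.mem_map.1 hb
    exact ⟨x, rfl⟩
  have halt : ∀ n {x y : W}, x ∈ parabolic cs (Set.range f) → y ∈ parabolic cs (Set.range f) →
      altProd n x y ∈ parabolic cs (Set.range f) := by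
    intro n
    induction n with
    | zero => intro x y _ _; exact one_mem _
    | succ n ih => intro x y hx hy; exact mul_mem (ih hy hx) hy
  have hmi : r i ∈ parabolic cs (Set.range f) := hri ▸ hrmem u
  have hmj : r j ∈ parabolic cs (Set.range f) := hrj ▸ hrmem v
  -- Both sides lie in the parabolic subgroup of the two blocks and agree on its simple roots. Their
  -- quotient fixes these roots, hence is trivial by `eq_one_of_nonneg`; so a matrix identity yields
  -- an identity in `W`.
  have hbraid : altProd m (r i) (r j) = altProd m (r j) (r i) := by
    rw [← inv_mul_eq_one]
    refine eq_one_of_nonneg cs hA (mul_mem (inv_mem (halt m hmi hmj)) (halt m hmj hmi)) ?_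
    rintro _ ⟨x, rfl⟩
    have h1 : rootRep cs hA (altProd m (r i) (r j)) (Pi.single (f x) 1) =
        rootRep cs hA (altProd m (r j) (r i)) (Pi.single (f x) 1) := by
      rw [← rootComb_single, rootRep_altProd_rootComb cs hA hU hV,
        rootRep_altProd_rootComb cs hA hV hU]
      congr 1
      exact funext (h.braid x)
    rw [rootRep_mul_apply, ← h1, ← rootRep_mul_apply, inv_mul_cancel, rootRep_one_apply]
    exact Pi.single_nonneg.2 zero_le_one
  refine ⟨?_, ?_, ?_, ?_⟩
  · rcases hm with rfl | rfl
    · exact pow_three_eq_one_of_braid hi.sq hj.sq hbraid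
    · exact pow_four_eq_one_of_braid hi.sq hj.sq hbraid
  · rcases hm with rfl | rfl
    · exact pow_three_eq_one_of_braid hj.sq hi.sq hbraid.symm
    · exact pow_four_eq_one_of_braid hj.sq hi.sq hbraid.symm
  · rintro n hn _ ⟨b, hb, rfl⟩
    obtain ⟨x, hx, rfl⟩ := (hpi b).1 hb
    rw [← rootComb_single, rootRep_altProd_rootComb cs hA hU hV]
    refine rootComb_mem_closure (fun y => ?_) (h.pos n hn x hx)
    exact (hfr y).imp (fun hy => ⟨_, hy, rfl⟩) (fun hy => ⟨_, hy, rfl⟩)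
  · rintro n hn _ ⟨b, hb, rfl⟩
    obtain ⟨x, hx, rfl⟩ := (hpj b).1 hb
    rw [← rootComb_single, rootRep_altProd_rootComb cs hA hV hU]
    refine rootComb_mem_closure (fun y => ?_) (h.pos' n hn x hx)
    exact (hfr y).symm.imp (fun hy => ⟨_, hy, rfl⟩) (fun hy => ⟨_, hy, rfl⟩)

end Embedding

/-! ### The blocks and the pairs of blocks that occur in the foldings -/

section Blocks

set_option linter.unusedSectionVars false

variable {B W ι : Type*} [Group W] {M : CoxeterMatrix B} [Fintype B] [DecidableEq B]
  (cs : CoxeterSystem M W) {A : B → B → ℤ} (hA : IsCartan M A) (p : B → ι) (r : ι → W)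

/-- The block `i` is `{a}`. -/
structure IsSingleBlock (i : ι) (a : B) : Prop where
  mem_iff : ∀ b, p b = i ↔ b = a
  eq : r i = cs.simple a

/-- The block `i` is `{a, b}` with commuting reflections `a` and `b`. -/
structure IsDoubleBlock (A : B → B → ℤ) (i : ι) (a b : B) : Prop where
  mem_iff : ∀ c, p c = i ↔ c = a ∨ c = b
  ne : a ≠ b
  cartan : A a b = 0
  cartan' : A b a = 0
  eq : r i = cs.simple a * cs.simple b

/-- The block `i` is `{a, b}`, of type `A₂`. -/
structure IsTripleBlock (A : B → B → ℤ) (i : ι) (a b : B) : Prop where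
  mem_iff : ∀ c, p c = i ↔ c = a ∨ c = b
  ne : a ≠ b
  cartan : A a b = -1
  cartan' : A b a = -1
  eq : r i = cs.simple a * cs.simple b * cs.simple a

variable {p r} {i j : ι}

theorem commute_of_cartan_eq_zero (hA : IsCartan M A) {a b : B} (hne : a ≠ b) (h : A a b = 0) :
    cs.simple a * cs.simple b = cs.simple b * cs.simple a := by
  have hM : M a b = 2 := by
    rcases hA.off a b hne with h' | h' | h' | h' <;> omega
  have h1 := cs.simple_mul_simple_pow a b
  rw [hM, pow_two, mul_eq_one_iff_eq_inv, mul_inv_rev, cs.inv_simple, cs.inv_simple] at h1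
  exact h1

theorem braid_of_cartan_eq_neg_one (hA : IsCartan M A) {a b : B} (hne : a ≠ b) (h : A a b = -1)
    (h' : A b a = -1) : cs.simple a * cs.simple b * cs.simple a =
      cs.simple b * cs.simple a * cs.simple b := by
  have hM : M a b = 3 := by
    rcases hA.off a b hne with h' | h' | h' | h' <;> omega
  have h2 : cs.simple a * cs.simple b * cs.simple a * cs.simple b * (cs.simple a * cs.simple b)
      = 1 := by
    have := cs.simple_mul_simple_pow a b
    rwa [hM, pow_succ, pow_two, ← mul_assoc (cs.simple a * cs.simple b)] at this
  have h3 : cs.simple a * cs.simple b * cs.simple a * (cs.simple b * cs.simple a * cs.simple b)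
      = 1 := by
    simpa only [mul_assoc] using h2
  rw [mul_eq_one_iff_eq_inv] at h3
  rw [h3]
  simp [mul_assoc]

/-- A finite set of elements containing `1` and closed under right multiplication by the simple
reflections of `K` contains `W_K`. -/
theorem parabolic_subset {K : Set B} {S : Set W} (h1 : 1 ∈ S)
    (hS : ∀ w ∈ S, ∀ i ∈ K, w * cs.simple i ∈ S) : (parabolic cs K : Set W) ⊆ S := fun _ hw =>
  parabolic_induction_right cs (p := (· ∈ S)) h1 (fun w i _ hi h => hS w h i hi) hw

/-- In all three block types the parabolic subgroup is exhausted by an explicit list of 2, 4 or 6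
elements, which gives finiteness and the longest element at once. -/
theorem IsSingleBlock.isBlock {a : B} (h : IsSingleBlock cs p r i a) :
    IsBlock cs hA p r i ∧ cs.length (r i) = 1 := by
  have hK : p ⁻¹' {i} = {a} := by ext b; simpa using h.mem_iff b
  have hlen : cs.length (r i) = 1 := by rw [h.eq, cs.length_simple]
  have hS : (parabolic cs (p ⁻¹' {i}) : Set W) ⊆ ({1, cs.simple a} : Set W) := by
    rw [hK]
    refine parabolic_subset cs (by simp) ?_
    rintro w (rfl | rfl) b rfl <;> simp
  refine ⟨⟨⟨a, (h.mem_iff a).2 rfl⟩, ?_, ⟨?_, ?_⟩, ?_, ?_⟩, hlen⟩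
  · exact ((Set.toFinite _).subset hS).to_subtype
  · rw [h.eq]; exact simple_mem_parabolic cs ((h.mem_iff a).2 rfl)
  · intro w hw hne
    rw [h.eq] at hne
    rcases hS hw with rfl | rfl
    · rw [hlen, cs.length_one]; exact one_pos
    · exact absurd rfl hne
  · rw [h.eq, cs.simple_mul_simple_self]
  · intro b hb
    rw [h.mem_iff] at hb
    subst hb
    refine ⟨b, (h.mem_iff b).2 rfl, ?_⟩
    rw [h.eq, rootRep_simple_single, hA.diag]
    module

theorem IsDoubleBlock.isBlock {a b : B} (h : IsDoubleBlock cs p r A i a b) :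
    IsBlock cs hA p r i ∧ cs.length (r i) = 2 := by
  have hK : p ⁻¹' {i} = {a, b} := by ext c; simpa using h.mem_iff c
  have hcomm := commute_of_cartan_eq_zero cs hA h.ne h.cartan
  have hab : rootRep cs hA (cs.simple a) (Pi.single b 1) = Pi.single b 1 := by
    rw [rootRep_simple_single, h.cartan, zero_smul, sub_zero]
  have hba : rootRep cs hA (cs.simple b) (Pi.single a 1) = Pi.single a 1 := by
    rw [rootRep_simple_single, h.cartan', zero_smul, sub_zero]
  have haa : rootRep cs hA (cs.simple a) (Pi.single a 1) = - Pi.single a 1 := by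
    rw [rootRep_simple_single, hA.diag]; module
  have hbb : rootRep cs hA (cs.simple b) (Pi.single b 1) = - Pi.single b 1 := by
    rw [rootRep_simple_single, hA.diag]; module
  have hlen : cs.length (r i) = 2 := by
    have : ¬ cs.IsRightDescent (cs.simple a) b :=
      not_isRightDescent_of_nonneg cs hA (by rw [hab]; exact Pi.single_nonneg.2 zero_le_one)
    rw [cs.not_isRightDescent_iff, cs.length_simple] at this
    rw [h.eq, this]
  have hS : (parabolic cs (p ⁻¹' {i}) : Set W) ⊆
      ({1, cs.simple a, cs.simple b, cs.simple a * cs.simple b} : Set W) := by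
    rw [hK]
    refine parabolic_subset cs (by simp) ?_
    rintro w (rfl | rfl | rfl | rfl) c (rfl | rfl)
    · simp
    · simp
    · simp
    · simp
    · simp [hcomm]
    · simp
    · rw [hcomm]; simp
    · simp
  refine ⟨⟨⟨a, (h.mem_iff a).2 (Or.inl rfl)⟩, ?_, ⟨?_, ?_⟩, ?_, ?_⟩, hlen⟩
  · exact ((Set.toFinite _).subset hS).to_subtype
  · rw [h.eq]
    exact mul_mem (simple_mem_parabolic cs ((h.mem_iff a).2 (Or.inl rfl)))
      (simple_mem_parabolic cs ((h.mem_iff b).2 (Or.inr rfl)))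
  · intro w hw hne
    rw [h.eq] at hne
    rw [hlen]
    rcases hS hw with rfl | rfl | rfl | rfl
    · simp
    · simp
    · simp
    · exact absurd rfl hne
  · rw [h.eq]
    nth_rewrite 1 [hcomm]
    simp [mul_assoc]
  · intro c hc
    rw [h.mem_iff] at hc
    refine ⟨c, (h.mem_iff c).2 hc, ?_⟩
    rcases hc with rfl | rfl
    · rw [h.eq, rootRep_mul_apply, hba, haa]
    · rw [h.eq, rootRep_mul_apply, hbb, map_neg, hab]

/-- Unlike in the commuting case, the longest element of A₂ interchanges the two simple roots up to
sign. -/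
theorem IsTripleBlock.isBlock {a b : B} (h : IsTripleBlock cs p r A i a b) :
    IsBlock cs hA p r i ∧ cs.length (r i) = 3 := by
  have hK : p ⁻¹' {i} = {a, b} := by ext c; simpa using h.mem_iff c
  have hbraid := braid_of_cartan_eq_neg_one cs hA h.ne h.cartan h.cartan'
  have hab : rootRep cs hA (cs.simple a) (Pi.single b 1) = Pi.single b 1 + Pi.single a 1 := by
    rw [rootRep_simple_single, h.cartan]; module
  have hba : rootRep cs hA (cs.simple b) (Pi.single a 1) = Pi.single a 1 + Pi.single b 1 := by
    rw [rootRep_simple_single, h.cartan']; module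
  have haa : rootRep cs hA (cs.simple a) (Pi.single a 1) = - Pi.single a 1 := by
    rw [rootRep_simple_single, hA.diag]; module
  have hbb : rootRep cs hA (cs.simple b) (Pi.single b 1) = - Pi.single b 1 := by
    rw [rootRep_simple_single, hA.diag]; module
  have hpos : ∀ c : B, (0 : B → ℤ) ≤ Pi.single c 1 := fun c => Pi.single_nonneg.2 zero_le_one
  have hlen : cs.length (r i) = 3 := by
    have h1 : ¬ cs.IsRightDescent (cs.simple a) b :=
      not_isRightDescent_of_nonneg cs hA (by rw [hab]; exact add_nonneg (hpos _) (hpos _))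
    have h2 : ¬ cs.IsRightDescent (cs.simple a * cs.simple b) a :=
      not_isRightDescent_of_nonneg cs hA (by
        rw [rootRep_mul_apply, hba, map_add, hab, haa,
          show (- Pi.single a 1 + (Pi.single b 1 + Pi.single a 1) : B → ℤ) = Pi.single b 1 by abel]
        exact hpos _)
    rw [cs.not_isRightDescent_iff] at h1 h2
    rw [h.eq, h2, h1, cs.length_simple]
  have hS : (parabolic cs (p ⁻¹' {i}) : Set W) ⊆
      ({1, cs.simple a, cs.simple b, cs.simple a * cs.simple b, cs.simple b * cs.simple a,
        cs.simple a * cs.simple b * cs.simple a} : Set W) := by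
    rw [hK]
    refine parabolic_subset cs (by simp) ?_
    rintro w (rfl | rfl | rfl | rfl | rfl | rfl) c (rfl | rfl)
    · simp
    · simp
    · simp
    · simp
    · simp
    · simp
    · simp
    · simp
    · simp
    · rw [← hbraid]; simp
    · simp
    · rw [hbraid]; simp
  refine ⟨⟨⟨a, (h.mem_iff a).2 (Or.inl rfl)⟩, ?_, ⟨?_, ?_⟩, ?_, ?_⟩, hlen⟩
  · exact ((Set.toFinite _).subset hS).to_subtype
  · rw [h.eq]
    have ha := simple_mem_parabolic cs (K := p ⁻¹' {i}) ((h.mem_iff a).2 (Or.inl rfl))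
    have hb := simple_mem_parabolic cs (K := p ⁻¹' {i}) ((h.mem_iff b).2 (Or.inr rfl))
    exact mul_mem (mul_mem ha hb) ha
  · intro w hw hne
    rw [h.eq] at hne
    rw [hlen]
    have h2 : ∀ c d, cs.length (cs.simple c * cs.simple d) < 3 := by
      intro c d
      have := cs.length_mul_le (cs.simple c) (cs.simple d)
      rw [cs.length_simple, cs.length_simple] at this
      omega
    rcases hS hw with rfl | rfl | rfl | rfl | rfl | rfl
    · simp
    · simp
    · simp
    · exact h2 _ _
    · exact h2 _ _
    · exact absurd rfl hne
  · rw [h.eq]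
    simp [mul_assoc]
  · intro c hc
    rw [h.mem_iff] at hc
    rcases hc with rfl | rfl
    · refine ⟨b, (h.mem_iff b).2 (Or.inr rfl), ?_⟩
      rw [h.eq, rootRep_mul_apply, haa, map_neg, rootRep_mul_apply, hba, map_add, haa, hab]
      abel
    · refine ⟨a, (h.mem_iff a).2 (Or.inl rfl), ?_⟩
      rw [h.eq, rootRep_mul_apply, hab, map_add, rootRep_mul_apply, rootRep_mul_apply, hbb, hba,
        map_neg, map_add, haa, hab]
      abel

/-- Two orthogonal blocks. -/
theorem isBlockPair_of_orthogonal (hi : IsBlock cs hA p r i) (hj : IsBlock cs hA p r j)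
    (hij : i ≠ j) (h : ∀ a b, p a = i → p b = j → A a b = 0 ∧ A b a = 0) :
    IsBlockPair cs hA p r i j 2 := by
  have hcomm : r i * r j = r j * r i := by
    -- Generators of orthogonal blocks commute, so the two parabolic subgroups centralize each
    -- other.
    have h1 : parabolic cs (p ⁻¹' {i}) ≤ Subgroup.centralizer (parabolic cs (p ⁻¹' {j})) := by
      rw [parabolic, Subgroup.closure_le, parabolic, Subgroup.centralizer_closure]
      rintro _ ⟨a, ha, rfl⟩
      rw [SetLike.mem_coe, Subgroup.mem_centralizer_iff]
      rintro _ ⟨b, hb, rfl⟩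
      have hne : b ≠ a := by
        rintro rfl
        exact hij (ha.symm.trans hb)
      exact commute_of_cartan_eq_zero cs hA hne (h a b ha hb).2
    exact (Subgroup.mem_centralizer_iff.1 (h1 hi.longest.1) _ hj.longest.1).symm
  have hrel : (r i * r j) ^ 2 = 1 := by
    rw [pow_two]
    nth_rewrite 2 [hcomm]
    rw [mul_assoc, ← mul_assoc (r j), hj.sq, one_mul, hi.sq]
  refine ⟨hrel, by rw [← hcomm, hrel], ?_, ?_⟩
  · rintro k hk _ ⟨b, hb, rfl⟩
    have : rootRep cs hA (altProd k (r i) (r j)) (Pi.single b 1) = Pi.single b 1 := by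
      interval_cases k
      · exact rootRep_one_apply cs hA _
      · simp only [altProd, one_mul]
        exact rootRep_single_of_orthogonal cs hA hj.longest.1 b fun a ha => (h b a hb ha).2
    rw [this]
    exact AddSubmonoid.subset_closure (Or.inl ⟨b, hb, rfl⟩)
  · rintro k hk _ ⟨b, hb, rfl⟩
    have : rootRep cs hA (altProd k (r j) (r i)) (Pi.single b 1) = Pi.single b 1 := by
      interval_cases k
      · exact rootRep_one_apply cs hA _
      · simp only [altProd, one_mul]
        exact rootRep_single_of_orthogonal cs hA hi.longest.1 b fun a ha => (h a b ha hb).1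
    rw [this]
    exact AddSubmonoid.subset_closure (Or.inl ⟨b, hb, rfl⟩)

/-- As in the other configurations, `f` lists the elements of both blocks in the order used by the
small Cartan matrix. -/
theorem isBlockPair_A₂ {a b : B} (hi : IsSingleBlock cs p r i a)
    (hj : IsSingleBlock cs p r j b)
    (hab : A a b = -1) (hba : A b a = -1) :
    IsBlockPair cs hA p r i j 3 := by
  refine isSmallPair_A₂.isBlockPair cs hA (Or.inl rfl) (f := ![a, b]) ?_
    (hi.isBlock cs hA).1 (hj.isBlock cs hA).1 ?_ ?_ ?_ ?_
  · intro x y; fin_cases x <;> fin_cases y <;> simp [hA.diag, hab, hba]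
  · intro e; simp [hi.mem_iff, Fin.exists_fin_succ, @eq_comm _ e]
  · intro e; simp [hj.mem_iff, Fin.exists_fin_succ, @eq_comm _ e]
  · simp [hi.eq, CoxeterSystem.wordProd_cons]
  · simp [hj.eq, CoxeterSystem.wordProd_cons]

theorem isBlockPair_A₂A₂ {a b c d : B} (hi : IsDoubleBlock cs p r A i a b)
    (hj : IsDoubleBlock cs p r A j c d)
    (hac : A a c = -1) (hca : A c a = -1) (hbd : A b d = -1) (hdb : A d b = -1)
    (had : A a d = 0) (hda : A d a = 0) (hbc : A b c = 0) (hcb : A c b = 0) :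
    IsBlockPair cs hA p r i j 3 := by
  refine isSmallPair_A₂A₂.isBlockPair cs hA (Or.inl rfl) (f := ![a, b, c, d]) ?_
    (hi.isBlock cs hA).1 (hj.isBlock cs hA).1 ?_ ?_ ?_ ?_
  · intro x y
    fin_cases x <;> fin_cases y <;> simp [hA.diag, hac, hca, hbd, hdb, had, hda, hbc, hcb,
      hi.cartan, hi.cartan', hj.cartan, hj.cartan']
  · intro e; simp [hi.mem_iff, Fin.exists_fin_succ, @eq_comm _ e]
  · intro e; simp [hj.mem_iff, Fin.exists_fin_succ, @eq_comm _ e]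
  · simp [hi.eq, CoxeterSystem.wordProd_cons]
  · simp [hj.eq, CoxeterSystem.wordProd_cons]

theorem isBlockPair_A₃ {a b c : B} (hi : IsSingleBlock cs p r i a)
    (hj : IsDoubleBlock cs p r A j b c)
    (hab : A a b = -1) (hba : A b a = -1) (hac : A a c = -1) (hca : A c a = -1) :
    IsBlockPair cs hA p r i j 4 := by
  refine isSmallPair_A₃.isBlockPair cs hA (Or.inr rfl) (f := ![a, b, c]) ?_
    (hi.isBlock cs hA).1 (hj.isBlock cs hA).1 ?_ ?_ ?_ ?_
  · intro x y
    fin_cases x <;> fin_cases y <;>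
      simp [hA.diag, hab, hba, hac, hca, hj.cartan, hj.cartan']
  · intro e; simp [hi.mem_iff, Fin.exists_fin_succ, @eq_comm _ e]
  · intro e; simp [hj.mem_iff, Fin.exists_fin_succ, @eq_comm _ e]
  · simp [hi.eq, CoxeterSystem.wordProd_cons]
  · simp [hj.eq, CoxeterSystem.wordProd_cons]

theorem isBlockPair_A₄ {a b c d : B} (hi : IsTripleBlock cs p r A i a b)
    (hj : IsDoubleBlock cs p r A j c d)
    (hac : A a c = -1) (hca : A c a = -1) (hbd : A b d = -1) (hdb : A d b = -1)
    (had : A a d = 0) (hda : A d a = 0) (hbc : A b c = 0) (hcb : A c b = 0) :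
    IsBlockPair cs hA p r i j 4 := by
  refine isSmallPair_A₄.isBlockPair cs hA (Or.inr rfl) (f := ![a, b, c, d]) ?_
    (hi.isBlock cs hA).1 (hj.isBlock cs hA).1 ?_ ?_ ?_ ?_
  · intro x y
    fin_cases x <;> fin_cases y <;> simp [hA.diag, hac, hca, hbd, hdb, had, hda, hbc, hcb,
      hi.cartan, hi.cartan', hj.cartan, hj.cartan']
  · intro e; simp [hi.mem_iff, Fin.exists_fin_succ, @eq_comm _ e]
  · intro e; simp [hj.mem_iff, Fin.exists_fin_succ, @eq_comm _ e]
  · simp [hi.eq, CoxeterSystem.wordProd_cons, mul_assoc]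
  · simp [hj.eq, CoxeterSystem.wordProd_cons]

theorem isBlockPair_B₂ {a b : B} (hi : IsSingleBlock cs p r i a)
    (hj : IsSingleBlock cs p r j b)
    (hab : A a b = -2) (hba : A b a = -1) :
    IsBlockPair cs hA p r i j 4 := by
  refine isSmallPair_B₂.isBlockPair cs hA (Or.inr rfl) (f := ![a, b]) ?_
    (hi.isBlock cs hA).1 (hj.isBlock cs hA).1 ?_ ?_ ?_ ?_
  · intro x y; fin_cases x <;> fin_cases y <;> simp [hA.diag, hab, hba]
  · intro e; simp [hi.mem_iff, Fin.exists_fin_succ, @eq_comm _ e]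
  · intro e; simp [hj.mem_iff, Fin.exists_fin_succ, @eq_comm _ e]
  · simp [hi.eq, CoxeterSystem.wordProd_cons]
  · simp [hj.eq, CoxeterSystem.wordProd_cons]

theorem isBlockPair_B₂B₂ {a b c d : B} (hi : IsDoubleBlock cs p r A i a b)
    (hj : IsDoubleBlock cs p r A j c d)
    (hac : A a c = -2) (hca : A c a = -1) (hbd : A b d = -1) (hdb : A d b = -2)
    (had : A a d = 0) (hda : A d a = 0) (hbc : A b c = 0) (hcb : A c b = 0) :
    IsBlockPair cs hA p r i j 4 := by
  refine isSmallPair_B₂B₂.isBlockPair cs hA (Or.inr rfl) (f := ![a, b, c, d]) ?_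
    (hi.isBlock cs hA).1 (hj.isBlock cs hA).1 ?_ ?_ ?_ ?_
  · intro x y
    fin_cases x <;> fin_cases y <;> simp [hA.diag, hac, hca, hbd, hdb, had, hda, hbc, hcb,
      hi.cartan, hi.cartan', hj.cartan, hj.cartan']
  · intro e; simp [hi.mem_iff, Fin.exists_fin_succ, @eq_comm _ e]
  · intro e; simp [hj.mem_iff, Fin.exists_fin_succ, @eq_comm _ e]
  · simp [hi.eq, CoxeterSystem.wordProd_cons]
  · simp [hj.eq, CoxeterSystem.wordProd_cons]

end Blocks

/-! ### Weighted length functions and their generating series -/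

section Weight

variable {B W : Type*} [Group W] {M : CoxeterMatrix B}

/-- `L` is the weighted length function on `W` in which the simple reflection `i` has weight
`c i`. -/
structure IsWeight (cs : CoxeterSystem M W) (c : B → ℕ) (L : W → ℕ) : Prop where
  pos : ∀ i, 0 < c i
  one : L 1 = 0
  mul_simple : ∀ w i, ¬ cs.IsRightDescent w i → L (w * cs.simple i) = L w + c i

variable {cs : CoxeterSystem M W} {c : B → ℕ} {L : W → ℕ}

theorem IsWeight.simple (hL : IsWeight cs c L) (i : B) : L (cs.simple i) = c i := by
  have := hL.mul_simple 1 i (cs.not_isRightDescent_one i)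
  rwa [one_mul, hL.one, zero_add] at this

/-- A right descent of `x` is also one of `u * x` when lengths add; removing it preserves
additivity, so induction on the length of `x` applies. -/
theorem IsWeight.mul (hL : IsWeight cs c L) {u x : W}
    (h : cs.length (u * x) = cs.length u + cs.length x) : L (u * x) = L u + L x := by
  induction hn : cs.length x using Nat.strong_induction_on generalizing x with
  | _ n ih =>
    by_cases hx : x = 1
    · subst hx; simp [hL.one]
    obtain ⟨i, hi⟩ := cs.exists_rightDescent_of_ne_one hx
    have h1 := cs.isRightDescent_iff.1 hi
    have h2 := cs.length_mul_le u (x * cs.simple i)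
    have h3 := cs.length_mul_simple (u * x) i
    rw [mul_assoc] at h3
    have h4 : cs.length (u * (x * cs.simple i)) = cs.length u + cs.length (x * cs.simple i) := by
      omega
    have h5 := ih _ (by omega) h4 rfl
    have h6 := hL.mul_simple (x * cs.simple i) i
      (cs.isRightDescent_iff_not_isRightDescent_mul.1 hi)
    have h7 := hL.mul_simple (u * (x * cs.simple i)) i (by
      rw [cs.not_isRightDescent_iff, mul_assoc, cs.simple_mul_simple_cancel_right]
      omega)
    rw [cs.simple_mul_simple_cancel_right] at h6
    rw [mul_assoc, cs.simple_mul_simple_cancel_right] at h7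
    omega

/-- Positive weights dominate the length, so the level sets of `L` are finite in finite rank. -/
theorem IsWeight.length_le (hL : IsWeight cs c L) (w : W) : cs.length w ≤ L w := by
  induction hn : cs.length w using Nat.strong_induction_on generalizing w with
  | _ n ih =>
    by_cases hw : w = 1
    · subst hw; simp at hn; omega
    obtain ⟨i, hi⟩ := cs.exists_rightDescent_of_ne_one hw
    have h1 := cs.isRightDescent_iff.1 hi
    have h2 := ih _ (by omega) (w * cs.simple i) rfl
    have h3 := hL.mul_simple (w * cs.simple i) i
      (cs.isRightDescent_iff_not_isRightDescent_mul.1 hi)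
    rw [cs.simple_mul_simple_cancel_right] at h3
    have := hL.pos i
    omega

theorem IsWeight.finite [Finite B] (hL : IsWeight cs c L) (m : ℕ) : {w | L w = m}.Finite := by
  have hfin : (⋃ k ∈ Set.Iic m, cs.wordProd '' {ω : List B | ω.length = k}).Finite :=
    (Set.finite_Iic m).biUnion fun k _ => (List.finite_length_eq B k).image _
  refine hfin.subset fun w hw => ?_
  obtain ⟨ω, hω, rfl⟩ := cs.exists_isReduced w
  have h1 := hL.length_le (cs.wordProd ω)
  have h2 : L (cs.wordProd ω) = m := hw
  simp only [Set.mem_iUnion]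
  exact ⟨ω.length, by rw [Set.mem_Iic, ← hω.eq]; omega, ω, rfl, rfl⟩

end Weight

/-! ### Generating series of subsets by weight -/

section LevelSeries

open scoped Pointwise

variable {W : Type*} {L : W → ℕ}

/-- The generating series `∑_{w ∈ Z} X ^ L w`. -/
noncomputable def levelSeries (L : W → ℕ) (Z : Set W) : ℚ⟦X⟧ :=
  PowerSeries.mk fun m => ((Z ∩ {w | L w = m}).ncard : ℚ)

theorem levelSeries_empty : levelSeries L ∅ = 0 := by
  ext m
  simp [levelSeries]

theorem levelSeries_union (hfin : ∀ m, {w | L w = m}.Finite) {Y Z : Set W} (h : Disjoint Y Z) :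
    levelSeries L (Y ∪ Z) = levelSeries L Y + levelSeries L Z := by
  ext m
  simp only [levelSeries, PowerSeries.coeff_mk, map_add]
  rw [Set.union_inter_distrib_right, Set.ncard_union_eq
    (h.mono Set.inter_subset_left Set.inter_subset_left)
    ((hfin m).subset Set.inter_subset_right) ((hfin m).subset Set.inter_subset_right)]
  push_cast
  rfl

theorem levelSeries_singleton (w : W) : levelSeries L {w} = X ^ L w := by
  ext m
  rw [levelSeries, PowerSeries.coeff_mk, PowerSeries.coeff_X_pow]
  split_ifs with h
  · have : ({w} ∩ {w | L w = m} : Set W) = {w} := by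
      rw [Set.inter_eq_left]; rintro _ rfl; exact h.symm
    rw [this]; simp
  · have : ({w} ∩ {w | L w = m} : Set W) = ∅ := by
      ext x
      simp only [Set.mem_inter_iff, Set.mem_singleton_iff, Set.mem_empty_iff_false, iff_false,
        not_and]
      rintro rfl h'
      exact h h'.symm
    rw [this]; simp

theorem levelSeries_image_range (hfin : ∀ m, {w | L w = m}.Finite) (u : ℕ → W) (n : ℕ)
    (hu : Set.InjOn u (Set.Iio n)) :
    levelSeries L (u '' Set.Iio n) = ∑ k ∈ Finset.range n, X ^ L (u k) := by
  induction n with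
  | zero => simp [levelSeries_empty]
  | succ n ih =>
    have h1 : u '' Set.Iio (n + 1) = u '' Set.Iio n ∪ {u n} := by
      rw [show Set.Iio (n + 1) = Set.Iio n ∪ {n} by ext; simp, Set.image_union,
        Set.image_singleton]
    have hsub : Set.Iio n ⊆ Set.Iio (n + 1) := Set.Iio_subset_Iio (Nat.le_succ n)
    rw [h1, levelSeries_union hfin, ih (hu.mono hsub), levelSeries_singleton,
      Finset.sum_range_succ]
    rw [Set.disjoint_singleton_right]
    rintro ⟨k, hk, he⟩
    have := hu (hsub hk) (Nat.lt_succ_self n : n ∈ Set.Iio (n + 1)) he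
    exact absurd (Set.mem_Iio.1 hk) (by omega)

/-- Unique factorization with additive weights turns the product set into a Cauchy product. It is
applied to cosets of parabolic subgroups and to orthogonal parabolics. -/
theorem levelSeries_mul [Group W] (hfin : ∀ m, {w | L w = m}.Finite) {U Z : Set W}
    (hinj : ∀ u ∈ U, ∀ u' ∈ U, ∀ x ∈ Z, ∀ x' ∈ Z, u * x = u' * x' → u = u' ∧ x = x')
    (hL : ∀ u ∈ U, ∀ x ∈ Z, L (u * x) = L u + L x) :
    levelSeries L (U * Z) = levelSeries L U * levelSeries L Z := by
  classical
  ext m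
  rw [PowerSeries.coeff_mul]
  simp only [levelSeries, PowerSeries.coeff_mk]
  have hf : ∀ (Y : Set W) m, (Y ∩ {w | L w = m}).Finite := fun Y m =>
    (hfin m).subset Set.inter_subset_right
  have key : (U * Z) ∩ {w | L w = m} = (fun q : W × W => q.1 * q.2) ''
      (((Finset.HasAntidiagonal.antidiagonal m).biUnion fun ab =>
        (hf U ab.1).toFinset ×ˢ (hf Z ab.2).toFinset : Finset (W × W)) : Set (W × W)) := by
    ext w
    constructor
    · rintro ⟨⟨u, hu, x, hx, rfl⟩, hw⟩
      refine ⟨(u, x), ?_, rfl⟩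
      simp only [Finset.coe_biUnion, Set.mem_iUnion]
      refine ⟨(L u, L x), ?_, ?_⟩
      · have h1 : L (u * x) = m := hw
        simp [← hL u hu x hx, h1]
      · simp [hu, hx]
    · rintro ⟨⟨u, x⟩, hq, rfl⟩
      simp only [Finset.coe_biUnion, Set.mem_iUnion] at hq
      obtain ⟨⟨a, b⟩, hab, hq⟩ := hq
      simp at hab hq
      obtain ⟨⟨hu, ha⟩, hx, hb⟩ := hq
      refine ⟨⟨u, hu, x, hx, rfl⟩, ?_⟩
      change L (u * x) = m
      rw [hL u hu x hx, ha, hb, hab]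
  rw [key, Set.InjOn.ncard_image, Set.ncard_coe_finset, Finset.card_biUnion]
  · push_cast
    refine Finset.sum_congr rfl fun ab _ => ?_
    rw [Finset.card_product, Set.ncard_eq_toFinset_card _ (hf U ab.1),
      Set.ncard_eq_toFinset_card _ (hf Z ab.2)]
    push_cast
    rfl
  · rintro ⟨a, b⟩ - ⟨a', b'⟩ - hne
    rw [Function.onFun, Finset.disjoint_left]
    rintro ⟨u, x⟩ h1 h2
    simp at h1 h2
    apply hne
    rw [← h1.1.2, ← h1.2.2, ← h2.1.2, ← h2.2.2]
  · rintro ⟨u, x⟩ hq ⟨u', x'⟩ hq' h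
    simp only [Finset.coe_biUnion, Set.mem_iUnion] at hq hq'
    obtain ⟨ab, -, hq⟩ := hq
    obtain ⟨ab', -, hq'⟩ := hq'
    simp at hq hq'
    obtain ⟨h1, h2⟩ := hinj u hq.1.1 u' hq'.1.1 x hq.2.1 x' hq'.2.1 h
    rw [h1, h2]

end LevelSeries

/-! ### The weighted Poincaré polynomial of type `B` -/

section TypeB

open scoped Pointwise
open CoxeterSystem

variable {B W : Type*} [Group W] {M : CoxeterMatrix B}

/-- The Cartan matrix of the path `0 — 1 — 2 — ⋯` whose first edge is labelled `4`. -/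
def pathCartan (i j : ℕ) : ℤ :=
  if i = j then 2 else if j = i + 1 then (if i = 0 then -2 else -1) else if i = j + 1 then -1 else 0

/-- The simple reflections `f 0, …, f (N - 1)` form a path of type `B`. -/
structure IsPathB (A : B → B → ℤ) (f : ℕ → B) (N : ℕ) : Prop where
  inj : ∀ i < N, ∀ j < N, f i = f j → i = j
  cartan : ∀ i < N, ∀ j < N, A (f i) (f j) = pathCartan i j

/-- The vector `∑_{l ≤ i} α_{f l}`, a coordinate vector of the standard model of type `B`. -/
def coordRoot [DecidableEq B] (f : ℕ → B) (i : ℕ) : B → ℤ :=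
  ∑ l ∈ Finset.range (i + 1), Pi.single (f l) 1

/-- The minimal coset representatives of type `B_m` in type `B_{m+1}`, by increasing length. -/
def pathRep (cs : CoxeterSystem M W) (f : ℕ → B) (m : ℕ) : ℕ → W
  | 0 => 1
  | k + 1 => cs.simple (f ((m - k) + (k - m))) * pathRep cs f m k

section Coord

variable [DecidableEq B] (f : ℕ → B)

theorem coordRoot_zero : coordRoot f 0 = Pi.single (f 0) 1 := by
  simp [coordRoot]

theorem coordRoot_succ (i : ℕ) :
    coordRoot f (i + 1) = coordRoot f i + Pi.single (f (i + 1)) 1 :=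
  Finset.sum_range_succ _ _

theorem coordRoot_nonneg (i : ℕ) : 0 ≤ coordRoot f i :=
  Finset.sum_nonneg fun _ _ => Pi.single_nonneg.2 zero_le_one

theorem coordRoot_mono {i j : ℕ} (h : i ≤ j) : coordRoot f i ≤ coordRoot f j :=
  Finset.sum_le_sum_of_subset_of_nonneg (Finset.range_mono (by omega))
    fun _ _ _ => Pi.single_nonneg.2 zero_le_one

variable {f} [Fintype B] {A : B → B → ℤ} {N : ℕ}

/-- Write ε_i for `coordRoot f i`. The simple roots are ε_0 and ε_{i+1} - ε_i, so `f 0` acts as the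
sign change of ε_0 and `f (i + 1)` swaps ε_i and ε_{i+1}. -/
theorem coroot_coordRoot (hf : IsPathB A f N) {i j : ℕ} (hi : i < N) (hj : j < N) :
    coroot A (f j) (coordRoot f i) =
      if j = 0 then (if i = 0 then 2 else 0)
      else if i + 1 = j then -1 else if i = j then 1 else 0 := by
  induction i with
  | zero =>
    rw [coordRoot_zero, coroot_single, hf.cartan j hj 0 hi, pathCartan]
    split_ifs <;> omega
  | succ i ih =>
    rw [coordRoot_succ, map_add, ih (by omega), coroot_single, hf.cartan j hj _ hi, pathCartan]
    clear ih
    rcases Nat.eq_zero_or_pos j with rfl | hj0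
    · rcases Nat.eq_zero_or_pos i with rfl | hi0
      · simp
      · simp [hi0.ne']
    · simp only [hj0.ne', if_false]
      split_ifs <;> omega

theorem reflection_coordRoot_of_ne (hf : IsPathB A f N) {i j : ℕ} (hi : i < N) (hj : j < N)
    (h1 : i ≠ j) (h2 : i + 1 ≠ j) : reflection A (f j) (coordRoot f i) = coordRoot f i := by
  rw [reflection_apply, coroot_coordRoot hf hi hj]
  have : (if j = 0 then (if i = 0 then 2 else 0) else
    if i + 1 = j then -1 else if i = j then 1 else 0 : ℤ) = 0 := by split_ifs <;> omega
  rw [this, zero_smul, sub_zero]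

theorem reflection_coordRoot_zero (hf : IsPathB A f N) (hN : 0 < N) :
    reflection A (f 0) (coordRoot f 0) = - coordRoot f 0 := by
  rw [reflection_apply, coroot_coordRoot hf hN hN, coordRoot_zero]
  simp only [if_true]
  module

theorem reflection_coordRoot_self (hf : IsPathB A f N) {i : ℕ} (hi : i + 1 < N) :
    reflection A (f (i + 1)) (coordRoot f (i + 1)) = coordRoot f i := by
  rw [reflection_apply, coroot_coordRoot hf hi hi, coordRoot_succ]
  simp

theorem reflection_coordRoot_pred (hf : IsPathB A f N) {i : ℕ} (hi : i + 1 < N) :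
    reflection A (f (i + 1)) (coordRoot f i) = coordRoot f (i + 1) := by
  rw [reflection_apply, coroot_coordRoot hf (by omega) hi, coordRoot_succ]
  simp

end Coord

variable [Fintype B] [DecidableEq B] (cs : CoxeterSystem M W) {A : B → B → ℤ}
  (hA : IsCartan M A) {f : ℕ → B} {N : ℕ}

/-- The letter added at step `k` has index |m - k|, written with truncated subtraction, so from
right to left the word runs through m, …, 0, …, m. As a signed permutation it carries ε_m down to
ε_0, changes its sign and carries it up again, while the other ε_i keep their order and signs. -/
theorem rootRep_pathRep_coordRoot (hf : IsPathB A f N) {m : ℕ} (hm : m < N) {k : ℕ}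
    (hk : k ≤ 2 * m + 1) :
    (∀ i < m, rootRep cs hA (pathRep cs f m k) (coordRoot f i) =
      coordRoot f (if i < (if k ≤ m then m - k else k - m - 1) then i else i + 1)) ∧
    rootRep cs hA (pathRep cs f m k) (coordRoot f m) =
      if k ≤ m then coordRoot f (m - k) else - coordRoot f (k - m - 1) := by
  induction k with
  | zero =>
    refine ⟨fun i hi => ?_, ?_⟩
    · simp [pathRep, hi]
    · simp [pathRep]
  | succ k ih =>
    obtain ⟨ih1, ih2⟩ := ih (by omega)
    simp only [pathRep, rootRep_mul_apply, rootRep_simple]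
    refine ⟨fun i hi => ?_, ?_⟩
    · rw [ih1 i hi]
      rcases lt_trichotomy k m with hkm | hkm | hkm
      · rw [if_pos hkm.le, if_pos (show k + 1 ≤ m by omega),
          show m - k + (k - m) = (m - (k + 1)) + 1 by omega,
          show m - k = (m - (k + 1)) + 1 by omega]
        rcases lt_trichotomy i (m - (k + 1)) with h | h | h
        · rw [if_pos (by omega), if_pos h, reflection_coordRoot_of_ne hf] <;> omega
        · rw [if_pos (by omega), if_neg (by omega), ← h, reflection_coordRoot_pred hf (by omega)]
        · rw [if_neg (by omega), if_neg (by omega), reflection_coordRoot_of_ne hf] <;> omega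
      · subst hkm
        rw [if_pos le_rfl, if_neg (show ¬ i < k - k by omega), if_neg (show ¬ k + 1 ≤ k by omega),
          if_neg (show ¬ i < k + 1 - k - 1 by omega), reflection_coordRoot_of_ne hf] <;> omega
      · rw [if_neg (show ¬ k ≤ m by omega), if_neg (show ¬ k + 1 ≤ m by omega),
          show m - k + (k - m) = (k - m - 1) + 1 by omega,
          show k + 1 - m - 1 = (k - m - 1) + 1 by omega]
        rcases lt_trichotomy i (k - m - 1) with h | h | h
        · rw [if_pos h, if_pos (by omega), reflection_coordRoot_of_ne hf] <;> omega
        · rw [if_neg (by omega), if_pos (by omega), ← h, reflection_coordRoot_self hf (by omega)]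
        · rw [if_neg (by omega), if_neg (by omega), reflection_coordRoot_of_ne hf] <;> omega
    · rw [ih2]
      rcases lt_trichotomy k m with hkm | hkm | hkm
      · rw [if_pos hkm.le, if_pos (show k + 1 ≤ m by omega),
          show m - k + (k - m) = (m - (k + 1)) + 1 by omega,
          show m - k = (m - (k + 1)) + 1 by omega, reflection_coordRoot_self hf (by omega)]
      · subst hkm
        rw [if_pos le_rfl, if_neg (by omega), show k - k + (k - k) = 0 by omega,
          show k - k = 0 by omega, show k + 1 - k - 1 = 0 by omega,
          reflection_coordRoot_zero hf (by omega)]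
      · rw [if_neg (by omega), if_neg (by omega), map_neg,
          show m - k + (k - m) = (k - m - 1) + 1 by omega,
          show k + 1 - m - 1 = (k - m - 1) + 1 by omega, reflection_coordRoot_pred hf (by omega)]

/-- The signed permutation is positive and increasing on ε_0, …, ε_{m-1}, so the simple roots ε_0
and ε_{i+1} - ε_i stay nonnegative. -/
theorem pathRep_mem_minReps (hA : IsCartan M A) (hf : IsPathB A f N) {m : ℕ} (hm : m < N) {k : ℕ}
    (hk : k ≤ 2 * m + 1) : pathRep cs f m k ∈ minReps cs (f '' Set.Iio m) := by
  rintro _ ⟨i, hi, rfl⟩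
  rw [Set.mem_Iio] at hi
  apply not_isRightDescent_of_nonneg cs hA
  have h := (rootRep_pathRep_coordRoot cs hA hf hm hk).1
  rcases i with _ | i
  · rw [← coordRoot_zero, h 0 hi]
    exact coordRoot_nonneg _ _
  · rw [show (Pi.single (f (i + 1)) 1 : B → ℤ) = coordRoot f (i + 1) - coordRoot f i by
      rw [coordRoot_succ]; abel, map_sub, h _ hi, h i (by omega), sub_nonneg]
    apply coordRoot_mono
    split_ifs <;> omega

/-- The next letter is no left descent because its root is the image of a nonnegative vector: ε_m -
ε_{m-k-1}, ε_m or ε_{k-m-1} + ε_m, according to whether k < m, k = m or k > m. -/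
theorem length_pathRep_succ (hA : IsCartan M A) (hf : IsPathB A f N) {m : ℕ} (hm : m < N) {k : ℕ}
    (hk : k ≤ 2 * m) :
    cs.length (pathRep cs f m (k + 1)) = cs.length (pathRep cs f m k) + 1 := by
  rw [pathRep, ← cs.not_isLeftDescent_iff, ← cs.isRightDescent_inv_iff]
  obtain ⟨h1, h2⟩ := rootRep_pathRep_coordRoot cs hA hf hm (k := k) (by omega)
  have key : ∀ v, 0 ≤ v → rootRep cs hA (pathRep cs f m k) v =
      Pi.single (f (m - k + (k - m))) 1 →
      ¬ cs.IsRightDescent (pathRep cs f m k)⁻¹ (f (m - k + (k - m))) := by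
    intro v hv he
    apply not_isRightDescent_of_nonneg cs hA
    rw [← he, ← rootRep_mul_apply, inv_mul_cancel, rootRep_one_apply]
    exact hv
  rcases lt_trichotomy k m with hkm | hkm | hkm
  · apply key (coordRoot f m - coordRoot f (m - (k + 1)))
      (sub_nonneg.2 (coordRoot_mono f (by omega)))
    rw [map_sub, h2, h1 _ (by omega), if_pos hkm.le, if_pos hkm.le, if_pos (by omega),
      show m - k + (k - m) = (m - (k + 1)) + 1 by omega,
      show m - k = (m - (k + 1)) + 1 by omega, coordRoot_succ]
    abel
  · subst hkm
    apply key (coordRoot f k) (coordRoot_nonneg f _)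
    rw [h2, if_pos le_rfl, show k - k + (k - k) = 0 by omega, show k - k = 0 by omega,
      coordRoot_zero]
  · apply key (coordRoot f (k - m - 1) + coordRoot f m)
      (add_nonneg (coordRoot_nonneg f _) (coordRoot_nonneg f _))
    rw [map_add, h2, h1 _ (by omega), if_neg (show ¬ k ≤ m by omega), if_neg hkm.not_ge,
      if_neg (lt_irrefl _),
      show m - k + (k - m) = (k - m - 1) + 1 by omega, coordRoot_succ]
    abel

theorem length_pathRep (hA : IsCartan M A) (hf : IsPathB A f N) {m : ℕ} (hm : m < N) {k : ℕ}
    (hk : k ≤ 2 * m + 1) : cs.length (pathRep cs f m k) = k := by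
  induction k with
  | zero => simp [pathRep]
  | succ k ih => rw [length_pathRep_succ cs hA hf hm (by omega), ih (by omega)]

end TypeB

/-! ### Coset decomposition, weights and longest elements along a path of type `B` -/

section TypeB

set_option linter.unusedSectionVars false

open scoped Pointwise
open CoxeterSystem

variable {B W : Type*} [Group W] {M : CoxeterMatrix B} [Fintype B] [DecidableEq B]
  (cs : CoxeterSystem M W) {A : B → B → ℤ} {f : ℕ → B} {N : ℕ}

theorem IsPathB.commute (hA : IsCartan M A) (hf : IsPathB A f N) {i j : ℕ} (hi : i < N)
    (hj : j < N) (h0 : i ≠ j) (h1 : i ≠ j + 1) (h2 : j ≠ i + 1) :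
    cs.simple (f i) * cs.simple (f j) = cs.simple (f j) * cs.simple (f i) := by
  refine commute_of_cartan_eq_zero cs hA (fun h => h0 (hf.inj i hi j hj h)) ?_
  rw [hf.cartan i hi j hj, pathCartan, if_neg h0, if_neg h2, if_neg h1]

theorem IsPathB.braid (hA : IsCartan M A) (hf : IsPathB A f N) {i : ℕ} (hi : i + 2 < N) :
    cs.simple (f (i + 1)) * cs.simple (f (i + 2)) * cs.simple (f (i + 1)) =
      cs.simple (f (i + 2)) * cs.simple (f (i + 1)) * cs.simple (f (i + 2)) := by
  refine braid_of_cartan_eq_neg_one cs hA ?_ ?_ ?_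
  · intro h
    have := hf.inj _ (by omega) _ hi h
    omega
  · rw [hf.cartan _ (by omega) _ hi]
    simp [pathCartan]
  · rw [hf.cartan _ hi _ (by omega)]
    simp [pathCartan]

theorem IsPathB.braid_zero (hA : IsCartan M A) (hf : IsPathB A f N) (hN : 1 < N) :
    cs.simple (f 0) * cs.simple (f 1) * cs.simple (f 0) * cs.simple (f 1) =
      cs.simple (f 1) * cs.simple (f 0) * cs.simple (f 1) * cs.simple (f 0) := by
  have hne : f 0 ≠ f 1 := fun h => absurd (hf.inj 0 (by omega) 1 hN h) (by omega)
  have hc : A (f 0) (f 1) = -2 := by rw [hf.cartan 0 (by omega) 1 hN]; simp [pathCartan]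
  have hM : M (f 0) (f 1) = 4 := by
    rcases hA.off _ _ hne with h | h | h | h <;> omega
  have h1 := cs.simple_mul_simple_pow (f 0) (f 1)
  rw [hM, show 4 = 2 + 2 from rfl, pow_add, mul_eq_one_iff_eq_inv, pow_two, ← mul_assoc] at h1
  rw [h1]
  simp [mul_assoc]

theorem pathRep_succ' {m k τ : ℕ} (h : τ = (m - k) + (k - m)) :
    pathRep cs f m (k + 1) = cs.simple (f τ) * pathRep cs f m k := by
  rw [h, pathRep]

/-- A simple reflection of type `B_{m+1}` that does not move the coset of `pathRep m k` in the
chain of cosets fixes it. -/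
theorem simple_mul_pathRep (hA : IsCartan M A) (hf : IsPathB A f N) {m : ℕ} (hm : m < N) {k : ℕ}
    (hk : k ≤ 2 * m + 1) {a : ℕ} (ha : a ≤ m) (h1 : a ≠ (m - k) + (k - m))
    (h2 : 1 ≤ k → a ≠ (m - (k - 1)) + ((k - 1) - m)) :
    ∃ x ∈ parabolic cs (f '' Set.Iio m),
      cs.simple (f a) * pathRep cs f m k = pathRep cs f m k * x := by
  induction k using Nat.strong_induction_on generalizing a with
  | _ k ih =>
    rcases k with _ | k
    · exact ⟨cs.simple (f a), simple_mem_parabolic cs ⟨a, by simp; omega, rfl⟩, by simp [pathRep]⟩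
    obtain ⟨τ, hτ⟩ : ∃ τ, τ = (m - k) + (k - m) := ⟨_, rfl⟩
    rw [pathRep_succ' cs hτ]
    have haτ : a ≠ τ := by
      have := h2 (by omega)
      rw [Nat.add_sub_cancel] at this
      omega
    have hτN : τ < N := by omega
    -- A letter not adjacent to the leading letter commutes past it.
    by_cases hfar : a + 1 ≠ τ ∧ a ≠ τ + 1
    · obtain ⟨x, hx, he⟩ := ih k (by omega) (by omega) ha (by omega) (by omega)
      refine ⟨x, hx, ?_⟩
      rw [← mul_assoc, hf.commute cs hA (by omega) hτN haτ hfar.2 hfar.1.symm, mul_assoc, he,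
        mul_assoc]
    · -- `a` is adjacent to `τ`, hence the letter before `τ`
      have hk1 : 1 ≤ k := by omega
      obtain ⟨k, rfl⟩ : ∃ k', k = k' + 1 := ⟨k - 1, by omega⟩
      have haσ : a = (m - k) + (k - m) := by omega
      rw [pathRep_succ' cs haσ]
      by_cases h0 : a = 0
      · -- the edge with label `4`
        have hτ1 : τ = 1 := by omega
        obtain ⟨k, rfl⟩ : ∃ k', k = k' + 1 := ⟨k - 1, by omega⟩
        have hσ : τ = (m - k) + (k - m) := by omega
        rw [pathRep_succ' cs hσ]
        obtain ⟨x, hx, he⟩ := ih k (by omega) (by omega) ha (by omega) (by omega)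
        refine ⟨x, hx, ?_⟩
        subst h0 hτ1
        have hb := hf.braid_zero cs hA hτN
        simp only [← mul_assoc]
        rw [hb, mul_assoc, he]
        simp only [← mul_assoc]
      -- The braid relation moves the letter through the two leading ones and leaves `τ` in front of
      -- a shorter representative, which absorbs it by induction.
      · obtain ⟨x, hx, he⟩ := ih k (by omega) (by omega) (a := τ) (by omega) (by omega) (by omega)
        refine ⟨x, hx, ?_⟩
        have hb : cs.simple (f a) * cs.simple (f τ) * cs.simple (f a) =
            cs.simple (f τ) * cs.simple (f a) * cs.simple (f τ) := by
          rcases (show τ = a + 1 ∨ a = τ + 1 by omega) with h | h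
          · obtain ⟨c, rfl⟩ : ∃ c, a = c + 1 := ⟨a - 1, by omega⟩
            subst h
            exact hf.braid cs hA (by omega)
          · obtain ⟨c, rfl⟩ : ∃ c, τ = c + 1 := ⟨τ - 1, by omega⟩
            subst h
            exact (hf.braid cs hA (by omega)).symm
        simp only [← mul_assoc]
        rw [hb, mul_assoc, he]
        simp only [← mul_assoc]

theorem pathRep_mem_parabolic {m k : ℕ} (hk : k ≤ 2 * m + 1) :
    pathRep cs f m k ∈ parabolic cs (f '' Set.Iio (m + 1)) := by
  induction k with
  | zero => exact one_mem _
  | succ k ih =>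
    exact mul_mem (simple_mem_parabolic cs ⟨_, by simp; omega, rfl⟩) (ih (by omega))

/-- The right side contains 1 and is stable under left multiplication by generators: each one moves
a coset one step up or down the chain, or fixes it by `simple_mul_pathRep`. -/
theorem parabolic_path_succ (hA : IsCartan M A) (hf : IsPathB A f N) {m : ℕ} (hm : m < N) :
    (parabolic cs (f '' Set.Iio (m + 1)) : Set W) =
      (pathRep cs f m '' Set.Iio (2 * m + 2)) * (parabolic cs (f '' Set.Iio m) : Set W) := by
  apply Set.Subset.antisymm
  · intro w hw
    refine parabolic_induction_left cs (p := fun w => w ∈ (pathRep cs f m '' Set.Iio (2 * m + 2)) *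
      (parabolic cs (f '' Set.Iio m) : Set W)) ?_ ?_ hw
    · exact ⟨1, ⟨0, by simp, rfl⟩, 1, one_mem _, one_mul 1⟩
    · rintro _ _ - ⟨a, ha, rfl⟩ ⟨_, ⟨k, hk, rfl⟩, x, hx, rfl⟩
      rw [Set.mem_Iio] at ha hk
      by_cases h1 : a = (m - k) + (k - m)
      · refine ⟨_, ⟨k + 1, ?_, rfl⟩, x, hx, ?_⟩
        · rw [Set.mem_Iio]; omega
        · simp only [pathRep_succ' cs h1, mul_assoc]
      by_cases h2 : 1 ≤ k ∧ a = (m - (k - 1)) + ((k - 1) - m)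
      · refine ⟨_, ⟨k - 1, ?_, rfl⟩, x, hx, ?_⟩
        · rw [Set.mem_Iio]; omega
        · have := pathRep_succ' cs (f := f) h2.2
          rw [Nat.sub_add_cancel h2.1] at this
          simp only [this, mul_assoc, simple_mul_simple_cancel_left]
      · obtain ⟨y, hy, he⟩ := simple_mul_pathRep cs hA hf hm (k := k) (by omega) (a := a)
          (by omega) h1 (fun h h' => h2 ⟨h, h'⟩)
        refine ⟨_, ⟨k, hk, rfl⟩, y * x, mul_mem hy hx, ?_⟩
        simp only [← mul_assoc, he]
  · rintro _ ⟨_, ⟨k, hk, rfl⟩, x, hx, rfl⟩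
    rw [Set.mem_Iio] at hk
    refine mul_mem (pathRep_mem_parabolic cs (by omega)) (parabolic_mono cs ?_ hx)
    exact Set.image_mono (Set.Iio_subset_Iio (Nat.le_succ m))

variable {c : B → ℕ} {L : W → ℕ} {a b : ℕ}

/-- The letter `f 0` enters exactly once, at step `m + 1`; all other letters have weight `b`. -/
theorem weight_pathRep (hA : IsCartan M A) (hf : IsPathB A f N) (hL : IsWeight cs c L)
    (ha : c (f 0) = a) (hb : ∀ i, 0 < i → i < N → c (f i) = b) {m : ℕ} (hm : m < N) {k : ℕ}
    (hk : k ≤ 2 * m + 1) :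
    L (pathRep cs f m k) = if k ≤ m then b * k else b * (k - 1) + a := by
  induction k with
  | zero => simp [pathRep, hL.one]
  | succ k ih =>
    have hlen := length_pathRep_succ cs hA hf hm (k := k) (by omega)
    rw [pathRep] at hlen ⊢
    rw [hL.mul (by rw [hlen, cs.length_simple, add_comm]), hL.simple, ih (by omega)]
    rcases lt_trichotomy k m with h | h | h
    · rw [hb _ (by omega) (by omega), if_pos h.le, if_pos (by omega)]
      ring
    · subst h
      simp [ha, add_comm]
    · rw [hb _ (by omega) (by omega), if_neg (by omega), if_neg (by omega)]
      obtain ⟨k, rfl⟩ : ∃ k', k = k' + 1 := ⟨k - 1, by omega⟩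
      simp only [Nat.add_sub_cancel]
      ring

/-- The representatives form two geometric progressions of `m + 1` terms, before and after the
letter `f 0` enters; the second is shifted by the factor X^a (X^b)^m. -/
theorem levelSeries_pathRep (hA : IsCartan M A) (hf : IsPathB A f N) (hL : IsWeight cs c L)
    (ha : c (f 0) = a) (hb : ∀ i, 0 < i → i < N → c (f i) = b) {m : ℕ} (hm : m < N) :
    levelSeries L (pathRep cs f m '' Set.Iio (2 * m + 2)) * (1 - X ^ b) =
      (1 + X ^ a * (X ^ b) ^ m) * (1 - (X ^ b) ^ (m + 1)) := by
  rw [levelSeries_image_range hL.finite]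
  · rw [show 2 * m + 2 = (m + 1) + (m + 1) by omega, Finset.sum_range_add]
    have h1 : ∑ k ∈ Finset.range (m + 1), (X : ℚ⟦X⟧) ^ L (pathRep cs f m k) =
        ∑ k ∈ Finset.range (m + 1), (X ^ b) ^ k := by
      refine Finset.sum_congr rfl fun k hk => ?_
      rw [Finset.mem_range] at hk
      rw [weight_pathRep cs hA hf hL ha hb hm (by omega), if_pos (by omega), pow_mul]
    have h2 : ∑ k ∈ Finset.range (m + 1), (X : ℚ⟦X⟧) ^ L (pathRep cs f m (m + 1 + k)) =
        X ^ a * (X ^ b) ^ m * ∑ k ∈ Finset.range (m + 1), (X ^ b) ^ k := by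
      rw [Finset.mul_sum]
      refine Finset.sum_congr rfl fun k hk => ?_
      rw [Finset.mem_range] at hk
      rw [weight_pathRep cs hA hf hL ha hb hm (by omega), if_neg (by omega),
        show m + 1 + k - 1 = m + k by omega]
      ring
    rw [h1, h2]
    have := geom_sum_mul_neg (X ^ b : ℚ⟦X⟧) (m + 1)
    rw [← this]
    ring
  · intro k hk k' hk' h
    rw [Set.mem_Iio] at hk hk'
    have := congrArg cs.length h
    rwa [length_pathRep cs hA hf hm (by omega), length_pathRep cs hA hf hm (by omega)] at this

/-- The weighted Poincaré polynomial of type `B_m`. -/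
theorem levelSeries_parabolic_path (hA : IsCartan M A) (hf : IsPathB A f N) (hL : IsWeight cs c L)
    (ha : c (f 0) = a) (hb : ∀ i, 0 < i → i < N → c (f i) = b) {m : ℕ} (hm : m ≤ N) :
    levelSeries L (parabolic cs (f '' Set.Iio m) : Set W) * (1 - X ^ b) ^ m =
      ∏ i ∈ Finset.range m, ((1 + X ^ a * (X ^ b) ^ i) * (1 - (X ^ b) ^ (i + 1))) := by
  induction m with
  | zero =>
    have : (parabolic cs (f '' Set.Iio 0) : Set W) = {1} := by
      simp [parabolic]
    rw [this, levelSeries_singleton, hL.one]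
    simp
  | succ m ih =>
    have hmin : ∀ u ∈ pathRep cs f m '' Set.Iio (2 * m + 2), u ∈ minReps cs (f '' Set.Iio m) := by
      rintro _ ⟨k, hk, rfl⟩
      rw [Set.mem_Iio] at hk
      exact pathRep_mem_minReps cs hA hf (by omega) (by omega)
    rw [parabolic_path_succ cs hA hf (by omega), levelSeries_mul hL.finite, Finset.prod_range_succ,
      ← ih (by omega), ← levelSeries_pathRep cs hA hf hL ha hb (by omega : m < N)]
    · ring
    · intro u hu u' hu' x hx x' hx' h
      exact eq_of_mul_eq_mul cs hA (hmin u hu) (hmin u' hu') hx hx' h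
    · intro u hu x hx
      exact hL.mul (length_mul_of_mem_minReps cs hA (hmin u hu) hx)

/-- The longest element of type `B_m` and its weight. -/
theorem exists_longest_path (hA : IsCartan M A) (hf : IsPathB A f N) (hL : IsWeight cs c L)
    (ha : c (f 0) = a) (hb : ∀ i, 0 < i → i < N → c (f i) = b) {m : ℕ} (hm : m ≤ N) :
    ∃ w ∈ parabolic cs (f '' Set.Iio m), (∀ i < m, cs.IsRightDescent w (f i)) ∧
      L w = m * a + m * (m - 1) * b := by
  suffices h : ∃ w ∈ parabolic cs (f '' Set.Iio m),
      (∀ i < m, rootRep cs hA w (coordRoot f i) = - coordRoot f i) ∧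
      L w = m * a + m * (m - 1) * b by
    obtain ⟨w, hw, h, hLw⟩ := h
    refine ⟨w, hw, fun i hi => isRightDescent_of_nonpos cs hA ?_, hLw⟩
    rw [show rootRep cs hA w (Pi.single (f i) 1) = - Pi.single (f i) 1 from ?_]
    · exact neg_nonpos.2 (Pi.single_nonneg.2 zero_le_one)
    rcases i with _ | i
    · rw [← coordRoot_zero, h 0 hi]
    · rw [show (Pi.single (f (i + 1)) 1 : B → ℤ) = coordRoot f (i + 1) - coordRoot f i by
        rw [coordRoot_succ]; abel, map_sub, h _ hi, h i (by omega)]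
      abel
  induction m with
  | zero => exact ⟨1, one_mem _, by simp, by simp [hL.one]⟩
  | succ m ih =>
    obtain ⟨w, hw, h, hLw⟩ := ih (by omega)
    obtain ⟨h1, h2⟩ := rootRep_pathRep_coordRoot cs hA hf (by omega : m < N)
      (le_refl (2 * m + 1))
    -- The top representative changes only the sign of the last coordinate, so multiplying by it
    -- extends -1 from type B_m to B_{m+1}.
    refine ⟨pathRep cs f m (2 * m + 1) * w, mul_mem (pathRep_mem_parabolic cs le_rfl)
      (parabolic_mono cs (Set.image_mono (Set.Iio_subset_Iio (Nat.le_succ m))) hw), ?_, ?_⟩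
    · intro i hi
      rw [rootRep_mul_apply]
      rcases Nat.lt_succ_iff_lt_or_eq.1 hi with hi | rfl
      · rw [h i hi, map_neg, h1 i hi, if_neg (show ¬ 2 * m + 1 ≤ m by omega), if_pos (by omega)]
      -- The last coordinate is orthogonal to the roots of the smaller parabolic subgroup.
      · have hfix : rootRep cs hA w (coordRoot f i) = coordRoot f i := by
          refine parabolic_induction_right cs
            (p := fun w => rootRep cs hA w (coordRoot f i) = coordRoot f i)
            (rootRep_one_apply cs hA _) ?_ hw
          rintro w _ - ⟨j, hj, rfl⟩ hw
          rw [Set.mem_Iio] at hj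
          rw [rootRep_mul_apply, rootRep_simple, reflection_coordRoot_of_ne hf, hw] <;> omega
        rw [hfix, h2, if_neg (by omega), show 2 * i + 1 - i - 1 = i by omega]
    · rw [hL.mul (length_mul_of_mem_minReps cs hA
        (pathRep_mem_minReps cs hA hf (by omega) le_rfl) hw), hLw,
        weight_pathRep cs hA hf hL ha hb (by omega) le_rfl, if_neg (by omega)]
      rcases m with _ | m
      · simp
      · simp only [Nat.add_sub_cancel]
        ring

end TypeB

/-! ### A `q`-Vandermonde summation -/

section Vandermonde

variable {R : Type*} [CommRing R]

/-- The Gaussian binomial coefficient at `t`. -/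
def gaussBinom (t : R) : ℕ → ℕ → R
  | _, 0 => 1
  | 0, _ + 1 => 0
  | n + 1, m + 1 => gaussBinom t n (m + 1) + t ^ (n - m) * gaussBinom t n m

/-- The `q`-Pochhammer symbol `∏_{i < m} (1 - x t ^ i)`. -/
def qPoch (x t : R) (m : ℕ) : R := ∏ i ∈ Finset.range m, (1 - x * t ^ i)

theorem qPoch_succ (x t : R) (m : ℕ) : qPoch x t (m + 1) = qPoch x t m * (1 - x * t ^ m) :=
  Finset.prod_range_succ _ _

theorem qPoch_add (x t : R) (m k : ℕ) :
    qPoch x t (m + k) = qPoch x t m * qPoch (x * t ^ m) t k := by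
  rw [qPoch, Finset.prod_range_add]
  congr 1
  exact Finset.prod_congr rfl fun i _ => by rw [pow_add, mul_assoc]

theorem gaussBinom_zero_right (t : R) (n : ℕ) : gaussBinom t n 0 = 1 := by
  cases n <;> rfl

theorem gaussBinom_eq_zero (t : R) {n m : ℕ} (h : n < m) : gaussBinom t n m = 0 := by
  induction n generalizing m with
  | zero =>
    obtain ⟨m, rfl⟩ : ∃ k, m = k + 1 := ⟨m - 1, by omega⟩
    rfl
  | succ n ih =>
    obtain ⟨m, rfl⟩ : ∃ k, m = k + 1 := ⟨m - 1, by omega⟩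
    rw [gaussBinom, ih (by omega), ih (by omega), mul_zero, add_zero]

theorem gaussBinom_mul_qPoch (t : R) {n m : ℕ} (h : m ≤ n) :
    gaussBinom t n m * (qPoch t t m * qPoch t t (n - m)) = qPoch t t n := by
  induction n generalizing m with
  | zero =>
    obtain rfl : m = 0 := by omega
    simp [gaussBinom, qPoch]
  | succ n ih =>
    rcases m with _ | m
    · simp [gaussBinom, qPoch]
    · rw [gaussBinom, Nat.add_sub_add_right, qPoch_succ t t n]
      have h2 := ih (m := m) (by omega)
      have hp : t * t ^ n = t ^ (n - m) * (t * t ^ m) := by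
        rw [← pow_succ', ← pow_succ', ← pow_add]
        congr 1
        omega
      rcases Nat.lt_or_ge m n with hlt | hge
      · have h1 := ih (m := m + 1) (by omega)
        obtain ⟨d, hd⟩ : ∃ d, n - m = d + 1 := ⟨n - m - 1, by omega⟩
        rw [show n - (m + 1) = d by omega, qPoch_succ] at h1
        rw [hd] at h2 hp ⊢
        rw [qPoch_succ] at h2
        rw [qPoch_succ, qPoch_succ, hp]
        linear_combination (1 - t * t ^ d) * h1 + t ^ (d + 1) * (1 - t * t ^ m) * h2
      · obtain rfl : m = n := by omega
        rw [gaussBinom_eq_zero t (Nat.lt_succ_self m), qPoch_succ]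
        rw [Nat.sub_self] at h2 ⊢
        linear_combination (1 - t * t ^ m) * h2

/-- The `q`-Pascal rule splits the sum into the same sums of size `n` for (at, b) and (a, bt), which
share the product ∏_{i<n} (1 - ab t^{n+i}). The prefactors 1 - b t^n and b t^n (1 - a t^n) add up to
the new factor 1 - ab t^{2n}. -/
theorem qVandermonde (a b t : R) (n : ℕ) :
    ∑ m ∈ Finset.range (n + 1), gaussBinom t n m * (t ^ (m * (m - 1)) * b ^ m *
      (qPoch (b * t ^ m) t (n - m) * qPoch (a * t ^ (n - m)) t m)) =
    ∏ i ∈ Finset.range n, (1 - a * b * t ^ (n - 1 + i)) := by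
  induction n generalizing a b with
  | zero => simp [gaussBinom, qPoch]
  | succ n ih =>
    set G : ℕ → R := fun m => t ^ (m * (m - 1)) * b ^ m *
      (qPoch (b * t ^ m) t (n + 1 - m) * qPoch (a * t ^ (n + 1 - m)) t m) with hG
    have hsplit : ∑ m ∈ Finset.range (n + 1 + 1), gaussBinom t (n + 1) m * G m =
        ∑ m ∈ Finset.range (n + 1), gaussBinom t n m * G m +
        ∑ m ∈ Finset.range (n + 1), t ^ (n - m) * gaussBinom t n m * G (m + 1) := by
      have h0 : ∑ m ∈ Finset.range (n + 1), gaussBinom t n m * G m =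
          ∑ m ∈ Finset.range (n + 1 + 1), gaussBinom t n m * G m := by
        rw [Finset.sum_range_succ _ (n + 1), gaussBinom_eq_zero t (Nat.lt_succ_self n), zero_mul,
          add_zero]
      rw [h0, Finset.sum_range_succ', Finset.sum_range_succ' _ (n + 1), gaussBinom_zero_right,
        gaussBinom_zero_right]
      simp only [gaussBinom, add_mul, Finset.sum_add_distrib]
      ring
    -- The last factor of the first Pochhammer symbol does not depend on `m`, and the second symbol
    -- only has `a` replaced by `a * t`.
    have h1 : ∑ m ∈ Finset.range (n + 1), gaussBinom t n m * G m =
        (1 - b * t ^ n) * ∏ i ∈ Finset.range n, (1 - a * b * t ^ (n + i)) := by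
      have hprod : ∏ i ∈ Finset.range n, (1 - a * b * t ^ (n + i)) =
          ∏ i ∈ Finset.range n, (1 - a * t * b * t ^ (n - 1 + i)) := by
        refine Finset.prod_congr rfl fun i hi => ?_
        rw [Finset.mem_range] at hi
        rw [show n + i = n - 1 + i + 1 by omega, pow_succ]
        ring
      rw [hprod, ← ih (a * t) b, Finset.mul_sum]
      refine Finset.sum_congr rfl fun m hm => ?_
      have hm' : m ≤ n := by simpa [Nat.lt_succ_iff] using hm
      have e1 : b * t ^ m * t ^ (n - m) = b * t ^ n := by
        rw [mul_assoc, ← pow_add, Nat.add_sub_cancel' hm']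
      have e2 : a * t ^ (n - m + 1) = a * t * t ^ (n - m) := by rw [pow_succ]; ring
      simp only [hG]
      rw [show n + 1 - m = n - m + 1 by omega, qPoch_succ, e1, e2]
      ring
    -- After the index shift, `b` becomes `b * t`, and the last factor of the second Pochhammer
    -- symbol is independent of `m`.
    have h2 : ∑ m ∈ Finset.range (n + 1), t ^ (n - m) * gaussBinom t n m * G (m + 1) =
        (b * t ^ n * (1 - a * t ^ n)) * ∏ i ∈ Finset.range n, (1 - a * b * t ^ (n + i)) := by
      have hprod : ∏ i ∈ Finset.range n, (1 - a * b * t ^ (n + i)) =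
          ∏ i ∈ Finset.range n, (1 - a * (b * t) * t ^ (n - 1 + i)) := by
        refine Finset.prod_congr rfl fun i hi => ?_
        rw [Finset.mem_range] at hi
        rw [show n + i = n - 1 + i + 1 by omega, pow_succ]
        ring
      rw [hprod, ← ih a (b * t), Finset.mul_sum]
      refine Finset.sum_congr rfl fun m hm => ?_
      have hm' : m ≤ n := by simpa [Nat.lt_succ_iff] using hm
      have e1 : a * t ^ (n - m) * t ^ m = a * t ^ n := by
        rw [mul_assoc, ← pow_add, Nat.sub_add_cancel hm']
      have e2 : b * t ^ (m + 1) = b * t * t ^ m := by rw [pow_succ]; ring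
      have e3 : t ^ (n - m) * t ^ ((m + 1) * m) = t ^ n * (t ^ (m * (m - 1)) * t ^ m) := by
        rw [← pow_add, ← pow_add, ← pow_add]
        congr 1
        rcases m with _ | m
        · simp
        · simp only [Nat.add_sub_cancel]
          have : (m + 1 + 1) * (m + 1) = (m + 1) * m + (m + 1) + (m + 1) := by ring
          omega
      simp only [hG]
      rw [show n + 1 - (m + 1) = n - m by omega, show m + 1 - 1 = m by omega, qPoch_succ, e1, e2,
        mul_pow, pow_succ b]
      linear_combination gaussBinom t n m * b ^ m * b * qPoch (b * t * t ^ m) t (n - m) *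
        qPoch (a * t ^ (n - m)) t m * (1 - a * t ^ n) * e3
    rw [hsplit, h1, h2, Finset.prod_range_succ, Nat.add_sub_cancel]
    have : t ^ (n + n) = t ^ n * t ^ n := pow_add _ _ _
    rw [this]
    ring

end Vandermonde

/-! ### Cartan matrices of the Coxeter graphs -/

section Cartan

/-- The Cartan matrix in which an edge with label `4` points to the smaller vertex. -/
def cartan {m : ℕ} (M : CoxeterMatrix (Fin m)) (i j : Fin m) : ℤ :=
  if i = j then 2 else if M i j = 2 then 0 else if M i j = 3 then -1
  else if i < j then -2 else -1

theorem isCartan_cartan {m : ℕ} {M : CoxeterMatrix (Fin m)}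
    (h : ∀ i j, i ≠ j → M i j = 2 ∨ M i j = 3 ∨ M i j = 4) : IsCartan M (cartan M) := by
  refine ⟨fun i => by simp [cartan], fun i j hij => ?_⟩
  simp only [cartan, if_neg hij, if_neg hij.symm, M.symmetric j i]
  rcases h i j hij with h | h | h <;> simp only [h] <;>
    rcases lt_or_gt_of_ne hij with h' | h' <;> simp [h', not_lt_of_gt h']

/-- Read from its other end, the path of C̃_n has the entry -2 on the wrong side; the transposed
matrix repairs this without a change of the Coxeter group. -/
theorem IsCartan.transpose {B : Type*} {M : CoxeterMatrix B} {A : B → B → ℤ} (h : IsCartan M A) :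
    IsCartan M fun i j => A j i := by
  refine ⟨h.diag, fun i j hij => ?_⟩
  rcases h.off i j hij with h | h | h | h <;> tauto

theorem cartan_ofLabels (m : ℕ) (e : ℕ → ℕ → ℕ) (he : ∀ i j, e i j ≠ 1) {i j : ℕ}
    (hi : i < m + 1) (hj : j < m + 1) : cartan (ofLabels m e he) ⟨i, hi⟩ ⟨j, hj⟩ =
      if i = j then 2 else if e (min i j) (max i j) = 2 then 0
      else if e (min i j) (max i j) = 3 then -1 else if i < j then -2 else -1 := by
  by_cases h : i = j
  · subst h; simp [cartan]
  · simp [cartan, h, ofLabels]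

theorem isCartan_ofLabels (m : ℕ) (e : ℕ → ℕ → ℕ) (he : ∀ i j, e i j ≠ 1)
    (h : ∀ i j, e i j = 2 ∨ e i j = 3 ∨ e i j = 4) :
    IsCartan (ofLabels m e he) (cartan (ofLabels m e he)) := by
  refine isCartan_cartan fun i j hij => ?_
  simpa [ofLabels, hij] using h _ _

theorem isCartan_affineA (m : ℕ) : IsCartan (affineA m) (cartan (affineA m)) :=
  isCartan_ofLabels _ _ _ fun i j => by split_ifs <;> simp

theorem isCartan_affineB (m : ℕ) : IsCartan (affineB m) (cartan (affineB m)) :=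
  isCartan_ofLabels _ _ _ fun i j => by split_ifs <;> simp

theorem isCartan_affineC (m : ℕ) : IsCartan (affineC m) (cartan (affineC m)) :=
  isCartan_ofLabels _ _ _ fun i j => by split_ifs <;> simp

theorem isCartan_affineD (m : ℕ) : IsCartan (affineD m) (cartan (affineD m)) :=
  isCartan_ofLabels _ _ _ fun i j => by split_ifs <;> simp

theorem cartan_affineC (m : ℕ) {i j : ℕ} (hi : i < m + 1) (hj : j < m + 1) :
    cartan (affineC m) ⟨i, hi⟩ ⟨j, hj⟩ =
      if i = j then 2 else if j = i + 1 then (if i = 0 ∨ j = m then -2 else -1)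
      else if i = j + 1 then -1 else 0 := by
  rw [affineC, cartan_ofLabels]
  rcases lt_trichotomy i j with h | h | h
  · rw [min_eq_left h.le, max_eq_right h.le]
    split_ifs <;> omega
  · simp [h]
  · rw [min_eq_right h.le, max_eq_left h.le]
    split_ifs <;> omega

end Cartan

/-! ### The weighted Poincaré series of type `C̃` -/

section Orthogonal

open scoped Pointwise
open CoxeterSystem

variable {B W : Type*} [Group W] {M : CoxeterMatrix B} [Fintype B] [DecidableEq B]
  (cs : CoxeterSystem M W) {A : B → B → ℤ} {c : B → ℕ} {L : W → ℕ} {K K' : Set B}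

theorem parabolic_subset_minReps_of_orthogonal (hA : IsCartan M A)
    (h : ∀ a ∈ K, ∀ b ∈ K', A a b = 0) : (parabolic cs K : Set W) ⊆ minReps cs K' := by
  intro x hx b hb
  apply not_isRightDescent_of_nonneg cs hA
  rw [rootRep_single_of_orthogonal cs hA hx b fun a ha => h a ha b hb]
  exact Pi.single_nonneg.2 zero_le_one

/-- A generator of `K'` can be moved past any element of W_K because it commutes with all generators
of `K`. -/
theorem parabolic_union_of_orthogonal (hA : IsCartan M A) (h : ∀ a ∈ K, ∀ b ∈ K', A a b = 0) :
    (parabolic cs (K ∪ K') : Set W) = (parabolic cs K : Set W) * (parabolic cs K' : Set W) := by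
  have hne : ∀ a ∈ K, ∀ b ∈ K', a ≠ b := by
    rintro a ha b hb rfl
    have := h a ha a hb
    rw [hA.diag] at this
    omega
  apply Set.Subset.antisymm
  · intro w hw
    refine parabolic_induction_left cs
      (p := fun w => w ∈ (parabolic cs K : Set W) * (parabolic cs K' : Set W)) ?_ ?_ hw
    · exact ⟨1, one_mem _, 1, one_mem _, one_mul 1⟩
    · rintro _ i - hi ⟨x, hx, y, hy, rfl⟩
      rcases hi with hi | hi
      · exact ⟨cs.simple i * x, mul_mem (simple_mem_parabolic cs hi) hx, y, hy, mul_assoc _ _ _⟩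
      · refine ⟨x, hx, cs.simple i * y, mul_mem (simple_mem_parabolic cs hi) hy, ?_⟩
        have hcomm : cs.simple i * x = x * cs.simple i := by
          refine parabolic_induction_right cs
            (p := fun x => cs.simple i * x = x * cs.simple i) (by simp) ?_ hx
          intro w a _ ha ih
          rw [← mul_assoc, ih, mul_assoc, mul_assoc,
            commute_of_cartan_eq_zero cs hA (hne a ha i hi) (h a ha i hi)]
        simp only [← mul_assoc, hcomm]
  · rintro _ ⟨x, hx, y, hy, rfl⟩
    exact mul_mem (parabolic_mono cs Set.subset_union_left hx)
      (parabolic_mono cs Set.subset_union_right hy)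

/-- Every element factors uniquely as a minimal representative times an element of W_K times an
element of W_{K'}, with additive weights. -/
theorem levelSeries_univ_of_orthogonal (hA : IsCartan M A) (hL : IsWeight cs c L)
    (h : ∀ a ∈ K, ∀ b ∈ K', A a b = 0) :
    levelSeries L (Set.univ : Set W) = levelSeries L (minReps cs (K ∪ K')) *
      (levelSeries L (parabolic cs K : Set W) * levelSeries L (parabolic cs K' : Set W)) := by
  have hsub := parabolic_subset_minReps_of_orthogonal cs hA h
  rw [← levelSeries_mul hL.finite, ← parabolic_union_of_orthogonal cs hA h,
    ← levelSeries_mul hL.finite]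
  · congr 1
    refine (Set.eq_univ_of_forall fun w => ?_).symm
    obtain ⟨u, hu, x, hx, rfl⟩ := exists_minReps_mul cs (K ∪ K') w
    exact ⟨u, hu, x, hx, rfl⟩
  · intro u hu u' hu' x hx x' hx' he
    exact eq_of_mul_eq_mul cs hA hu hu' hx hx' he
  · intro u hu x hx
    exact hL.mul (length_mul_of_mem_minReps cs hA hu hx)
  · intro u hu u' hu' x hx x' hx' he
    exact eq_of_mul_eq_mul cs hA (hsub hu) (hsub hu') hx hx' he
  · intro u hu x hx
    exact hL.mul (length_mul_of_mem_minReps cs hA (hsub hu) hx)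

/-- The elements with all descents in `K` and no descents in `K'`, for orthogonal `K` and `K'`. -/
theorem levelSeries_descents_of_orthogonal (hA : IsCartan M A) (hL : IsWeight cs c L)
    (h : ∀ a ∈ K, ∀ b ∈ K', A a b = 0) {x₀ : W} (hx₀ : x₀ ∈ parabolic cs K)
    (hdx₀ : ∀ i ∈ K, cs.IsRightDescent x₀ i) :
    levelSeries L {w | (∀ i ∈ K, cs.IsRightDescent w i) ∧ ∀ i ∈ K', ¬ cs.IsRightDescent w i} =
      levelSeries L (minReps cs (K ∪ K')) * X ^ L x₀ := by
  have hsub := parabolic_subset_minReps_of_orthogonal cs hA h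
  have hmono := parabolic_mono cs (Set.subset_union_left (s := K) (t := K'))
  rw [← levelSeries_singleton, ← levelSeries_mul hL.finite]
  · congr 1
    ext w
    constructor
    · rintro ⟨hK, hK'⟩
      obtain ⟨u, hu, x, hx, rfl⟩ := exists_minReps_mul cs (K ∪ K') w
      have hx' : x ∈ (parabolic cs K : Set W) * (parabolic cs K' : Set W) := by
        rw [← parabolic_union_of_orthogonal cs hA h]; exact hx
      obtain ⟨y, hy, z, hz, rfl⟩ := hx'
      have hz1 : z = 1 := by
        refine eq_one_of_mem_minReps cs hA hz fun i hi => ?_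
        rw [← isRightDescent_mul_iff cs hA (hsub hy) hz hi,
          ← isRightDescent_mul_iff cs hA hu hx (Or.inr hi)]
        exact hK' i hi
      subst hz1
      simp only [mul_one] at hK hx ⊢
      have hyx : y = x₀ := eq_of_descents cs hA hy hx₀ (fun i hi => by
        rw [← isRightDescent_mul_iff cs hA hu hx (Or.inl hi)]
        exact hK i hi) hdx₀
      exact ⟨u, hu, x₀, rfl, by rw [hyx]⟩
    · rintro ⟨u, hu, _, rfl, rfl⟩
      refine ⟨fun i hi => ?_, fun i hi => ?_⟩
      · exact (isRightDescent_mul_iff cs hA hu (hmono hx₀) (Or.inl hi)).2 (hdx₀ i hi)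
      · exact mt (isRightDescent_mul_iff cs hA hu (hmono hx₀) (Or.inr hi)).1 (hsub hx₀ i hi)
  · rintro u hu u' hu' _ rfl _ rfl he
    exact ⟨mul_right_cancel he, rfl⟩
  · rintro u hu _ rfl
    exact hL.mul (length_mul_of_mem_minReps cs hA hu (hmono hx₀))

end Orthogonal

/-! ### Descent classes and the Poincaré series of C̃_n -/

section AffineC

open CoxeterSystem

variable {W : Type*} [Group W] {n : ℕ}

/-- Omitting the last vertex leaves a path of type B_n, whose edge of label 4 is the first one. -/
theorem isPathB_affineC (n : ℕ) :
    IsPathB (cartan (affineC n)) (fun i => Fin.ofNat (n + 1) i) n := by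
  refine ⟨fun i hi j hj h => ?_, fun i hi j hj => ?_⟩
  · have := congrArg Fin.val h
    simpa [Nat.mod_eq_of_lt (show i < n + 1 by omega),
      Nat.mod_eq_of_lt (show j < n + 1 by omega)] using this
  · have hi' : Fin.ofNat (n + 1) i = ⟨i, by omega⟩ := Fin.ext (Nat.mod_eq_of_lt (by omega))
    have hj' : Fin.ofNat (n + 1) j = ⟨j, by omega⟩ := Fin.ext (Nat.mod_eq_of_lt (by omega))
    simp only [hi', hj', cartan_affineC, pathCartan]
    split_ifs <;> omega

theorem isPathB_affineC_transpose (hn : 2 ≤ n) :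
    IsPathB (fun i j => cartan (affineC n) j i) (fun i => Fin.ofNat (n + 1) (n - i)) n := by
  refine ⟨fun i hi j hj h => ?_, fun i hi j hj => ?_⟩
  · have := congrArg Fin.val h
    simp [Nat.mod_eq_of_lt (show n - i < n + 1 by omega),
      Nat.mod_eq_of_lt (show n - j < n + 1 by omega)] at this
    omega
  · have hi' : Fin.ofNat (n + 1) (n - i) = ⟨n - i, by omega⟩ :=
      Fin.ext (Nat.mod_eq_of_lt (by omega))
    have hj' : Fin.ofNat (n + 1) (n - j) = ⟨n - j, by omega⟩ :=
      Fin.ext (Nat.mod_eq_of_lt (by omega))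
    simp only [hi', hj', cartan_affineC, pathCartan]
    split_ifs <;> omega

/-- The null root of type `C̃_n`. -/
def nullRoot (n : ℕ) : Fin (n + 1) → ℤ :=
  (2 : ℤ) • coordRoot (fun i => Fin.ofNat (n + 1) i) (n - 1) + Pi.single (Fin.last n) 1

/-- The null root is 2(α_0 + ⋯ + α_{n-1}) + α_n. The last coefficient is smaller because the edges
of label 4 are both oriented towards the smaller vertex. -/
theorem coroot_nullRoot (hn : 2 ≤ n) (i : Fin (n + 1)) :
    coroot (cartan (affineC n)) i (nullRoot n) = 0 := by
  obtain ⟨i, hi⟩ := i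
  rw [nullRoot, map_add, map_zsmul, coroot_single,
    show Fin.last n = ⟨n, by omega⟩ from rfl, cartan_affineC]
  rcases Nat.lt_or_ge i n with h | h
  · have hi' : (⟨i, hi⟩ : Fin (n + 1)) = Fin.ofNat (n + 1) i :=
      (Fin.ext (Nat.mod_eq_of_lt hi)).symm
    have := coroot_coordRoot (isPathB_affineC n) (i := n - 1) (j := i) (by omega) h
    rw [hi', this, smul_eq_mul]
    split_ifs <;> omega
  · obtain rfl : i = n := by omega
    have : coroot (cartan (affineC i)) ⟨i, hi⟩
        (coordRoot (fun k => Fin.ofNat (i + 1) k) (i - 1)) = -1 := by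
      rw [coordRoot, map_sum, Finset.sum_eq_single (i - 1)]
      · have hj' : Fin.ofNat (i + 1) (i - 1) = ⟨i - 1, by omega⟩ :=
          Fin.ext (Nat.mod_eq_of_lt (by omega))
        rw [coroot_single, hj', cartan_affineC]
        split_ifs <;> omega
      · intro j hj hne
        rw [Finset.mem_range] at hj
        have hj' : Fin.ofNat (i + 1) j = ⟨j, by omega⟩ := Fin.ext (Nat.mod_eq_of_lt (by omega))
        rw [coroot_single, hj', cartan_affineC]
        split_ifs <;> omega
      · simp
    rw [this]
    simp

/-- No element of a Coxeter group of type `C̃_n` has all simple reflections as descents. -/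
theorem exists_not_isRightDescent (cs : CoxeterSystem (affineC n) W) (hn : 2 ≤ n) (w : W) :
    ∃ i, ¬ cs.IsRightDescent w i := by
  by_contra! hc
  have hA := isCartan_affineC n
  -- The null root is killed by all coroots, hence fixed by the group; yet it is a positive
  -- combination of simple roots, which `w` would make nonpositive.
  have hfix : rootRep cs hA w (nullRoot n) = nullRoot n := by
    refine cs.simple_induction_right (p := fun w => rootRep cs hA w (nullRoot n) = nullRoot n) w
      (rootRep_one_apply cs hA _) fun w i ih => ?_
    rw [rootRep_mul_apply, rootRep_simple, reflection_apply, coroot_nullRoot hn, zero_smul,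
      sub_zero, ih]
  have hle : rootRep cs hA w (nullRoot n) ≤ 0 := by
    rw [nullRoot, map_add, map_zsmul, coordRoot, map_sum]
    refine add_nonpos (smul_nonpos_of_nonneg_of_nonpos (by norm_num) ?_)
      (rootRep_single_nonpos cs hA (hc _))
    exact Finset.sum_nonpos fun i _ => rootRep_single_nonpos cs hA (hc _)
  rw [hfix] at hle
  have h1 := hle (Fin.last n)
  have h2 := coordRoot_nonneg (fun i => Fin.ofNat (n + 1) i) (n - 1) (Fin.last n)
  simp only [nullRoot, Pi.add_apply, Pi.smul_apply, Pi.single_eq_same, Pi.zero_apply,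
    smul_eq_mul] at h1 h2
  omega

theorem alternating_sum_telescope {R : Type*} [CommRing R] (d : ℕ → R) (n : ℕ) :
    ∑ j ∈ Finset.range n, (-1) ^ j * (d j + d (j + 1)) = d 0 - (-1) ^ n * d n := by
  induction n with
  | zero => simp
  | succ n ih => rw [Finset.sum_range_succ, ih, pow_succ]; ring

/-- The weighted Poincaré series of type `C̃_n`. -/
theorem levelSeries_affineC (cs : CoxeterSystem (affineC n) W) (hn : 2 ≤ n)
    {w : Fin (n + 1) → ℕ} {L : W → ℕ} (hL : IsWeight cs w L) {a b c : ℕ}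
    (ha : ∀ i : Fin (n + 1), i.val = 0 → w i = a)
    (hb : ∀ i : Fin (n + 1), i.val ≠ 0 → i.val ≠ n → w i = b)
    (hc : ∀ i : Fin (n + 1), i.val = n → w i = c) :
    levelSeries L (Set.univ : Set W) * ((1 - X ^ b) ^ n *
      ∏ i ∈ Finset.range n, (1 - X ^ c * X ^ a * (X ^ b) ^ (n - 1 + i))) =
    ∏ i ∈ Finset.range n, ((1 + X ^ a * (X ^ b) ^ i) * (1 + X ^ c * (X ^ b) ^ i) *
      (1 - (X ^ b) ^ (i + 1))) := by
  have hA := isCartan_affineC n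
  set f : ℕ → Fin (n + 1) := fun i => Fin.ofNat (n + 1) i with hf
  set g : ℕ → Fin (n + 1) := fun i => Fin.ofNat (n + 1) (n - i) with hg
  have hfval : ∀ i, i ≤ n → (f i).val = i := fun i hi => Nat.mod_eq_of_lt (by omega)
  have hgval : ∀ i, (g i).val = n - i := fun i => Nat.mod_eq_of_lt (by omega)
  have hfa : w (f 0) = a := ha _ (hfval 0 (by omega))
  have hfb : ∀ i, 0 < i → i < n → w (f i) = b := fun i h h' => hb _
    (by rw [hfval i h'.le]; omega) (by rw [hfval i h'.le]; omega)
  have hgc : w (g 0) = c := hc _ (hgval 0)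
  have hgb : ∀ i, 0 < i → i < n → w (g i) = b := fun i h h' => hb _
    (by rw [hgval i]; omega) (by rw [hgval i]; omega)
  have hfK : ∀ j, j ≤ n → f '' Set.Iio j = {x : Fin (n + 1) | x.val < j} := by
    intro j hj
    ext x
    constructor
    · rintro ⟨i, hi, rfl⟩
      rw [Set.mem_Iio] at hi
      change (f i).val < j
      rw [hfval i (by omega)]
      exact hi
    · intro hx
      exact ⟨x.val, hx, Fin.ext (hfval _ (by omega))⟩
  have hgK : ∀ j, j ≤ n → g '' Set.Iio (n - j) = {x : Fin (n + 1) | j < x.val} := by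
    intro j hj
    ext x
    constructor
    · rintro ⟨i, hi, rfl⟩
      rw [Set.mem_Iio] at hi
      change j < (g i).val
      rw [hgval i]
      omega
    · intro hx
      have hx' : j < x.val := hx
      exact ⟨n - x.val, by rw [Set.mem_Iio]; omega, Fin.ext (by rw [hgval]; omega)⟩
  set t : ℚ⟦X⟧ := X ^ b with ht
  set C := levelSeries L (Set.univ : Set W) with hC
  -- the elements with a prescribed initial segment of descents
  let D : ℕ → Set W := fun j => {w | ∀ i : Fin (n + 1), cs.IsRightDescent w i ↔ i.val < j}
  have hD0 : levelSeries L (D 0) = 1 := by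
    have : D 0 = {1} := by
      ext x
      constructor
      · intro hx
        by_contra hne
        obtain ⟨i, hi⟩ := cs.exists_rightDescent_of_ne_one hne
        exact absurd ((hx i).1 hi) (by omega)
      · rintro rfl i
        simp [cs.not_isRightDescent_one]
    rw [this, levelSeries_singleton, hL.one, pow_zero]
  have hDn : levelSeries L (D (n + 1)) = 0 := by
    have : D (n + 1) = ∅ := by
      ext x
      simp only [Set.mem_empty_iff_false, iff_false]
      intro hx
      obtain ⟨i, hi⟩ := exists_not_isRightDescent cs hn x
      exact hi ((hx i).2 i.isLt)
    rw [this, levelSeries_empty]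
  -- The two descent sets differ only in the vertex `j`, on which the union imposes no condition.
  have hDE : ∀ j ≤ n, levelSeries L (D j) + levelSeries L (D (j + 1)) =
      levelSeries L {w | (∀ i ∈ {x : Fin (n + 1) | x.val < j}, cs.IsRightDescent w i) ∧
        ∀ i ∈ {x : Fin (n + 1) | j < x.val}, ¬ cs.IsRightDescent w i} := by
    intro j hj
    rw [← levelSeries_union hL.finite]
    · congr 1
      ext x
      constructor
      · rintro (hx | hx)
        · exact ⟨fun i hi => (hx i).2 hi, fun i hi h => by
            have h1 := (hx i).1 h
            have h2 : j < i.val := hi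
            omega⟩
        · exact ⟨fun i hi => (hx i).2 (Nat.lt_succ_of_lt hi), fun i hi h => by
            have h1 := (hx i).1 h
            have h2 : j < i.val := hi
            omega⟩
      · rintro ⟨h1, h2⟩
        by_cases hjd : cs.IsRightDescent x ⟨j, by omega⟩
        · right
          intro i
          refine ⟨fun hi => ?_, fun hi => ?_⟩
          · by_contra hlt
            exact h2 i (show j < i.val by omega) hi
          · rcases Nat.lt_succ_iff_lt_or_eq.1 hi with h | h
            · exact h1 i h
            · rwa [show i = ⟨j, by omega⟩ from Fin.ext h]
        · left
          intro i
          refine ⟨fun hi => ?_, fun hi => h1 i hi⟩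
          by_contra hlt
          rcases Nat.lt_or_ge j i.val with h | h
          · exact h2 i h hi
          · rw [show i = ⟨j, by omega⟩ from Fin.ext (by simp; omega)] at hi
            exact hjd hi
    · rw [Set.disjoint_left]
      intro x hx hx'
      have h1 := (hx' ⟨j, by omega⟩).2 (Nat.lt_succ_self j)
      exact absurd ((hx ⟨j, by omega⟩).1 h1) (lt_irrefl j)
  -- their generating series, up to a common factor
  have hE : ∀ j ≤ n, (-1) ^ j * (levelSeries L (D j) + levelSeries L (D (j + 1))) *
      (qPoch (-X ^ a) t n * qPoch (-X ^ c) t n * qPoch t t n) =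
      C * (1 - t) ^ n * (gaussBinom t n j * (t ^ (j * (j - 1)) * (-X ^ a) ^ j *
      (qPoch (-X ^ a * t ^ j) t (n - j) * qPoch (-X ^ c * t ^ (n - j)) t j))) := by
    intro j hj
    -- Removing the vertex `j` cuts the path into two orthogonal pieces of type B.
    have hort : ∀ x ∈ {x : Fin (n + 1) | x.val < j}, ∀ y ∈ {x : Fin (n + 1) | j < x.val},
        cartan (affineC n) x y = 0 := by
      rintro ⟨x, hx⟩ hx' ⟨y, hy⟩ hy'
      have h1 : x < j := hx'
      have h2 : j < y := hy'
      rw [cartan_affineC]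
      split_ifs <;> omega
    obtain ⟨x₀, hx₀, hd, hLx⟩ :=
      exists_longest_path cs hA (isPathB_affineC n) hL hfa hfb (m := j) hj
    rw [show (fun i => Fin.ofNat (n + 1) i) '' Set.Iio j = _ from hfK j hj] at hx₀
    have h1 := levelSeries_descents_of_orthogonal cs hA hL hort hx₀ (fun i hi => by
      have := hd i.val hi
      rwa [show Fin.ofNat (n + 1) i.val = i from Fin.ext (hfval _ (by omega))] at this)
    have h2 := levelSeries_univ_of_orthogonal cs hA hL hort
    have h3 := levelSeries_parabolic_path cs hA (isPathB_affineC n) hL hfa hfb (m := j) hj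
    have h4 := levelSeries_parabolic_path cs hA.transpose (isPathB_affineC_transpose hn) hL hgc
      hgb (m := n - j) (by omega)
    rw [show (fun i => Fin.ofNat (n + 1) i) '' Set.Iio j = _ from hfK j hj] at h3
    rw [show (fun i => Fin.ofNat (n + 1) (n - i)) '' Set.Iio (n - j) = _ from hgK j hj] at h4
    have hq : ∀ (e m : ℕ), ∏ i ∈ Finset.range m, ((1 + X ^ e * t ^ i) * (1 - t ^ (i + 1))) =
        qPoch (-X ^ e : ℚ⟦X⟧) t m * qPoch t t m := by
      intro e m
      rw [qPoch, qPoch, ← Finset.prod_mul_distrib]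
      exact Finset.prod_congr rfl fun i _ => by ring
    rw [hq] at h3 h4
    -- The common denominator is split at `j`: one part cancels against the type B polynomial, the
    -- other remains in the Vandermonde summand.
    have h5 : qPoch (-X ^ a : ℚ⟦X⟧) t n =
        qPoch (-X ^ a) t j * qPoch (-X ^ a * t ^ j) t (n - j) := by
      rw [← qPoch_add, Nat.add_sub_cancel' hj]
    have h6 : qPoch (-X ^ c : ℚ⟦X⟧) t n =
        qPoch (-X ^ c) t (n - j) * qPoch (-X ^ c * t ^ (n - j)) t j := by
      rw [← qPoch_add, Nat.sub_add_cancel hj]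
    have h7 := gaussBinom_mul_qPoch t hj
    have h8 : (1 - t) ^ n = (1 - t) ^ j * (1 - t) ^ (n - j) := by
      rw [← pow_add, Nat.add_sub_cancel' hj]
    have h9 : (X : ℚ⟦X⟧) ^ L x₀ = (X ^ a) ^ j * t ^ (j * (j - 1)) := by
      rw [hLx, ht, pow_add, ← pow_mul, ← pow_mul, mul_comm j a, mul_comm b]
    rw [hDE j hj, h1, h5, h6, ← h7, h8, h9, hC, h2, neg_pow]
    linear_combination (-1) ^ j * levelSeries L (minReps cs _) * (X ^ a) ^ j * t ^ (j * (j - 1)) *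
      gaussBinom t n j * qPoch (-X ^ a * t ^ j) t (n - j) * qPoch (-X ^ c * t ^ (n - j)) t j *
      (- qPoch (-X ^ c) t (n - j) * qPoch t t (n - j) * h3 -
        levelSeries L (parabolic cs {x : Fin (n + 1) | x.val < j} : Set W) * (1 - t) ^ j * h4)
  -- Only the two ends survive: 1 from the identity element, and 0 because no element has every
  -- descent.
  have hsum := alternating_sum_telescope (fun j => levelSeries L (D j)) (n + 1)
  rw [hD0, hDn, mul_zero, sub_zero] at hsum
  -- The parameter `-X ^ a` absorbs the alternating signs, and its powers together with t^{j(j-1)}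
  -- are the weights of the longest elements.
  have hV := qVandermonde (-X ^ c : ℚ⟦X⟧) (-X ^ a) t n
  have hfinal : qPoch (-X ^ a : ℚ⟦X⟧) t n * qPoch (-X ^ c) t n * qPoch t t n =
      C * (1 - t) ^ n * ∏ i ∈ Finset.range n, (1 - -X ^ c * -X ^ a * t ^ (n - 1 + i)) := by
    calc _ = (∑ j ∈ Finset.range (n + 1), (-1) ^ j * (levelSeries L (D j) +
          levelSeries L (D (j + 1)))) *
          (qPoch (-X ^ a : ℚ⟦X⟧) t n * qPoch (-X ^ c) t n * qPoch t t n) := by rw [hsum, one_mul]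
      _ = _ := by
        rw [Finset.sum_mul, ← hV, Finset.mul_sum]
        exact Finset.sum_congr rfl fun j hj => hE j (by rw [Finset.mem_range] at hj; omega)
  rw [← mul_assoc]
  simp only [neg_mul_neg] at hfinal
  rw [← hfinal, qPoch, qPoch, qPoch, ← Finset.prod_mul_distrib, ← Finset.prod_mul_distrib]
  exact Finset.prod_congr rfl fun i _ => by ring

end AffineC

/-! ### Foldings of type `C̃` -/

theorem affineC_apply (n : ℕ) (i j : Fin (n + 1)) (h : i.val < j.val) : affineC n i j =
    if j.val = i.val + 1 then (if i.val = 0 ∨ j.val = n then 4 else 3) else 2 := by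
  have hne : i ≠ j := fun h' => by rw [h'] at h; exact lt_irrefl _ h
  change (if i = j then 1 else if max i.val j.val = min i.val j.val + 1 then
    (if min i.val j.val = 0 ∨ max i.val j.val = n then 4 else 3) else 2) = _
  rw [if_neg hne, min_eq_left h.le, max_eq_right h.le]

theorem affineC_ne_zero (n : ℕ) (i j : Fin (n + 1)) : affineC n i j ≠ 0 := by
  change (if i = j then 1 else if max i.val j.val = min i.val j.val + 1 then
    (if min i.val j.val = 0 ∨ max i.val j.val = n then 4 else 3) else 2) ≠ 0
  split_ifs <;> simp

section Folding

variable {B W : Type*} [Group W] {M : CoxeterMatrix B} [Fintype B] [DecidableEq B] {n : ℕ}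

/-- A partition with blocks `0, …, n`, of which only consecutive ones interact, is a folding of type
`C̃_n` if consecutive blocks satisfy the dihedral condition; its unfolding series is the weighted
Poincaré series of type `C̃_n`. -/
theorem isFolding_affineC (cs : CoxeterSystem M W) {A : B → B → ℤ} (hA : IsCartan M A)
    (p : B → Fin (n + 1)) (r : Fin (n + 1) → W) (hn : 2 ≤ n) {a b c : ℕ}
    (ha : 0 < a) (hb : 0 < b) (hc : 0 < c)
    (hblock : ∀ i : Fin (n + 1), IsBlock cs hA p r i ∧
      cs.length (r i) = if i.val = 0 then a else if i.val = n then c else b)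
    (hadj : ∀ i j : Fin (n + 1), j.val = i.val + 1 →
      IsBlockPair cs hA p r i j (if i.val = 0 ∨ j.val = n then 4 else 3))
    (horth : ∀ x y, (p x).val + 2 ≤ (p y).val → A x y = 0 ∧ A y x = 0) :
    IsFolding cs p r (affineC n) ∧
    unfoldingSeries cs r * ((1 - X ^ b) ^ n *
      ∏ i ∈ Finset.range n, (1 - X ^ c * X ^ a * (X ^ b) ^ (n - 1 + i))) =
    ∏ i ∈ Finset.range n, ((1 + X ^ a * (X ^ b) ^ i) * (1 + X ^ c * (X ^ b) ^ i) *
      (1 - (X ^ b) ^ (i + 1))) := by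
  have hlt : ∀ i j : Fin (n + 1), i.val < j.val → IsBlockPair cs hA p r i j (affineC n i j) := by
    intro i j hij
    rw [affineC_apply n i j hij]
    split_ifs with h1 h2
    · simpa only [if_pos h2] using hadj i j h1
    · simpa only [if_neg h2] using hadj i j h1
    · refine isBlockPair_of_orthogonal cs hA (hblock i).1 (hblock j).1
        (fun h => by rw [h] at hij; exact lt_irrefl _ hij) fun x y hx hy => horth x y ?_
      rw [hx, hy]
      omega
  have hpair : ∀ i j, i ≠ j → IsBlockPair cs hA p r i j (affineC n i j) := by
    intro i j hij
    rcases lt_or_gt_of_ne (fun h => hij (Fin.ext h) : i.val ≠ j.val) with h | h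
    · exact hlt i j h
    · rw [(affineC n).symmetric i j]
      exact IsBlockPair.symm cs hA p r (hlt j i h)
  have hblock' := fun i => (hblock i).1
  have hr := isLiftable_of_blocks cs hA p r hblock' hpair
  refine ⟨isFolding_of_blocks cs hA p r hblock' hpair (affineC_ne_zero n), ?_⟩
  -- The length of the image is a weight function on the abstract group of type C̃_n, which brings
  -- in the weighted Poincaré series.
  have hL : IsWeight (affineC n).toCoxeterSystem (fun i => cs.length (r i))
      (fun w => cs.length (foldingHom r hr w)) := by
    refine ⟨fun i => ?_, by simp, fun w i h => ?_⟩
    · simp only [(hblock i).2]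
      split_ifs <;> assumption
    · exact length_foldingHom_mul_simple cs hA p r hr hblock' hpair (affineC_ne_zero n) h
  rw [unfoldingSeries_eq cs hA p r hr hblock' hpair (affineC_ne_zero n)]
  have := levelSeries_affineC (affineC n).toCoxeterSystem hn hL (a := a) (b := b) (c := c)
    (fun i h => by simp [(hblock i).2, h])
    (fun i h h' => by simp [(hblock i).2, h, h'])
    (fun i h => by simp [(hblock i).2, h, show n ≠ 0 by omega])
  simpa [levelSeries] using this

end Folding

/-! ### The seven foldings -/

section Instances

set_option linter.unusedSimpArgs false

variable {m i j : ℕ}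

theorem cartan_affineA_eq_neg_one {hi : i < m + 1} {hj : j < m + 1} (hne : i ≠ j)
    (h : j = i + 1 ∨ i = j + 1 ∨ (i = 0 ∧ j = m) ∨ (j = 0 ∧ i = m)) :
    cartan (affineA m) ⟨i, hi⟩ ⟨j, hj⟩ = -1 := by
  rw [affineA, cartan_ofLabels, if_neg hne]
  rcases lt_or_gt_of_ne hne with h' | h'
  · rw [min_eq_left h'.le, max_eq_right h'.le]; split_ifs <;> omega
  · rw [min_eq_right h'.le, max_eq_left h'.le]; split_ifs <;> omega

theorem cartan_affineA_eq_zero {hi : i < m + 1} {hj : j < m + 1} (hne : i ≠ j)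
    (h : ¬ (j = i + 1 ∨ i = j + 1 ∨ (i = 0 ∧ j = m) ∨ (j = 0 ∧ i = m))) :
    cartan (affineA m) ⟨i, hi⟩ ⟨j, hj⟩ = 0 := by
  rw [affineA, cartan_ofLabels, if_neg hne, if_pos]
  rcases lt_or_gt_of_ne hne with h' | h'
  · rw [min_eq_left h'.le, max_eq_right h'.le, if_neg (by omega)]
  · rw [min_eq_right h'.le, max_eq_left h'.le, if_neg (by omega)]

theorem cartan_affineB_zero_one {hi : 0 < m + 1} {hj : 1 < m + 1} :
    cartan (affineB m) ⟨0, hi⟩ ⟨1, hj⟩ = -2 := by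
  rw [affineB, cartan_ofLabels]; simp

theorem cartan_affineB_one_zero {hi : 1 < m + 1} {hj : 0 < m + 1} :
    cartan (affineB m) ⟨1, hi⟩ ⟨0, hj⟩ = -1 := by
  rw [affineB, cartan_ofLabels]; simp

theorem cartan_affineB_eq_neg_one {hi : i < m + 1} {hj : j < m + 1} (hne : i ≠ j)
    (h0 : 0 < i ∧ 0 < j) (h : (j = i + 1 ∧ j < m) ∨ (i = j + 1 ∧ i < m) ∨ (i + 2 = m ∧ j = m) ∨
      (j + 2 = m ∧ i = m)) :
    cartan (affineB m) ⟨i, hi⟩ ⟨j, hj⟩ = -1 := by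
  rw [affineB, cartan_ofLabels, if_neg hne]
  rcases lt_or_gt_of_ne hne with h' | h'
  · rw [min_eq_left h'.le, max_eq_right h'.le]; split_ifs <;> omega
  · rw [min_eq_right h'.le, max_eq_left h'.le]; split_ifs <;> omega

theorem cartan_affineB_eq_zero {hi : i < m + 1} {hj : j < m + 1} (hne : i ≠ j)
    (h : ¬ ((i = 0 ∧ j = 1) ∨ (i = 1 ∧ j = 0) ∨ (j = i + 1 ∧ j < m) ∨ (i = j + 1 ∧ i < m) ∨
      (i + 2 = m ∧ j = m) ∨ (j + 2 = m ∧ i = m))) :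
    cartan (affineB m) ⟨i, hi⟩ ⟨j, hj⟩ = 0 := by
  rw [affineB, cartan_ofLabels, if_neg hne, if_pos]
  rcases lt_or_gt_of_ne hne with h' | h'
  · rw [min_eq_left h'.le, max_eq_right h'.le, if_neg (by omega), if_neg (by omega)]
  · rw [min_eq_right h'.le, max_eq_left h'.le, if_neg (by omega), if_neg (by omega)]

theorem cartan_affineC_eq_neg_two {hi : i < m + 1} {hj : j < m + 1} (h : j = i + 1)
    (h' : i = 0 ∨ j = m) : cartan (affineC m) ⟨i, hi⟩ ⟨j, hj⟩ = -2 := by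
  rw [cartan_affineC, if_neg (by omega), if_pos h, if_pos h']

theorem cartan_affineC_eq_neg_one {hi : i < m + 1} {hj : j < m + 1}
    (h : i = j + 1 ∨ (j = i + 1 ∧ i ≠ 0 ∧ j ≠ m)) :
    cartan (affineC m) ⟨i, hi⟩ ⟨j, hj⟩ = -1 := by
  rw [cartan_affineC, if_neg (by omega)]
  split_ifs <;> omega

theorem cartan_affineC_eq_zero {hi : i < m + 1} {hj : j < m + 1} (hne : i ≠ j)
    (h : ¬ (i = j + 1 ∨ j = i + 1)) : cartan (affineC m) ⟨i, hi⟩ ⟨j, hj⟩ = 0 := by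
  rw [cartan_affineC, if_neg hne, if_neg (by omega), if_neg (by omega)]

theorem cartan_affineD_eq_neg_one {hi : i < m + 1} {hj : j < m + 1} (hne : i ≠ j)
    (h : (i = 0 ∧ j = 2) ∨ (i = 2 ∧ j = 0) ∨ (1 ≤ i ∧ j = i + 1 ∧ j < m) ∨
      (1 ≤ j ∧ i = j + 1 ∧ i < m) ∨ (i + 2 = m ∧ j = m) ∨ (j + 2 = m ∧ i = m)) :
    cartan (affineD m) ⟨i, hi⟩ ⟨j, hj⟩ = -1 := by
  rw [affineD, cartan_ofLabels, if_neg hne]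
  rcases lt_or_gt_of_ne hne with h' | h'
  · rw [min_eq_left h'.le, max_eq_right h'.le]; split_ifs <;> omega
  · rw [min_eq_right h'.le, max_eq_left h'.le]; split_ifs <;> omega

theorem cartan_affineD_eq_zero {hi : i < m + 1} {hj : j < m + 1} (hne : i ≠ j)
    (h : ¬ ((i = 0 ∧ j = 2) ∨ (i = 2 ∧ j = 0) ∨ (1 ≤ i ∧ j = i + 1 ∧ j < m) ∨
      (1 ≤ j ∧ i = j + 1 ∧ i < m) ∨ (i + 2 = m ∧ j = m) ∨ (j + 2 = m ∧ i = m))) :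
    cartan (affineD m) ⟨i, hi⟩ ⟨j, hj⟩ = 0 := by
  rw [affineD, cartan_ofLabels, if_neg hne, if_pos]
  rcases lt_or_gt_of_ne hne with h' | h'
  · rw [min_eq_left h'.le, max_eq_right h'.le, if_neg (by omega)]
  · rw [min_eq_right h'.le, max_eq_left h'.le, if_neg (by omega)]

theorem gen_eq (M : CoxeterMatrix (Fin (m + 1))) {k : ℕ} (hk : k < m + 1) :
    gen M k = M.toCoxeterSystem.simple ⟨k, hk⟩ := by
  rw [CoxeterMatrix.toCoxeterSystem_simple, gen]
  congr 1
  exact Fin.ext (Nat.mod_eq_of_lt hk)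

/-- The smaller of x and c - x is at most n, so `Fin.ofNat` does not wrap around. -/
theorem reflectBlock_val {n m c : ℕ} (hc : c ≤ 2 * n + 1) (x : Fin (m + 1)) :
    (reflectBlock n m c x).val = min x.val (c - x.val) :=
  Nat.mod_eq_of_lt (by omega)

theorem forkBlock_val {n : ℕ} (x : Fin (n + 1 + 1)) : (forkBlock n x).val = min x.val n :=
  Nat.mod_eq_of_lt (by omega)

theorem doubleForkBlock_val {n : ℕ} (x : Fin (n + 2 + 1)) :
    (doubleForkBlock n x).val = min (x.val - 1) n :=
  Nat.mod_eq_of_lt (by omega)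

variable {n : ℕ}

/-- A reflection of the cycle fixing two opposite edges: both end blocks are of type A₂ (weight 3)
and meet their neighbours in an A₄; the inner blocks are commuting pairs. -/
theorem isFolding_fold₁ (hn : 2 ≤ n) :
    IsFolding (affineA (2 * n + 1)).toCoxeterSystem (reflectBlock n (2 * n + 1) (2 * n + 1))
      (fold₁ n) (affineC n) ∧
    unfoldingSeries (affineA (2 * n + 1)).toCoxeterSystem (fold₁ n) * ((1 - X ^ 2) ^ n *
      ∏ i ∈ Finset.range n, (1 - X ^ 3 * X ^ 3 * (X ^ 2) ^ (n - 1 + i))) =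
    ∏ i ∈ Finset.range n, ((1 + X ^ 3 * (X ^ 2) ^ i) * (1 + X ^ 3 * (X ^ 2) ^ i) *
      (1 - (X ^ 2) ^ (i + 1))) := by
  have hA := isCartan_affineA (2 * n + 1)
  have h0 : ∀ i : Fin (n + 1), i.val = 0 →
      IsTripleBlock (affineA (2 * n + 1)).toCoxeterSystem
      (reflectBlock n (2 * n + 1) (2 * n + 1)) (fold₁ n) (cartan (affineA (2 * n + 1))) i
      ⟨0, by omega⟩ ⟨2 * n + 1, by omega⟩ := by
    intro i hi
    refine ⟨fun x => ?_, ?_, cartan_affineA_eq_neg_one (by omega) (by omega),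
      cartan_affineA_eq_neg_one (by omega) (by omega), ?_⟩
    · simp only [Fin.ext_iff, reflectBlock_val (le_refl (2 * n + 1))]
      omega
    · simp only [ne_eq, Fin.ext_iff]; omega
    · simp only [fold₁, hi, if_true, show 0 ≠ n by omega, if_false, Nat.sub_zero]
      rw [gen_eq _ (show 0 < 2 * n + 1 + 1 by omega),
        gen_eq _ (show 2 * n + 1 < 2 * n + 1 + 1 by omega)]
  have h1 : ∀ i : Fin (n + 1), i.val = n →
      IsTripleBlock (affineA (2 * n + 1)).toCoxeterSystem
      (reflectBlock n (2 * n + 1) (2 * n + 1)) (fold₁ n) (cartan (affineA (2 * n + 1))) i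
      ⟨n, by omega⟩ ⟨n + 1, by omega⟩ := by
    intro i hi
    refine ⟨fun x => ?_, ?_, cartan_affineA_eq_neg_one (by omega) (by omega),
      cartan_affineA_eq_neg_one (by omega) (by omega), ?_⟩
    · simp only [Fin.ext_iff, reflectBlock_val (le_refl (2 * n + 1))]
      omega
    · simp only [ne_eq, Fin.ext_iff]; omega
    · simp only [fold₁, hi, if_true, show n ≠ 0 by omega, if_false]
      rw [gen_eq _ (show n < 2 * n + 1 + 1 by omega),
        gen_eq _ (show n + 1 < 2 * n + 1 + 1 by omega)]
  have h2 : ∀ i : Fin (n + 1), ∀ (_ : i.val ≠ 0) (_ : i.val ≠ n),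
      IsDoubleBlock (affineA (2 * n + 1)).toCoxeterSystem
      (reflectBlock n (2 * n + 1) (2 * n + 1)) (fold₁ n) (cartan (affineA (2 * n + 1))) i
      ⟨i.val, by omega⟩ ⟨2 * n + 1 - i.val, by omega⟩ := by
    intro i hi hi'
    refine ⟨fun x => ?_, ?_, cartan_affineA_eq_zero (by omega) (by omega),
      cartan_affineA_eq_zero (by omega) (by omega), ?_⟩
    · simp only [Fin.ext_iff, reflectBlock_val (le_refl (2 * n + 1))]
      omega
    · simp only [ne_eq, Fin.ext_iff]; omega
    · simp only [fold₁, hi, hi', if_false]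
      rw [gen_eq _ (show i.val < 2 * n + 1 + 1 by omega),
        gen_eq _ (show 2 * n + 1 - i.val < 2 * n + 1 + 1 by omega)]
  refine isFolding_affineC _ hA _ _ hn (by omega) (by omega) (by omega) ?_ ?_ ?_
  · intro i
    split_ifs with hi hi'
    · exact (h0 i hi).isBlock _ hA
    · exact (h1 i hi').isBlock _ hA
    · exact (h2 i hi hi').isBlock _ hA
  · intro i j hij
    by_cases hi : i.val = 0
    · rw [if_pos (Or.inl hi)]
      exact isBlockPair_A₄ _ hA (h0 i hi) (h2 j (by omega) (by omega))
        (cartan_affineA_eq_neg_one (by omega) (by omega))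
        (cartan_affineA_eq_neg_one (by omega) (by omega))
        (cartan_affineA_eq_neg_one (by omega) (by omega))
        (cartan_affineA_eq_neg_one (by omega) (by omega))
        (cartan_affineA_eq_zero (by omega) (by omega))
        (cartan_affineA_eq_zero (by omega) (by omega))
        (cartan_affineA_eq_zero (by omega) (by omega))
        (cartan_affineA_eq_zero (by omega) (by omega))
    by_cases hj : j.val = n
    · rw [if_pos (Or.inr hj)]
      exact IsBlockPair.symm _ hA _ _ (isBlockPair_A₄ _ hA (h1 j hj) (h2 i hi (by omega))
        (cartan_affineA_eq_neg_one (by omega) (by omega))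
        (cartan_affineA_eq_neg_one (by omega) (by omega))
        (cartan_affineA_eq_neg_one (by omega) (by omega))
        (cartan_affineA_eq_neg_one (by omega) (by omega))
        (cartan_affineA_eq_zero (by omega) (by omega))
        (cartan_affineA_eq_zero (by omega) (by omega))
        (cartan_affineA_eq_zero (by omega) (by omega))
        (cartan_affineA_eq_zero (by omega) (by omega)))
    rw [if_neg (by tauto)]
    exact isBlockPair_A₂A₂ _ hA (h2 i hi (by omega)) (h2 j (by omega) hj)
        (cartan_affineA_eq_neg_one (by omega) (by omega))
        (cartan_affineA_eq_neg_one (by omega) (by omega))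
        (cartan_affineA_eq_neg_one (by omega) (by omega))
        (cartan_affineA_eq_neg_one (by omega) (by omega))
        (cartan_affineA_eq_zero (by omega) (by omega))
        (cartan_affineA_eq_zero (by omega) (by omega))
        (cartan_affineA_eq_zero (by omega) (by omega))
        (cartan_affineA_eq_zero (by omega) (by omega))
  · rintro ⟨x, hx⟩ ⟨y, hy⟩ h
    simp only [reflectBlock_val (le_refl (2 * n + 1))] at h
    exact ⟨cartan_affineA_eq_zero (by omega) (by omega),
      cartan_affineA_eq_zero (by omega) (by omega)⟩

/-- A reflection of the cycle fixing an edge and the opposite vertex: one end comes from an A₄ and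
the other from an A₃. -/
theorem isFolding_fold₂ (hn : 2 ≤ n) :
    IsFolding (affineA (2 * n)).toCoxeterSystem (reflectBlock n (2 * n) (2 * n))
      (fold₂ n) (affineC n) ∧
    unfoldingSeries (affineA (2 * n)).toCoxeterSystem (fold₂ n) * ((1 - X ^ 2) ^ n *
      ∏ i ∈ Finset.range n, (1 - X ^ 1 * X ^ 3 * (X ^ 2) ^ (n - 1 + i))) =
    ∏ i ∈ Finset.range n, ((1 + X ^ 3 * (X ^ 2) ^ i) * (1 + X ^ 1 * (X ^ 2) ^ i) *
      (1 - (X ^ 2) ^ (i + 1))) := by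
  have hA := isCartan_affineA (2 * n)
  have h0 : ∀ i : Fin (n + 1), i.val = 0 →
      IsTripleBlock (affineA (2 * n)).toCoxeterSystem
      (reflectBlock n (2 * n) (2 * n)) (fold₂ n) (cartan (affineA (2 * n))) i
      ⟨0, by omega⟩ ⟨2 * n, by omega⟩ := by
    intro i hi
    refine ⟨fun x => ?_, ?_, cartan_affineA_eq_neg_one (by omega) (by omega),
      cartan_affineA_eq_neg_one (by omega) (by omega), ?_⟩
    · simp only [Fin.ext_iff, reflectBlock_val (Nat.le_succ (2 * n))]
      omega
    · simp only [ne_eq, Fin.ext_iff]; omega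
    · simp only [fold₂, hi, if_true, show 0 ≠ n by omega, if_false, Nat.sub_zero]
      rw [gen_eq _ (show 0 < 2 * n + 1 by omega),
        gen_eq _ (show 2 * n < 2 * n + 1 by omega)]
  have h1 : ∀ i : Fin (n + 1), i.val = n →
      IsSingleBlock (affineA (2 * n)).toCoxeterSystem
      (reflectBlock n (2 * n) (2 * n)) (fold₂ n) i ⟨n, by omega⟩ := by
    intro i hi
    refine ⟨fun x => ?_, ?_⟩
    · simp only [Fin.ext_iff, reflectBlock_val (Nat.le_succ (2 * n))]
      omega
    · simp only [fold₂, hi, if_true, show n ≠ 0 by omega, if_false]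
      rw [gen_eq _ (show n < 2 * n + 1 by omega)]
  have h2 : ∀ i : Fin (n + 1), ∀ (_ : i.val ≠ 0) (_ : i.val ≠ n),
      IsDoubleBlock (affineA (2 * n)).toCoxeterSystem
      (reflectBlock n (2 * n) (2 * n)) (fold₂ n) (cartan (affineA (2 * n))) i
      ⟨i.val, by omega⟩ ⟨2 * n - i.val, by omega⟩ := by
    intro i hi hi'
    refine ⟨fun x => ?_, ?_, cartan_affineA_eq_zero (by omega) (by omega),
      cartan_affineA_eq_zero (by omega) (by omega), ?_⟩
    · simp only [Fin.ext_iff, reflectBlock_val (Nat.le_succ (2 * n))]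
      omega
    · simp only [ne_eq, Fin.ext_iff]; omega
    · simp only [fold₂, hi, hi', if_false]
      rw [gen_eq _ (show i.val < 2 * n + 1 by omega),
        gen_eq _ (show 2 * n - i.val < 2 * n + 1 by omega)]
  refine isFolding_affineC _ hA _ _ hn (by omega) (by omega) (by omega) ?_ ?_ ?_
  · intro i
    split_ifs with hi hi'
    · exact (h0 i hi).isBlock _ hA
    · exact (h1 i hi').isBlock _ hA
    · exact (h2 i hi hi').isBlock _ hA
  · intro i j hij
    by_cases hi : i.val = 0
    · rw [if_pos (Or.inl hi)]
      exact isBlockPair_A₄ _ hA (h0 i hi) (h2 j (by omega) (by omega))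
        (cartan_affineA_eq_neg_one (by omega) (by omega))
        (cartan_affineA_eq_neg_one (by omega) (by omega))
        (cartan_affineA_eq_neg_one (by omega) (by omega))
        (cartan_affineA_eq_neg_one (by omega) (by omega))
        (cartan_affineA_eq_zero (by omega) (by omega))
        (cartan_affineA_eq_zero (by omega) (by omega))
        (cartan_affineA_eq_zero (by omega) (by omega))
        (cartan_affineA_eq_zero (by omega) (by omega))
    by_cases hj : j.val = n
    · rw [if_pos (Or.inr hj)]
      exact IsBlockPair.symm _ hA _ _ (isBlockPair_A₃ _ hA (h1 j hj) (h2 i hi (by omega))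
        (cartan_affineA_eq_neg_one (by omega) (by omega))
        (cartan_affineA_eq_neg_one (by omega) (by omega))
        (cartan_affineA_eq_neg_one (by omega) (by omega))
        (cartan_affineA_eq_neg_one (by omega) (by omega)))
    rw [if_neg (by tauto)]
    exact isBlockPair_A₂A₂ _ hA (h2 i hi (by omega)) (h2 j (by omega) hj)
        (cartan_affineA_eq_neg_one (by omega) (by omega))
        (cartan_affineA_eq_neg_one (by omega) (by omega))
        (cartan_affineA_eq_neg_one (by omega) (by omega))
        (cartan_affineA_eq_neg_one (by omega) (by omega))
        (cartan_affineA_eq_zero (by omega) (by omega))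
        (cartan_affineA_eq_zero (by omega) (by omega))
        (cartan_affineA_eq_zero (by omega) (by omega))
        (cartan_affineA_eq_zero (by omega) (by omega))
  · rintro ⟨x, hx⟩ ⟨y, hy⟩ h
    simp only [reflectBlock_val (Nat.le_succ (2 * n))] at h
    exact ⟨cartan_affineA_eq_zero (by omega) (by omega),
      cartan_affineA_eq_zero (by omega) (by omega)⟩

/-- A reflection of the cycle fixing two opposite vertices: each of them and its two neighbours form
an A₃. -/
theorem isFolding_fold₃ (hn : 2 ≤ n) :
    IsFolding (affineA (2 * n - 1)).toCoxeterSystem (reflectBlock n (2 * n - 1) (2 * n))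
      (fold₃ n) (affineC n) ∧
    unfoldingSeries (affineA (2 * n - 1)).toCoxeterSystem (fold₃ n) * ((1 - X ^ 2) ^ n *
      ∏ i ∈ Finset.range n, (1 - X ^ 1 * X ^ 1 * (X ^ 2) ^ (n - 1 + i))) =
    ∏ i ∈ Finset.range n, ((1 + X ^ 1 * (X ^ 2) ^ i) * (1 + X ^ 1 * (X ^ 2) ^ i) *
      (1 - (X ^ 2) ^ (i + 1))) := by
  have hA := isCartan_affineA (2 * n - 1)
  have h0 : ∀ i : Fin (n + 1), i.val = 0 →
      IsSingleBlock (affineA (2 * n - 1)).toCoxeterSystem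
      (reflectBlock n (2 * n - 1) (2 * n)) (fold₃ n) i ⟨0, by omega⟩ := by
    intro i hi
    refine ⟨fun x => ?_, ?_⟩
    · simp only [Fin.ext_iff, reflectBlock_val (Nat.le_succ (2 * n))]
      omega
    · simp only [fold₃, hi, if_true, show 0 ≠ n by omega, if_false, Nat.sub_zero]
      rw [gen_eq _ (show 0 < 2 * n - 1 + 1 by omega)]
  have h1 : ∀ i : Fin (n + 1), i.val = n →
      IsSingleBlock (affineA (2 * n - 1)).toCoxeterSystem
      (reflectBlock n (2 * n - 1) (2 * n)) (fold₃ n) i ⟨n, by omega⟩ := by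
    intro i hi
    refine ⟨fun x => ?_, ?_⟩
    · simp only [Fin.ext_iff, reflectBlock_val (Nat.le_succ (2 * n))]
      omega
    · simp only [fold₃, hi, if_true, show n ≠ 0 by omega, if_false]
      rw [gen_eq _ (show n < 2 * n - 1 + 1 by omega)]
  have h2 : ∀ i : Fin (n + 1), ∀ (_ : i.val ≠ 0) (_ : i.val ≠ n),
      IsDoubleBlock (affineA (2 * n - 1)).toCoxeterSystem
      (reflectBlock n (2 * n - 1) (2 * n)) (fold₃ n) (cartan (affineA (2 * n - 1))) i
      ⟨i.val, by omega⟩ ⟨2 * n - i.val, by omega⟩ := by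
    intro i hi hi'
    refine ⟨fun x => ?_, ?_, cartan_affineA_eq_zero (by omega) (by omega),
      cartan_affineA_eq_zero (by omega) (by omega), ?_⟩
    · simp only [Fin.ext_iff, reflectBlock_val (Nat.le_succ (2 * n))]
      omega
    · simp only [ne_eq, Fin.ext_iff]; omega
    · simp only [fold₃, hi, hi', if_false]
      rw [gen_eq _ (show i.val < 2 * n - 1 + 1 by omega),
        gen_eq _ (show 2 * n - i.val < 2 * n - 1 + 1 by omega)]
  refine isFolding_affineC _ hA _ _ hn (by omega) (by omega) (by omega) ?_ ?_ ?_
  · intro i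
    split_ifs with hi hi'
    · exact (h0 i hi).isBlock _ hA
    · exact (h1 i hi').isBlock _ hA
    · exact (h2 i hi hi').isBlock _ hA
  · intro i j hij
    by_cases hi : i.val = 0
    · rw [if_pos (Or.inl hi)]
      exact isBlockPair_A₃ _ hA (h0 i hi) (h2 j (by omega) (by omega))
        (cartan_affineA_eq_neg_one (by omega) (by omega))
        (cartan_affineA_eq_neg_one (by omega) (by omega))
        (cartan_affineA_eq_neg_one (by omega) (by omega))
        (cartan_affineA_eq_neg_one (by omega) (by omega))
    by_cases hj : j.val = n
    · rw [if_pos (Or.inr hj)]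
      exact IsBlockPair.symm _ hA _ _ (isBlockPair_A₃ _ hA (h1 j hj) (h2 i hi (by omega))
        (cartan_affineA_eq_neg_one (by omega) (by omega))
        (cartan_affineA_eq_neg_one (by omega) (by omega))
        (cartan_affineA_eq_neg_one (by omega) (by omega))
        (cartan_affineA_eq_neg_one (by omega) (by omega)))
    rw [if_neg (by tauto)]
    exact isBlockPair_A₂A₂ _ hA (h2 i hi (by omega)) (h2 j (by omega) hj)
        (cartan_affineA_eq_neg_one (by omega) (by omega))
        (cartan_affineA_eq_neg_one (by omega) (by omega))
        (cartan_affineA_eq_neg_one (by omega) (by omega))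
        (cartan_affineA_eq_neg_one (by omega) (by omega))
        (cartan_affineA_eq_zero (by omega) (by omega))
        (cartan_affineA_eq_zero (by omega) (by omega))
        (cartan_affineA_eq_zero (by omega) (by omega))
        (cartan_affineA_eq_zero (by omega) (by omega))
  · rintro ⟨x, hx⟩ ⟨y, hy⟩ h
    simp only [reflectBlock_val (Nat.le_succ (2 * n))] at h
    exact ⟨cartan_affineA_eq_zero (by omega) (by omega),
      cartan_affineA_eq_zero (by omega) (by omega)⟩

/-- The edge of label 4 is kept, and the fork at the other end is an A₃ whose two end vertices are
joined in one block. -/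
theorem isFolding_fold₄ (hn : 2 ≤ n) :
    IsFolding (affineB (n + 1)).toCoxeterSystem (forkBlock n)
      (fold₄ n) (affineC n) ∧
    unfoldingSeries (affineB (n + 1)).toCoxeterSystem (fold₄ n) * ((1 - X ^ 1) ^ n *
      ∏ i ∈ Finset.range n, (1 - X ^ 2 * X ^ 1 * (X ^ 1) ^ (n - 1 + i))) =
    ∏ i ∈ Finset.range n, ((1 + X ^ 1 * (X ^ 1) ^ i) * (1 + X ^ 2 * (X ^ 1) ^ i) *
      (1 - (X ^ 1) ^ (i + 1))) := by
  have hA := isCartan_affineB (n + 1)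
  have h0 : ∀ i : Fin (n + 1), i.val = 0 →
      IsSingleBlock (affineB (n + 1)).toCoxeterSystem
      (forkBlock n) (fold₄ n) i ⟨0, by omega⟩ := by
    intro i hi
    refine ⟨fun x => ?_, ?_⟩
    · simp only [Fin.ext_iff, forkBlock_val]
      omega
    · simp only [fold₄, hi, if_true, show 0 ≠ n by omega, if_false, Nat.sub_zero]
      rw [gen_eq _ (show 0 < n + 1 + 1 by omega)]
  have h1 : ∀ i : Fin (n + 1), i.val = n →
      IsDoubleBlock (affineB (n + 1)).toCoxeterSystem
      (forkBlock n) (fold₄ n) (cartan (affineB (n + 1))) i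
      ⟨n, by omega⟩ ⟨n + 1, by omega⟩ := by
    intro i hi
    refine ⟨fun x => ?_, ?_, cartan_affineB_eq_zero (by omega) (by omega),
      cartan_affineB_eq_zero (by omega) (by omega), ?_⟩
    · simp only [Fin.ext_iff, forkBlock_val]
      omega
    · simp only [ne_eq, Fin.ext_iff]; omega
    · simp only [fold₄, hi, if_true, show n ≠ 0 by omega, if_false]
      rw [gen_eq _ (show n < n + 1 + 1 by omega),
        gen_eq _ (show n + 1 < n + 1 + 1 by omega)]
  have h2 : ∀ i : Fin (n + 1), ∀ (_ : i.val ≠ 0) (_ : i.val ≠ n),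
      IsSingleBlock (affineB (n + 1)).toCoxeterSystem
      (forkBlock n) (fold₄ n) i ⟨i.val, by omega⟩ := by
    intro i hi hi'
    refine ⟨fun x => ?_, ?_⟩
    · simp only [Fin.ext_iff, forkBlock_val]
      omega
    · simp only [fold₄, hi, hi', if_false]
      rw [gen_eq _ (show i.val < n + 1 + 1 by omega)]
  refine isFolding_affineC _ hA _ _ hn (by omega) (by omega) (by omega) ?_ ?_ ?_
  · intro i
    split_ifs with hi hi'
    · exact (h0 i hi).isBlock _ hA
    · exact (h1 i hi').isBlock _ hA
    · exact (h2 i hi hi').isBlock _ hA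
  · intro i j hij
    by_cases hi : i.val = 0
    · rw [if_pos (Or.inl hi)]
      have hj : j.val = 1 := by omega
      refine isBlockPair_B₂ _ hA (h0 i hi) (h2 j (by omega) (by omega)) ?_ ?_
      · simp only [hj]; exact cartan_affineB_zero_one
      · simp only [hj]; exact cartan_affineB_one_zero
    by_cases hj : j.val = n
    · rw [if_pos (Or.inr hj)]
      exact isBlockPair_A₃ _ hA (h2 i hi (by omega)) (h1 j hj)
        (cartan_affineB_eq_neg_one (by omega) (by omega) (by omega))
        (cartan_affineB_eq_neg_one (by omega) (by omega) (by omega))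
        (cartan_affineB_eq_neg_one (by omega) (by omega) (by omega))
        (cartan_affineB_eq_neg_one (by omega) (by omega) (by omega))
    rw [if_neg (by tauto)]
    exact isBlockPair_A₂ _ hA (h2 i hi (by omega)) (h2 j (by omega) hj)
        (cartan_affineB_eq_neg_one (by omega) (by omega) (by omega))
        (cartan_affineB_eq_neg_one (by omega) (by omega) (by omega))
  · rintro ⟨x, hx⟩ ⟨y, hy⟩ h
    simp only [forkBlock_val] at h
    exact ⟨cartan_affineB_eq_zero (by omega) (by omega),
      cartan_affineB_eq_zero (by omega) (by omega)⟩

/-- Both forks are folded, each giving an edge of label 4. -/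
theorem isFolding_fold₅ (hn : 2 ≤ n) :
    IsFolding (affineD (n + 2)).toCoxeterSystem (doubleForkBlock n)
      (fold₅ n) (affineC n) ∧
    unfoldingSeries (affineD (n + 2)).toCoxeterSystem (fold₅ n) * ((1 - X ^ 1) ^ n *
      ∏ i ∈ Finset.range n, (1 - X ^ 2 * X ^ 2 * (X ^ 1) ^ (n - 1 + i))) =
    ∏ i ∈ Finset.range n, ((1 + X ^ 2 * (X ^ 1) ^ i) * (1 + X ^ 2 * (X ^ 1) ^ i) *
      (1 - (X ^ 1) ^ (i + 1))) := by
  have hA := isCartan_affineD (n + 2)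
  have h0 : ∀ i : Fin (n + 1), i.val = 0 →
      IsDoubleBlock (affineD (n + 2)).toCoxeterSystem
      (doubleForkBlock n) (fold₅ n) (cartan (affineD (n + 2))) i
      ⟨0, by omega⟩ ⟨1, by omega⟩ := by
    intro i hi
    refine ⟨fun x => ?_, ?_, cartan_affineD_eq_zero (by omega) (by omega),
      cartan_affineD_eq_zero (by omega) (by omega), ?_⟩
    · simp only [Fin.ext_iff, doubleForkBlock_val]
      omega
    · simp only [ne_eq, Fin.ext_iff]; omega
    · simp only [fold₅, hi, if_true, show 0 ≠ n by omega, if_false, Nat.sub_zero]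
      rw [gen_eq _ (show 0 < n + 2 + 1 by omega),
        gen_eq _ (show 1 < n + 2 + 1 by omega)]
  have h1 : ∀ i : Fin (n + 1), i.val = n →
      IsDoubleBlock (affineD (n + 2)).toCoxeterSystem
      (doubleForkBlock n) (fold₅ n) (cartan (affineD (n + 2))) i
      ⟨n + 1, by omega⟩ ⟨n + 2, by omega⟩ := by
    intro i hi
    refine ⟨fun x => ?_, ?_, cartan_affineD_eq_zero (by omega) (by omega),
      cartan_affineD_eq_zero (by omega) (by omega), ?_⟩
    · simp only [Fin.ext_iff, doubleForkBlock_val]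
      omega
    · simp only [ne_eq, Fin.ext_iff]; omega
    · simp only [fold₅, hi, if_true, show n ≠ 0 by omega, if_false]
      rw [gen_eq _ (show n + 1 < n + 2 + 1 by omega),
        gen_eq _ (show n + 2 < n + 2 + 1 by omega)]
  have h2 : ∀ i : Fin (n + 1), ∀ (_ : i.val ≠ 0) (_ : i.val ≠ n),
      IsSingleBlock (affineD (n + 2)).toCoxeterSystem
      (doubleForkBlock n) (fold₅ n) i ⟨i.val + 1, by omega⟩ := by
    intro i hi hi'
    refine ⟨fun x => ?_, ?_⟩
    · simp only [Fin.ext_iff, doubleForkBlock_val]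
      omega
    · simp only [fold₅, hi, hi', if_false]
      rw [gen_eq _ (show i.val + 1 < n + 2 + 1 by omega)]
  refine isFolding_affineC _ hA _ _ hn (by omega) (by omega) (by omega) ?_ ?_ ?_
  · intro i
    split_ifs with hi hi'
    · exact (h0 i hi).isBlock _ hA
    · exact (h1 i hi').isBlock _ hA
    · exact (h2 i hi hi').isBlock _ hA
  · intro i j hij
    by_cases hi : i.val = 0
    · rw [if_pos (Or.inl hi)]
      exact IsBlockPair.symm _ hA _ _ (isBlockPair_A₃ _ hA (h2 j (by omega) (by omega)) (h0 i hi)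
        (cartan_affineD_eq_neg_one (by omega) (by omega))
        (cartan_affineD_eq_neg_one (by omega) (by omega))
        (cartan_affineD_eq_neg_one (by omega) (by omega))
        (cartan_affineD_eq_neg_one (by omega) (by omega)))
    by_cases hj : j.val = n
    · rw [if_pos (Or.inr hj)]
      exact isBlockPair_A₃ _ hA (h2 i hi (by omega)) (h1 j hj)
        (cartan_affineD_eq_neg_one (by omega) (by omega))
        (cartan_affineD_eq_neg_one (by omega) (by omega))
        (cartan_affineD_eq_neg_one (by omega) (by omega))
        (cartan_affineD_eq_neg_one (by omega) (by omega))
    rw [if_neg (by tauto)]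
    exact isBlockPair_A₂ _ hA (h2 i hi (by omega)) (h2 j (by omega) hj)
        (cartan_affineD_eq_neg_one (by omega) (by omega))
        (cartan_affineD_eq_neg_one (by omega) (by omega))
  · rintro ⟨x, hx⟩ ⟨y, hy⟩ h
    simp only [doubleForkBlock_val] at h
    exact ⟨cartan_affineD_eq_zero (by omega) (by omega),
      cartan_affineD_eq_zero (by omega) (by omega)⟩

/-- The flip of the path superimposes its two edges of label 4, giving B₂ × B₂, and fixes the middle
edge, giving an A₄. -/
theorem isFolding_fold₆ (hn : 2 ≤ n) :
    IsFolding (affineC (2 * n + 1)).toCoxeterSystem (reflectBlock n (2 * n + 1) (2 * n + 1))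
      (fold₆ n) (affineC n) ∧
    unfoldingSeries (affineC (2 * n + 1)).toCoxeterSystem (fold₆ n) * ((1 - X ^ 2) ^ n *
      ∏ i ∈ Finset.range n, (1 - X ^ 3 * X ^ 2 * (X ^ 2) ^ (n - 1 + i))) =
    ∏ i ∈ Finset.range n, ((1 + X ^ 2 * (X ^ 2) ^ i) * (1 + X ^ 3 * (X ^ 2) ^ i) *
      (1 - (X ^ 2) ^ (i + 1))) := by
  have hA := isCartan_affineC (2 * n + 1)
  have h0 : ∀ i : Fin (n + 1), i.val = 0 →
      IsDoubleBlock (affineC (2 * n + 1)).toCoxeterSystem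
      (reflectBlock n (2 * n + 1) (2 * n + 1)) (fold₆ n) (cartan (affineC (2 * n + 1))) i
      ⟨0, by omega⟩ ⟨2 * n + 1, by omega⟩ := by
    intro i hi
    refine ⟨fun x => ?_, ?_, cartan_affineC_eq_zero (by omega) (by omega),
      cartan_affineC_eq_zero (by omega) (by omega), ?_⟩
    · simp only [Fin.ext_iff, reflectBlock_val (le_refl (2 * n + 1))]
      omega
    · simp only [ne_eq, Fin.ext_iff]; omega
    · simp only [fold₆, hi, if_true, show 0 ≠ n by omega, if_false, Nat.sub_zero]
      rw [gen_eq _ (show 0 < 2 * n + 1 + 1 by omega),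
        gen_eq _ (show 2 * n + 1 < 2 * n + 1 + 1 by omega)]
  have h1 : ∀ i : Fin (n + 1), i.val = n →
      IsTripleBlock (affineC (2 * n + 1)).toCoxeterSystem
      (reflectBlock n (2 * n + 1) (2 * n + 1)) (fold₆ n) (cartan (affineC (2 * n + 1))) i
      ⟨n, by omega⟩ ⟨n + 1, by omega⟩ := by
    intro i hi
    refine ⟨fun x => ?_, ?_, cartan_affineC_eq_neg_one (by omega),
      cartan_affineC_eq_neg_one (by omega), ?_⟩
    · simp only [Fin.ext_iff, reflectBlock_val (le_refl (2 * n + 1))]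
      omega
    · simp only [ne_eq, Fin.ext_iff]; omega
    · simp only [fold₆, hi, if_true, show n ≠ 0 by omega, if_false]
      rw [gen_eq _ (show n < 2 * n + 1 + 1 by omega),
        gen_eq _ (show n + 1 < 2 * n + 1 + 1 by omega)]
  have h2 : ∀ i : Fin (n + 1), ∀ (_ : i.val ≠ 0) (_ : i.val ≠ n),
      IsDoubleBlock (affineC (2 * n + 1)).toCoxeterSystem
      (reflectBlock n (2 * n + 1) (2 * n + 1)) (fold₆ n) (cartan (affineC (2 * n + 1))) i
      ⟨i.val, by omega⟩ ⟨2 * n + 1 - i.val, by omega⟩ := by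
    intro i hi hi'
    refine ⟨fun x => ?_, ?_, cartan_affineC_eq_zero (by omega) (by omega),
      cartan_affineC_eq_zero (by omega) (by omega), ?_⟩
    · simp only [Fin.ext_iff, reflectBlock_val (le_refl (2 * n + 1))]
      omega
    · simp only [ne_eq, Fin.ext_iff]; omega
    · simp only [fold₆, hi, hi', if_false]
      rw [gen_eq _ (show i.val < 2 * n + 1 + 1 by omega),
        gen_eq _ (show 2 * n + 1 - i.val < 2 * n + 1 + 1 by omega)]
  refine isFolding_affineC _ hA _ _ hn (by omega) (by omega) (by omega) ?_ ?_ ?_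
  · intro i
    split_ifs with hi hi'
    · exact (h0 i hi).isBlock _ hA
    · exact (h1 i hi').isBlock _ hA
    · exact (h2 i hi hi').isBlock _ hA
  · intro i j hij
    by_cases hi : i.val = 0
    · rw [if_pos (Or.inl hi)]
      exact isBlockPair_B₂B₂ _ hA (h0 i hi) (h2 j (by omega) (by omega))
        (cartan_affineC_eq_neg_two (by omega) (by omega))
        (cartan_affineC_eq_neg_one (by omega))
        (cartan_affineC_eq_neg_one (by omega))
        (cartan_affineC_eq_neg_two (by omega) (by omega))
        (cartan_affineC_eq_zero (by omega) (by omega))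
        (cartan_affineC_eq_zero (by omega) (by omega))
        (cartan_affineC_eq_zero (by omega) (by omega))
        (cartan_affineC_eq_zero (by omega) (by omega))
    by_cases hj : j.val = n
    · rw [if_pos (Or.inr hj)]
      exact IsBlockPair.symm _ hA _ _ (isBlockPair_A₄ _ hA (h1 j hj) (h2 i hi (by omega))
        (cartan_affineC_eq_neg_one (by omega))
        (cartan_affineC_eq_neg_one (by omega))
        (cartan_affineC_eq_neg_one (by omega))
        (cartan_affineC_eq_neg_one (by omega))
        (cartan_affineC_eq_zero (by omega) (by omega))
        (cartan_affineC_eq_zero (by omega) (by omega))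
        (cartan_affineC_eq_zero (by omega) (by omega))
        (cartan_affineC_eq_zero (by omega) (by omega)))
    rw [if_neg (by tauto)]
    exact isBlockPair_A₂A₂ _ hA (h2 i hi (by omega)) (h2 j (by omega) hj)
        (cartan_affineC_eq_neg_one (by omega))
        (cartan_affineC_eq_neg_one (by omega))
        (cartan_affineC_eq_neg_one (by omega))
        (cartan_affineC_eq_neg_one (by omega))
        (cartan_affineC_eq_zero (by omega) (by omega))
        (cartan_affineC_eq_zero (by omega) (by omega))
        (cartan_affineC_eq_zero (by omega) (by omega))
        (cartan_affineC_eq_zero (by omega) (by omega))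
  · rintro ⟨x, hx⟩ ⟨y, hy⟩ h
    simp only [reflectBlock_val (le_refl (2 * n + 1))] at h
    exact ⟨cartan_affineC_eq_zero (by omega) (by omega),
      cartan_affineC_eq_zero (by omega) (by omega)⟩

/-- The flip of the path gives B₂ × B₂ at the ends and fixes the middle vertex, which gives an A₃.
-/
theorem isFolding_fold₇ (hn : 2 ≤ n) :
    IsFolding (affineC (2 * n)).toCoxeterSystem (reflectBlock n (2 * n) (2 * n))
      (fold₇ n) (affineC n) ∧
    unfoldingSeries (affineC (2 * n)).toCoxeterSystem (fold₇ n) * ((1 - X ^ 2) ^ n *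
      ∏ i ∈ Finset.range n, (1 - X ^ 1 * X ^ 2 * (X ^ 2) ^ (n - 1 + i))) =
    ∏ i ∈ Finset.range n, ((1 + X ^ 2 * (X ^ 2) ^ i) * (1 + X ^ 1 * (X ^ 2) ^ i) *
      (1 - (X ^ 2) ^ (i + 1))) := by
  have hA := isCartan_affineC (2 * n)
  have h0 : ∀ i : Fin (n + 1), i.val = 0 →
      IsDoubleBlock (affineC (2 * n)).toCoxeterSystem
      (reflectBlock n (2 * n) (2 * n)) (fold₇ n) (cartan (affineC (2 * n))) i
      ⟨0, by omega⟩ ⟨2 * n, by omega⟩ := by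
    intro i hi
    refine ⟨fun x => ?_, ?_, cartan_affineC_eq_zero (by omega) (by omega),
      cartan_affineC_eq_zero (by omega) (by omega), ?_⟩
    · simp only [Fin.ext_iff, reflectBlock_val (Nat.le_succ (2 * n))]
      omega
    · simp only [ne_eq, Fin.ext_iff]; omega
    · simp only [fold₇, hi, if_true, show 0 ≠ n by omega, if_false, Nat.sub_zero]
      rw [gen_eq _ (show 0 < 2 * n + 1 by omega),
        gen_eq _ (show 2 * n < 2 * n + 1 by omega)]
  have h1 : ∀ i : Fin (n + 1), i.val = n →
      IsSingleBlock (affineC (2 * n)).toCoxeterSystem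
      (reflectBlock n (2 * n) (2 * n)) (fold₇ n) i ⟨n, by omega⟩ := by
    intro i hi
    refine ⟨fun x => ?_, ?_⟩
    · simp only [Fin.ext_iff, reflectBlock_val (Nat.le_succ (2 * n))]
      omega
    · simp only [fold₇, hi, if_true, show n ≠ 0 by omega, if_false]
      rw [gen_eq _ (show n < 2 * n + 1 by omega)]
  have h2 : ∀ i : Fin (n + 1), ∀ (_ : i.val ≠ 0) (_ : i.val ≠ n),
      IsDoubleBlock (affineC (2 * n)).toCoxeterSystem
      (reflectBlock n (2 * n) (2 * n)) (fold₇ n) (cartan (affineC (2 * n))) i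
      ⟨i.val, by omega⟩ ⟨2 * n - i.val, by omega⟩ := by
    intro i hi hi'
    refine ⟨fun x => ?_, ?_, cartan_affineC_eq_zero (by omega) (by omega),
      cartan_affineC_eq_zero (by omega) (by omega), ?_⟩
    · simp only [Fin.ext_iff, reflectBlock_val (Nat.le_succ (2 * n))]
      omega
    · simp only [ne_eq, Fin.ext_iff]; omega
    · simp only [fold₇, hi, hi', if_false]
      rw [gen_eq _ (show i.val < 2 * n + 1 by omega),
        gen_eq _ (show 2 * n - i.val < 2 * n + 1 by omega)]
  refine isFolding_affineC _ hA _ _ hn (by omega) (by omega) (by omega) ?_ ?_ ?_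
  · intro i
    split_ifs with hi hi'
    · exact (h0 i hi).isBlock _ hA
    · exact (h1 i hi').isBlock _ hA
    · exact (h2 i hi hi').isBlock _ hA
  · intro i j hij
    by_cases hi : i.val = 0
    · rw [if_pos (Or.inl hi)]
      exact isBlockPair_B₂B₂ _ hA (h0 i hi) (h2 j (by omega) (by omega))
        (cartan_affineC_eq_neg_two (by omega) (by omega))
        (cartan_affineC_eq_neg_one (by omega))
        (cartan_affineC_eq_neg_one (by omega))
        (cartan_affineC_eq_neg_two (by omega) (by omega))
        (cartan_affineC_eq_zero (by omega) (by omega))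
        (cartan_affineC_eq_zero (by omega) (by omega))
        (cartan_affineC_eq_zero (by omega) (by omega))
        (cartan_affineC_eq_zero (by omega) (by omega))
    by_cases hj : j.val = n
    · rw [if_pos (Or.inr hj)]
      exact IsBlockPair.symm _ hA _ _ (isBlockPair_A₃ _ hA (h1 j hj) (h2 i hi (by omega))
        (cartan_affineC_eq_neg_one (by omega))
        (cartan_affineC_eq_neg_one (by omega))
        (cartan_affineC_eq_neg_one (by omega))
        (cartan_affineC_eq_neg_one (by omega)))
    rw [if_neg (by tauto)]
    exact isBlockPair_A₂A₂ _ hA (h2 i hi (by omega)) (h2 j (by omega) hj)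
        (cartan_affineC_eq_neg_one (by omega))
        (cartan_affineC_eq_neg_one (by omega))
        (cartan_affineC_eq_neg_one (by omega))
        (cartan_affineC_eq_neg_one (by omega))
        (cartan_affineC_eq_zero (by omega) (by omega))
        (cartan_affineC_eq_zero (by omega) (by omega))
        (cartan_affineC_eq_zero (by omega) (by omega))
        (cartan_affineC_eq_zero (by omega) (by omega))
  · rintro ⟨x, hx⟩ ⟨y, hy⟩ h
    simp only [reflectBlock_val (Nat.le_succ (2 * n))] at h
    exact ⟨cartan_affineC_eq_zero (by omega) (by omega),
      cartan_affineC_eq_zero (by omega) (by omega)⟩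

end Instances

/-! ### Product formulas -/

section Products

open Finset

theorem prod_Icc_one_eq_prod_range {R : Type*} [CommMonoid R] (f : ℕ → R) (n : ℕ) :
    ∏ k ∈ Icc 1 n, f k = ∏ i ∈ range n, f (i + 1) := by
  induction n with
  | zero => simp
  | succ n ih => rw [prod_Icc_succ_top (by omega), ih, prod_range_succ]

theorem prod_Icc_two_succ {R : Type*} [CommMonoid R] (f : ℕ → R) (n : ℕ) :
    ∏ k ∈ Icc 2 (n + 1), f k = ∏ k ∈ Icc 1 n, f (k + 1) := by
  induction n with
  | zero => simp
  | succ n ih => rw [prod_Icc_succ_top (by omega), ih, prod_Icc_succ_top (by omega)]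

theorem prod_Icc_one_two_mul {R : Type*} [CommMonoid R] (f : ℕ → R) (n : ℕ) :
    ∏ k ∈ Icc 1 (2 * n), f k = ∏ i ∈ range n, (f (2 * i + 1) * f (2 * i + 2)) := by
  induction n with
  | zero => simp
  | succ n ih =>
    rw [show 2 * (n + 1) = 2 * n + 1 + 1 by ring, prod_Icc_succ_top (by omega),
      prod_Icc_succ_top (by omega), ih, prod_range_succ, mul_assoc]

/-- `(1 - q ^ (n + 1)) ⋯ (1 - q ^ (2 n)) = (1 - q) (1 - q ^ 3) ⋯ (1 - q ^ (2 n - 1)) ·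
(1 + q) ⋯ (1 + q ^ n)`. -/
theorem prod_one_sub_pow_upper {R : Type*} [CommRing R] (q : R) (n : ℕ) :
    ∏ i ∈ range n, (1 - q ^ (n + 1 + i)) =
      ∏ i ∈ range n, ((1 - q ^ (2 * i + 1)) * (1 + q ^ (i + 1))) := by
  induction n with
  | zero => simp
  | succ n ih =>
    have h : (1 - q ^ (n + 1)) * ∏ i ∈ range n, (1 - q ^ (n + 1 + 1 + i)) =
        (∏ i ∈ range n, (1 - q ^ (n + 1 + i))) * (1 - q ^ (2 * n + 1)) := by
      have h1 := prod_range_succ (fun i => 1 - q ^ (n + 1 + i)) n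
      have h2 := prod_range_succ' (fun i => 1 - q ^ (n + 1 + i)) n
      rw [h1, show n + 1 + n = 2 * n + 1 by ring, add_zero] at h2
      rw [h2, mul_comm]
      congr 1
      exact prod_congr rfl fun i _ => by ring
    rw [prod_range_succ, prod_range_succ, ← ih]
    linear_combination (1 + q ^ (n + 1)) * h

/-- `(1 - q ^ (n + 1)) ⋯ (1 - q ^ (2 n + 1)) = (1 - q) (1 - q ^ 3) ⋯ (1 - q ^ (2 n + 1)) ·
(1 + q) ⋯ (1 + q ^ n)`. -/
theorem prod_one_sub_pow_upper_succ {R : Type*} [CommRing R] (q : R) (n : ℕ) :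
    ∏ i ∈ range (n + 1), (1 - q ^ (n + 1 + i)) =
      (∏ i ∈ range (n + 1), (1 - q ^ (2 * i + 1))) * ∏ i ∈ range n, (1 + q ^ (i + 1)) := by
  rw [prod_range_succ, prod_one_sub_pow_upper, prod_mul_distrib, prod_range_succ]
  ring

theorem qInt_mul_one_sub (k : ℕ) (q : ℚ⟦X⟧) : qInt k q * (1 - q) = 1 - q ^ k := by
  rw [qInt, ← geom_sum_mul_neg]

theorem qInt_neg_mul_one_add (k : ℕ) (q : ℚ⟦X⟧) : qInt k (-q) * (1 + q) = 1 - (-q) ^ k := by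
  rw [← qInt_mul_one_sub, sub_neg_eq_add]

theorem qInt_odd_mul_one_add (i : ℕ) (q : ℚ⟦X⟧) :
    qInt (2 * i + 1) (-q) * (1 + q) = 1 + q ^ (2 * i + 1) := by
  rw [qInt_neg_mul_one_add, Odd.neg_pow ⟨i, rfl⟩, sub_neg_eq_add]

/-- The product of the signed `q`-integers `[k]`, for `1 ≤ k ≤ 2 n`. -/
theorem prod_qInt_two_mul (q : ℚ⟦X⟧) (n : ℕ) :
    (∏ k ∈ Icc 1 (2 * n), qInt k ((-1) ^ k * q)) * (1 - q ^ 2) ^ n =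
      ∏ i ∈ range n, ((1 + q ^ (2 * i + 1)) * (1 - q ^ (2 * i + 2))) := by
  have h : (1 - q ^ 2) ^ n = ∏ i ∈ range n, (1 - q ^ 2) := by simp
  rw [prod_Icc_one_two_mul, h, ← prod_mul_distrib]
  refine prod_congr rfl fun i _ => ?_
  rw [Odd.neg_one_pow ⟨i, rfl⟩, Even.neg_one_pow ⟨i + 1, by ring⟩, neg_one_mul, one_mul,
    ← qInt_odd_mul_one_add, ← qInt_mul_one_sub (2 * i + 2)]
  ring

/-- The product of the signed `q`-integers `[k]`, for `2 ≤ k ≤ 2 n + 1`. -/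
theorem prod_qInt_succ_two_mul (q : ℚ⟦X⟧) (n : ℕ) :
    (∏ k ∈ Icc 1 (2 * n), qInt (k + 1) ((-1) ^ (k + 1) * q)) * (1 - q ^ 2) ^ n =
      ∏ i ∈ range n, ((1 + q ^ (2 * i + 3)) * (1 - q ^ (2 * i + 2))) := by
  have h : (1 - q ^ 2) ^ n = ∏ i ∈ range n, (1 - q ^ 2) := by simp
  rw [prod_Icc_one_two_mul, h, ← prod_mul_distrib]
  refine prod_congr rfl fun i _ => ?_
  have h3 := qInt_odd_mul_one_add (i + 1) q
  rw [show 2 * (i + 1) + 1 = 2 * i + 3 by ring] at h3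
  rw [Odd.neg_one_pow (n := 2 * i + 2 + 1) ⟨i + 1, by ring⟩,
    Even.neg_one_pow (n := 2 * i + 1 + 1) ⟨i + 1, by ring⟩, neg_one_mul, one_mul, ← h3,
    show 2 * i + 1 + 1 = 2 * i + 2 by ring, ← qInt_mul_one_sub (2 * i + 2)]
  ring

theorem prod_qInt_two_mul_add_one (q : ℚ⟦X⟧) (n : ℕ) :
    (∏ k ∈ Icc 1 (2 * n + 1), qInt k ((-1) ^ k * q)) * (1 - q ^ 2) ^ n =
      ∏ i ∈ range n, ((1 + q ^ (2 * i + 3)) * (1 - q ^ (2 * i + 2))) := by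
  rw [← prod_qInt_succ_two_mul, prod_Icc_one_eq_prod_range, prod_range_succ',
    prod_Icc_one_eq_prod_range]
  simp [qInt]

/-- The recurring factor is ([2k+1]_q - q^k)(1 - q) = (1 + q^{k+1})(1 - q^k); the three leading
`q`-integers account for the indices below 3. -/
theorem prod_qInt_fork (q : ℚ⟦X⟧) {n : ℕ} (hn : 2 ≤ n) :
    qInt 2 q * qInt 3 (-q) * qInt 4 q * (∏ k ∈ Icc 3 n, (qInt (2 * k + 1) q - q ^ k)) *
      (1 - q) ^ n = ∏ i ∈ range n, ((1 + q ^ (i + 2)) * (1 - q ^ (i + 1))) := by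
  induction n, hn using Nat.le_induction with
  | base =>
    simp [qInt, sum_range_succ, prod_range_succ]
    ring
  | succ n hn ih =>
    rw [prod_Icc_succ_top (by omega), prod_range_succ, ← ih]
    have := qInt_mul_one_sub (2 * (n + 1) + 1) q
    linear_combination qInt 2 q * qInt 3 (-q) * qInt 4 q *
      (∏ k ∈ Icc 3 n, (qInt (2 * k + 1) q - q ^ k)) * (1 - q) ^ n * this

theorem prod_one_add_neg_pow_two_mul (q : ℚ⟦X⟧) (n : ℕ) :
    ∏ k ∈ Icc 1 (2 * n), (1 + (-q) ^ k) =
      ∏ i ∈ range n, ((1 - q ^ (2 * i + 1)) * (1 + q ^ (2 * i + 2))) := by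
  rw [prod_Icc_one_two_mul]
  refine prod_congr rfl fun i _ => ?_
  rw [Odd.neg_pow ⟨i, rfl⟩, Even.neg_pow ⟨i + 1, by ring⟩, sub_eq_add_neg]

theorem prod_mul_inv_mul_prod {ι : Type*} (s : Finset ι) (f g : ι → ℚ⟦X⟧)
    (hg : ∀ k ∈ s, constantCoeff (g k) ≠ 0) :
    (∏ k ∈ s, (f k * (g k)⁻¹)) * ∏ k ∈ s, g k = ∏ k ∈ s, f k := by
  rw [← prod_mul_distrib]
  refine prod_congr rfl fun k hk => ?_
  rw [mul_assoc, PowerSeries.inv_mul_cancel _ (hg k hk), mul_one]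

/-- The computed series and the claimed one are compared as fractions, by cross multiplication. -/
theorem eq_of_mul_eq_of_mul_eq {R : Type*} [CommRing R] [IsDomain R] {U V D E N P : R}
    (hU : U * D = N) (hV : V * E = P) (hD : D ≠ 0) (hE : E ≠ 0) (h : P * D = N * E) : U = V := by
  refine mul_right_cancel₀ (mul_ne_zero hD hE) ?_
  linear_combination E * hU - D * hV - h

theorem ne_zero_of_constantCoeff {f : ℚ⟦X⟧} (h : constantCoeff f ≠ 0) : f ≠ 0 := by
  rintro rfl
  exact h (map_zero _)

theorem denominator_ne_zero (n a b c : ℕ) (hb : 0 < b) (hc : 0 < c) : ((1 - X ^ b) ^ n *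
    ∏ i ∈ range n, (1 - X ^ c * X ^ a * (X ^ b) ^ (n - 1 + i)) : ℚ⟦X⟧) ≠ 0 := by
  apply ne_zero_of_constantCoeff
  simp [map_prod, hb.ne', hc.ne']

end Products

/-! ### The seven unfolding series -/

section Formulas

open Finset

variable {n : ℕ}

theorem constantCoeff_one_add_neg_pow {k : ℕ} (hk : 1 ≤ k) :
    constantCoeff (1 + (-X) ^ k : ℚ⟦X⟧) ≠ 0 := by
  simp [show k ≠ 0 by omega]

/-- The denominators 1 - q^{2(n+2+i)} lack the factor 1 - q^{2n+2} needed for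
`prod_one_sub_pow_upper_succ`. It is supplied by the exceptional index n + 1, since (1 -
(-q)^{n+1})(1 + (-q)^{n+1}) = 1 - q^{2n+2}. -/
theorem unfoldingSeries_fold₁ (hn : 2 ≤ n) :
    unfoldingSeries (affineA (2 * n + 1)).toCoxeterSystem (fold₁ n) =
      qInt (n + 1) (-X) * qInt (n + 1) ((-1) ^ (n + 1) * X) *
        ∏ k ∈ (Icc 1 (2 * n + 1)).erase (n + 1),
          (qInt k ((-1) ^ k * X) * (1 + (-X) ^ k)⁻¹) := by
  have hc : ∀ k ∈ (Icc 1 (2 * n + 1)).erase (n + 1), constantCoeff (1 + (-X) ^ k : ℚ⟦X⟧) ≠ 0 :=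
    fun k hk => constantCoeff_one_add_neg_pow (mem_Icc.1 (mem_of_mem_erase hk)).1
  refine eq_of_mul_eq_of_mul_eq (isFolding_fold₁ hn).2
    ((mul_assoc _ _ _).trans (congrArg _ (prod_mul_inv_mul_prod _ _ _ hc)))
    (denominator_ne_zero _ _ _ _ (by omega) (by omega))
    (prod_ne_zero_iff.2 fun k hk => ne_zero_of_constantCoeff (hc k hk)) ?_
  have hmem : n + 1 ∈ Icc 1 (2 * n + 1) := mem_Icc.2 (by omega)
  rw [mul_assoc (qInt (n + 1) (-X)),
    mul_prod_erase _ (fun k => qInt k ((-1) ^ k * X : ℚ⟦X⟧)) hmem]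
  have hE := mul_prod_erase _ (fun k => (1 + (-X) ^ k : ℚ⟦X⟧)) hmem
  rw [prod_Icc_succ_top (by omega), prod_one_add_neg_pow_two_mul, Odd.neg_pow ⟨n, rfl⟩] at hE
  set E : ℚ⟦X⟧ := ∏ k ∈ (Icc 1 (2 * n + 1)).erase (n + 1), (1 + (-X) ^ k)
  have hP := prod_qInt_two_mul_add_one X n
  have hq := qInt_neg_mul_one_add (n + 1) X
  -- Multiplying by 1 + X clears [n+1]_{-q}, and the second factor restores the erased denominator.
  have hne : ((1 + X) * (1 + (-X) ^ (n + 1)) : ℚ⟦X⟧) ≠ 0 := by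
    apply ne_zero_of_constantCoeff
    simp
  refine mul_right_cancel₀ hne ?_
  have h1 : (1 - X ^ (2 * n + 2) : ℚ⟦X⟧) *
      ∏ i ∈ range n, (1 - X ^ 3 * X ^ 3 * (X ^ 2) ^ (n - 1 + i)) =
      (∏ i ∈ range (n + 1), (1 - (X ^ 2) ^ (2 * i + 1))) *
        ∏ i ∈ range n, (1 + (X ^ 2) ^ (i + 1)) := by
    rw [← prod_one_sub_pow_upper_succ, prod_range_succ', mul_comm, add_zero]
    congr 1
    · refine prod_congr rfl fun i _ => ?_
      rw [← pow_add, ← pow_mul, ← pow_add, ← pow_mul]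
      congr 2
      omega
    · ring
  have h2 : ∏ i ∈ range n, ((1 + X ^ 3 * (X ^ 2) ^ i) * (1 + X ^ 3 * (X ^ 2) ^ i) *
      (1 - (X ^ 2) ^ (i + 1)) : ℚ⟦X⟧) = (∏ i ∈ range n, ((1 + X ^ (2 * i + 3)) *
        (1 - X ^ (2 * i + 2)))) * ∏ i ∈ range n, (1 + X ^ (2 * i + 3)) := by
    rw [← prod_mul_distrib]
    exact prod_congr rfl fun i _ => by ring
  have h3 : (1 + X : ℚ⟦X⟧) * ∏ i ∈ range n, (1 + X ^ (2 * i + 3)) =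
      ∏ i ∈ range (n + 1), (1 + X ^ (2 * i + 1)) := by
    rw [prod_range_succ', mul_comm, mul_zero, zero_add, pow_one]
    congr 1
  have h4 : (∏ i ∈ range (n + 1), (1 - (X ^ 2) ^ (2 * i + 1)) : ℚ⟦X⟧) *
      ∏ i ∈ range n, (1 + (X ^ 2) ^ (i + 1)) =
      (∏ i ∈ range (n + 1), (1 + X ^ (2 * i + 1))) *
      ((∏ i ∈ range n, ((1 - X ^ (2 * i + 1)) * (1 + X ^ (2 * i + 2)))) *
        (1 + -X ^ (2 * n + 1))) := by
    have h5 : ∏ i ∈ range (n + 1), (1 - (X ^ 2) ^ (2 * i + 1) : ℚ⟦X⟧) =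
        (∏ i ∈ range (n + 1), (1 + X ^ (2 * i + 1))) *
          ∏ i ∈ range (n + 1), (1 - X ^ (2 * i + 1)) := by
      rw [← prod_mul_distrib]
      exact prod_congr rfl fun i _ => by ring
    have h6 : ∏ i ∈ range n, (1 + (X ^ 2) ^ (i + 1) : ℚ⟦X⟧) =
        ∏ i ∈ range n, (1 + X ^ (2 * i + 2)) := prod_congr rfl fun i _ => by ring
    rw [h5, h6, prod_range_succ (fun i => (1 - X ^ (2 * i + 1) : ℚ⟦X⟧)), prod_mul_distrib]
    ring
  have h7 : (1 - (-X) ^ (n + 1)) * (1 + (-X) ^ (n + 1)) = (1 - X ^ (2 * n + 2) : ℚ⟦X⟧) := by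
    have : ((-X) ^ (n + 1) : ℚ⟦X⟧) ^ 2 = X ^ (2 * n + 2) := by
      rw [← pow_mul, mul_comm (n + 1), Even.neg_pow ⟨n + 1, by ring⟩]
      ring
    linear_combination -this
  rw [h2, ← hP]
  set D : ℚ⟦X⟧ := ∏ i ∈ range n, (1 - X ^ 3 * X ^ 3 * (X ^ 2) ^ (n - 1 + i))
  set G : ℚ⟦X⟧ := ∏ k ∈ Icc 1 (2 * n + 1), qInt k ((-1) ^ k * X)
  rw [h4, ← h3, ← hE, ← h7, ← hq] at h1
  linear_combination G * (1 - X ^ 2) ^ n * h1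

/-- The denominators are the upper factors of `prod_one_sub_pow_upper` at q², and 1 - q^{2(2i+1)}
cancels one factor 1 + q^{2i+1}. -/
theorem unfoldingSeries_fold₂ (hn : 2 ≤ n) :
    unfoldingSeries (affineA (2 * n)).toCoxeterSystem (fold₂ n) =
      ∏ k ∈ Icc 1 (2 * n), (qInt (k + 1) ((-1) ^ (k + 1) * X) * (1 + (-X) ^ k)⁻¹) := by
  have hc : ∀ k ∈ Icc 1 (2 * n), constantCoeff (1 + (-X) ^ k : ℚ⟦X⟧) ≠ 0 :=
    fun k hk => constantCoeff_one_add_neg_pow (mem_Icc.1 hk).1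
  refine eq_of_mul_eq_of_mul_eq (isFolding_fold₂ hn).2 (prod_mul_inv_mul_prod _ _ _ hc)
    (denominator_ne_zero _ _ _ _ (by omega) (by omega))
    (prod_ne_zero_iff.2 fun k hk => ne_zero_of_constantCoeff (hc k hk)) ?_
  have h1 : ∏ i ∈ range n, (1 - X ^ 1 * X ^ 3 * (X ^ 2) ^ (n - 1 + i) : ℚ⟦X⟧) =
      ∏ i ∈ range n, ((1 - (X ^ 2) ^ (2 * i + 1)) * (1 + (X ^ 2) ^ (i + 1))) := by
    rw [← prod_one_sub_pow_upper]
    refine prod_congr rfl fun i _ => ?_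
    rw [← pow_add, ← pow_mul, ← pow_add, ← pow_mul]
    congr 2
    omega
  rw [← mul_assoc, prod_qInt_succ_two_mul, h1, prod_one_add_neg_pow_two_mul, ← prod_mul_distrib,
    ← prod_mul_distrib]
  exact prod_congr rfl fun i _ => by ring

/-- As [1] = 1, the numerator may start at k = 1. The denominators are the upper factors at q² of
`prod_one_sub_pow_upper_succ`, for n - 1 in place of n. -/
theorem unfoldingSeries_fold₃ (hn : 2 ≤ n) :
    unfoldingSeries (affineA (2 * n - 1)).toCoxeterSystem (fold₃ n) =
      ∏ k ∈ Icc 2 (2 * n), (qInt k ((-1) ^ k * X) * (1 + (-X) ^ (k - 1))⁻¹) := by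
  have hc : ∀ k ∈ Icc 2 (2 * n), constantCoeff (1 + (-X) ^ (k - 1) : ℚ⟦X⟧) ≠ 0 :=
    fun k hk => constantCoeff_one_add_neg_pow (by have := (mem_Icc.1 hk).1; omega)
  refine eq_of_mul_eq_of_mul_eq (isFolding_fold₃ hn).2 (prod_mul_inv_mul_prod _ _ _ hc)
    (denominator_ne_zero _ _ _ _ (by omega) (by omega))
    (prod_ne_zero_iff.2 fun k hk => ne_zero_of_constantCoeff (hc k hk)) ?_
  clear hc
  obtain ⟨m, rfl⟩ : ∃ m, n = m + 1 := ⟨n - 1, by omega⟩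
  have hP : (∏ k ∈ Icc 2 (2 * (m + 1)), qInt k ((-1) ^ k * X)) =
      ∏ k ∈ Icc 1 (2 * (m + 1)), qInt k ((-1) ^ k * X) := by
    rw [show 2 * (m + 1) = 2 * m + 1 + 1 by ring, prod_Icc_two_succ,
      prod_Icc_one_eq_prod_range _ (2 * m + 1 + 1), prod_range_succ', prod_Icc_one_eq_prod_range]
    simp [qInt]
  have hE : (∏ k ∈ Icc 2 (2 * (m + 1)), (1 + (-X) ^ (k - 1)) : ℚ⟦X⟧) =
      (∏ i ∈ range (m + 1), (1 - X ^ (2 * i + 1))) * ∏ i ∈ range m, (1 + X ^ (2 * i + 2)) := by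
    rw [show 2 * (m + 1) = 2 * m + 1 + 1 by ring, prod_Icc_two_succ]
    simp only [Nat.add_sub_cancel]
    rw [prod_Icc_succ_top (by omega), prod_one_add_neg_pow_two_mul, prod_mul_distrib,
      prod_range_succ _ m, Odd.neg_pow ⟨m, rfl⟩]
    ring
  have h1 : ∏ i ∈ range (m + 1), (1 - X ^ 1 * X ^ 1 * (X ^ 2) ^ (m + 1 - 1 + i) : ℚ⟦X⟧) =
      (∏ i ∈ range (m + 1), (1 - (X ^ 2) ^ (2 * i + 1))) *
        ∏ i ∈ range m, (1 + (X ^ 2) ^ (i + 1)) := by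
    rw [← prod_one_sub_pow_upper_succ]
    refine prod_congr rfl fun i _ => ?_
    rw [← pow_add, ← pow_mul, ← pow_add, ← pow_mul]
    congr 2
    omega
  have h3 : ∏ i ∈ range m, (1 + (X ^ 2) ^ (i + 1) : ℚ⟦X⟧) =
      ∏ i ∈ range m, (1 + X ^ (2 * i + 2)) := prod_congr rfl fun i _ => by ring
  rw [hP, hE, ← mul_assoc, prod_qInt_two_mul, h1, h3, ← mul_assoc, ← mul_assoc,
    ← prod_mul_distrib, ← prod_mul_distrib]
  congr 1
  exact prod_congr rfl fun i _ => by ring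

/-- The factor [2]_{-q^{n+1}} = 1 - q^{n+1} completes the denominators 1 - q^{n+2}, …, 1 - q^{2n+1}
to the full upper product, which then splits into odd factors and factors 1 + q^i. -/
theorem unfoldingSeries_fold₄ (hn : 2 ≤ n) :
    unfoldingSeries (affineB (n + 1)).toCoxeterSystem (fold₄ n) =
      qInt 2 X * qInt 3 (-X) * qInt 4 X * qInt 2 (-X ^ (n + 1)) *
        ((1 - X) * (1 - X ^ 3) * (1 - X ^ 5))⁻¹ *
        ∏ k ∈ Icc 3 n, ((qInt (2 * k + 1) X - X ^ k) * (1 - X ^ (2 * k + 1))⁻¹) := by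
  have hc : ∀ k ∈ Icc 3 n, constantCoeff (1 - X ^ (2 * k + 1) : ℚ⟦X⟧) ≠ 0 := by
    intro k hk
    simp
  have hc' : constantCoeff ((1 - X) * (1 - X ^ 3) * (1 - X ^ 5) : ℚ⟦X⟧) ≠ 0 := by simp
  refine eq_of_mul_eq_of_mul_eq
    (E := ((1 - X) * (1 - X ^ 3) * (1 - X ^ 5)) * ∏ k ∈ Icc 3 n, (1 - X ^ (2 * k + 1)))
    (P := qInt 2 X * qInt 3 (-X) * qInt 4 X * qInt 2 (-X ^ (n + 1)) *
      ∏ k ∈ Icc 3 n, (qInt (2 * k + 1) X - X ^ k)) (isFolding_fold₄ hn).2 ?_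
    (denominator_ne_zero _ _ _ _ (by omega) (by omega))
    (mul_ne_zero (ne_zero_of_constantCoeff hc')
      (prod_ne_zero_iff.2 fun k hk => ne_zero_of_constantCoeff (hc k hk))) ?_
  · have hF := prod_mul_inv_mul_prod _ (fun k => qInt (2 * k + 1) X - X ^ k) _ hc
    rw [← hF, mul_mul_mul_comm, mul_assoc (_ * _) _⁻¹, PowerSeries.inv_mul_cancel _ hc', mul_one]
  have h := prod_qInt_fork X hn
  have h0 : qInt 2 (-X ^ (n + 1)) = 1 - X ^ (n + 1) := by
    simp [qInt, sum_range_succ, sub_eq_add_neg]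
  have hE : ((1 - X) * (1 - X ^ 3) * (1 - X ^ 5) : ℚ⟦X⟧) * ∏ k ∈ Icc 3 n, (1 - X ^ (2 * k + 1)) =
      ∏ i ∈ range (n + 1), (1 - X ^ (2 * i + 1)) := by
    clear h h0 hc hc'
    induction n, hn using Nat.le_induction with
    | base => simp [prod_range_succ]
    | succ n hn ih => rw [prod_Icc_succ_top (by omega), prod_range_succ, ← ih, ← mul_assoc]
  have h1 : (1 - X ^ (n + 1) : ℚ⟦X⟧) *
      ∏ i ∈ range n, (1 - X ^ 2 * X ^ 1 * (X ^ 1) ^ (n - 1 + i)) =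
      (∏ i ∈ range (n + 1), (1 - X ^ (2 * i + 1))) * ∏ i ∈ range n, (1 + X ^ (i + 1)) := by
    rw [← prod_one_sub_pow_upper_succ, prod_range_succ', mul_comm, add_zero]
    congr 1
    refine prod_congr rfl fun i _ => ?_
    rw [← pow_add, ← pow_mul, ← pow_add]
    congr 2
    omega
  have h2 : ∏ i ∈ range n, ((1 + X ^ 1 * (X ^ 1) ^ i) * (1 + X ^ 2 * (X ^ 1) ^ i) *
      (1 - (X ^ 1) ^ (i + 1)) : ℚ⟦X⟧) = (∏ i ∈ range n, ((1 + X ^ (i + 2)) *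
        (1 - X ^ (i + 1)))) * ∏ i ∈ range n, (1 + X ^ (i + 1)) := by
    rw [← prod_mul_distrib]
    exact prod_congr rfl fun i _ => by ring
  rw [h0, hE, h2, ← h, pow_one]
  rw [pow_one] at h1
  linear_combination (qInt 2 X * qInt 3 (-X) * qInt 4 X *
    (∏ k ∈ Icc 3 n, (qInt (2 * k + 1) X - X ^ k)) * (1 - X) ^ n) * h1

/-- Here, and for the two foldings of type C̃ below, the denominators already agree factor by
factor, so only the numerator is rewritten. -/
theorem unfoldingSeries_fold₅ (hn : 2 ≤ n) :
    unfoldingSeries (affineD (n + 2)).toCoxeterSystem (fold₅ n) =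
      qInt 2 X * qInt 3 (-X) * qInt 4 X *
        (∏ k ∈ Icc 3 n, (qInt (2 * k + 1) X - X ^ k)) *
        ∏ k ∈ Icc 1 n, ((1 + X ^ (k + 1)) * (1 - X ^ (n + k + 2))⁻¹) := by
  have hc : ∀ k ∈ Icc 1 n, constantCoeff (1 - X ^ (n + k + 2) : ℚ⟦X⟧) ≠ 0 := by
    intro k hk
    simp
  refine eq_of_mul_eq_of_mul_eq (isFolding_fold₅ hn).2
    ((mul_assoc _ _ _).trans (congrArg _ (prod_mul_inv_mul_prod _ _ _ hc)))
    (denominator_ne_zero _ _ _ _ (by omega) (by omega))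
    (prod_ne_zero_iff.2 fun k hk => ne_zero_of_constantCoeff (hc k hk)) ?_
  have h := prod_qInt_fork X hn
  have h1 : ∏ i ∈ range n, (1 - X ^ 2 * X ^ 2 * (X ^ 1) ^ (n - 1 + i) : ℚ⟦X⟧) =
      ∏ k ∈ Icc 1 n, (1 - X ^ (n + k + 2)) := by
    rw [prod_Icc_one_eq_prod_range]
    refine prod_congr rfl fun i _ => ?_
    rw [← pow_add, ← pow_mul, ← pow_add]
    congr 2
    omega
  have h2 : ∏ i ∈ range n, ((1 + X ^ 2 * (X ^ 1) ^ i) * (1 + X ^ 2 * (X ^ 1) ^ i) *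
      (1 - (X ^ 1) ^ (i + 1)) : ℚ⟦X⟧) = (∏ i ∈ range n, ((1 + X ^ (i + 2)) *
        (1 - X ^ (i + 1)))) * ∏ k ∈ Icc 1 n, (1 + X ^ (k + 1)) := by
    rw [prod_Icc_one_eq_prod_range, ← prod_mul_distrib]
    exact prod_congr rfl fun i _ => by ring
  rw [h1, h2, ← h, pow_one]
  ring

theorem unfoldingSeries_fold₆ (hn : 2 ≤ n) :
    unfoldingSeries (affineC (2 * n + 1)).toCoxeterSystem (fold₆ n) =
      (∏ k ∈ Icc 1 (2 * n + 1), qInt k ((-1) ^ k * X)) *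
        ∏ k ∈ Icc 1 n, ((1 + X ^ (2 * k)) * (1 - X ^ (2 * (n + k) + 1))⁻¹) := by
  have hc : ∀ k ∈ Icc 1 n, constantCoeff (1 - X ^ (2 * (n + k) + 1) : ℚ⟦X⟧) ≠ 0 := by
    intro k hk
    simp
  refine eq_of_mul_eq_of_mul_eq (isFolding_fold₆ hn).2
    ((mul_assoc _ _ _).trans (congrArg _ (prod_mul_inv_mul_prod _ _ _ hc)))
    (denominator_ne_zero _ _ _ _ (by omega) (by omega))
    (prod_ne_zero_iff.2 fun k hk => ne_zero_of_constantCoeff (hc k hk)) ?_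
  have h := prod_qInt_two_mul_add_one X n
  have h1 : ∏ i ∈ range n, (1 - X ^ 3 * X ^ 2 * (X ^ 2) ^ (n - 1 + i) : ℚ⟦X⟧) =
      ∏ k ∈ Icc 1 n, (1 - X ^ (2 * (n + k) + 1)) := by
    rw [prod_Icc_one_eq_prod_range]
    refine prod_congr rfl fun i _ => ?_
    rw [← pow_add, ← pow_mul, ← pow_add]
    congr 2
    omega
  have h2 : ∏ i ∈ range n, ((1 + X ^ 2 * (X ^ 2) ^ i) * (1 + X ^ 3 * (X ^ 2) ^ i) *
      (1 - (X ^ 2) ^ (i + 1)) : ℚ⟦X⟧) = (∏ i ∈ range n, ((1 + X ^ (2 * i + 3)) *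
        (1 - X ^ (2 * i + 2)))) * ∏ k ∈ Icc 1 n, (1 + X ^ (2 * k)) := by
    rw [prod_Icc_one_eq_prod_range, ← prod_mul_distrib]
    exact prod_congr rfl fun i _ => by ring
  rw [h1, h2, ← h]
  ring

theorem unfoldingSeries_fold₇ (hn : 2 ≤ n) :
    unfoldingSeries (affineC (2 * n)).toCoxeterSystem (fold₇ n) =
      (∏ k ∈ Icc 1 (2 * n), qInt k ((-1) ^ k * X)) *
        ∏ k ∈ Icc 1 n, ((1 + X ^ (2 * k)) * (1 - X ^ (2 * (n + k) - 1))⁻¹) := by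
  have hc : ∀ k ∈ Icc 1 n, constantCoeff (1 - X ^ (2 * (n + k) - 1) : ℚ⟦X⟧) ≠ 0 := by
    intro k hk
    simp [show 2 * (n + k) - 1 ≠ 0 by omega]
  refine eq_of_mul_eq_of_mul_eq (isFolding_fold₇ hn).2
    ((mul_assoc _ _ _).trans (congrArg _ (prod_mul_inv_mul_prod _ _ _ hc)))
    (denominator_ne_zero _ _ _ _ (by omega) (by omega))
    (prod_ne_zero_iff.2 fun k hk => ne_zero_of_constantCoeff (hc k hk)) ?_
  have h := prod_qInt_two_mul X n
  have h1 : ∏ i ∈ range n, (1 - X ^ 1 * X ^ 2 * (X ^ 2) ^ (n - 1 + i) : ℚ⟦X⟧) =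
      ∏ k ∈ Icc 1 n, (1 - X ^ (2 * (n + k) - 1)) := by
    rw [prod_Icc_one_eq_prod_range]
    refine prod_congr rfl fun i _ => ?_
    rw [← pow_add, ← pow_mul, ← pow_add]
    congr 2
    omega
  have h2 : ∏ i ∈ range n, ((1 + X ^ 2 * (X ^ 2) ^ i) * (1 + X ^ 1 * (X ^ 2) ^ i) *
      (1 - (X ^ 2) ^ (i + 1)) : ℚ⟦X⟧) = (∏ i ∈ range n, ((1 + X ^ (2 * i + 1)) *
        (1 - X ^ (2 * i + 2)))) * ∏ k ∈ Icc 1 n, (1 + X ^ (2 * k)) := by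
    rw [prod_Icc_one_eq_prod_range, ← prod_mul_distrib]
    exact prod_congr rfl fun i _ => by ring
  rw [h1, h2, ← h]
  ring

end Formulas

end CoxeterFolding

/-- All power series that are inverted below have constant coefficient `1`. -/
theorem theorem1p8 (n : ℕ) (hn : 2 ≤ n) :
    (IsFolding (affineA (2 * n + 1)).toCoxeterSystem (reflectBlock n (2 * n + 1) (2 * n + 1))
        (fold₁ n) (affineC n) ∧
      unfoldingSeries (affineA (2 * n + 1)).toCoxeterSystem (fold₁ n) =
        qInt (n + 1) (-X) * qInt (n + 1) ((-1) ^ (n + 1) * X) *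
          ∏ k ∈ (Finset.Icc 1 (2 * n + 1)).erase (n + 1),
            (qInt k ((-1) ^ k * X) * (1 + (-X) ^ k)⁻¹)) ∧
    (IsFolding (affineA (2 * n)).toCoxeterSystem (reflectBlock n (2 * n) (2 * n))
        (fold₂ n) (affineC n) ∧
      unfoldingSeries (affineA (2 * n)).toCoxeterSystem (fold₂ n) =
        ∏ k ∈ Finset.Icc 1 (2 * n),
          (qInt (k + 1) ((-1) ^ (k + 1) * X) * (1 + (-X) ^ k)⁻¹)) ∧
    (IsFolding (affineA (2 * n - 1)).toCoxeterSystem (reflectBlock n (2 * n - 1) (2 * n))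
        (fold₃ n) (affineC n) ∧
      unfoldingSeries (affineA (2 * n - 1)).toCoxeterSystem (fold₃ n) =
        ∏ k ∈ Finset.Icc 2 (2 * n),
          (qInt k ((-1) ^ k * X) * (1 + (-X) ^ (k - 1))⁻¹)) ∧
    (IsFolding (affineB (n + 1)).toCoxeterSystem (forkBlock n) (fold₄ n) (affineC n) ∧
      unfoldingSeries (affineB (n + 1)).toCoxeterSystem (fold₄ n) =
        qInt 2 X * qInt 3 (-X) * qInt 4 X * qInt 2 (-X ^ (n + 1)) *
          ((1 - X) * (1 - X ^ 3) * (1 - X ^ 5))⁻¹ *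
          ∏ k ∈ Finset.Icc 3 n, ((qInt (2 * k + 1) X - X ^ k) * (1 - X ^ (2 * k + 1))⁻¹)) ∧
    (IsFolding (affineD (n + 2)).toCoxeterSystem (doubleForkBlock n) (fold₅ n) (affineC n) ∧
      unfoldingSeries (affineD (n + 2)).toCoxeterSystem (fold₅ n) =
        qInt 2 X * qInt 3 (-X) * qInt 4 X *
          (∏ k ∈ Finset.Icc 3 n, (qInt (2 * k + 1) X - X ^ k)) *
          ∏ k ∈ Finset.Icc 1 n, ((1 + X ^ (k + 1)) * (1 - X ^ (n + k + 2))⁻¹)) ∧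
    (IsFolding (affineC (2 * n + 1)).toCoxeterSystem (reflectBlock n (2 * n + 1) (2 * n + 1))
        (fold₆ n) (affineC n) ∧
      unfoldingSeries (affineC (2 * n + 1)).toCoxeterSystem (fold₆ n) =
        (∏ k ∈ Finset.Icc 1 (2 * n + 1), qInt k ((-1) ^ k * X)) *
          ∏ k ∈ Finset.Icc 1 n, ((1 + X ^ (2 * k)) * (1 - X ^ (2 * (n + k) + 1))⁻¹)) ∧
    (IsFolding (affineC (2 * n)).toCoxeterSystem (reflectBlock n (2 * n) (2 * n))
        (fold₇ n) (affineC n) ∧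
      unfoldingSeries (affineC (2 * n)).toCoxeterSystem (fold₇ n) =
        (∏ k ∈ Finset.Icc 1 (2 * n), qInt k ((-1) ^ k * X)) *
          ∏ k ∈ Finset.Icc 1 n, ((1 + X ^ (2 * k)) * (1 - X ^ (2 * (n + k) - 1))⁻¹)) := by
  exact ⟨⟨(isFolding_fold₁ hn).1, unfoldingSeries_fold₁ hn⟩,
    ⟨(isFolding_fold₂ hn).1, unfoldingSeries_fold₂ hn⟩,
    ⟨(isFolding_fold₃ hn).1, unfoldingSeries_fold₃ hn⟩,
    ⟨(isFolding_fold₄ hn).1, unfoldingSeries_fold₄ hn⟩,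
    ⟨(isFolding_fold₅ hn).1, unfoldingSeries_fold₅ hn⟩,
    ⟨(isFolding_fold₆ hn).1, unfoldingSeries_fold₆ hn⟩,
    ⟨(isFolding_fold₇ hn).1, unfoldingSeries_fold₇ hn⟩⟩
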